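/- For a tuple $x$ of variables let $\mathbb{C}\{x\}$ be the ring of convergent power series (germs at $0$ of holomorphic functions), and let $\mathcal{N}\{x\}\subset\mathbb{C}\{x\}$ be the subring of those that are algebraic over $\mathbb{C}[x]$; for $\eta\in\mathbb{C}\{x\}$, $\bar\eta$ is the series with complex conjugate coefficients. Let $N=n+d$ and let $(M,0)\subset\mathbb{C}^N$ be a germ of a generic real-algebraic submanifold of CR dimension $n$ and codimension $d$. Assume that $M$ is of constant orbit dimension at $0$, i.e. that the dimension of the local CR orbit of $q$ (the dimension at $q$ of the space of values of the Lie algebra generated by the sections of $T^{1,0}M$ and $T^{0,1}M$) is constant for $q\in M$ near $0$; let $c$ be the codimension of these orbits in $M$. Assume that $Z=(z,w,u)\in\mathbb{C}^n\times\mathbb{C}^{d-c}\times\mathbb{C}^c$ are normal coordinates adapted to the orbits: $M$ is given near $0$ by $$(w,u)=\Theta(z,\bar z,\bar w,\bar u)=\bigl(Q(z,\bar z,\bar w,\bar u),\bar u\bigr),$$ where $Q=Q(z,\chi,\tau,u)$ is a $\mathbb{C}^{d-c}$-valued algebraic map near $0$ with $\Theta(z,0,\eta)=\Theta(0,\chi,\eta)=\eta$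 and $\Theta(z,\chi,\bar\Theta(\chi,z,\eta))=\eta$. Let $\mathcal{M}=\{(Z,\zeta):\sigma=\bar\Theta(\chi,z,\eta)\}$, with $Z=(z,\eta)$, $\zeta=(\chi,\sigma)$, be the complexification of $M$ (a germ at $0$ in $\mathbb{C}^{2N}$), and let $\mathbb{C}\{\mathcal{M}\}$ be the quotient of $\mathbb{C}\{Z,\zeta\}$ by the ideal of the series vanishing on $\mathcal{M}$. Let $f\colon(\mathbb{C}^N,0)\to(\mathbb{C}^{N'},0)$ be a germ of a holomorphic map satisfying $(\clubsuit)$ there is an integer $\ell_0$ such that each component $f_s(Z)$ of $f$, regarded as an element of $\mathbb{C}\{\mathcal{M}\}$, is algebraic over the quotient field of the image in $\mathbb{C}\{\mathcal{M}\}$ of the subring of $\mathbb{C}\{Z,\zeta\}$ generated by $\mathcal{N}\{Z,\zeta\}$ and the components of the derivatives $\partial^\gamma\bar f(\zeta)$, $|\gamma|\le\ell_0$. Then each component of $f$ is algebraic over the quotient field of $\mathcal{A}^f=\bigcup_{\ell\ge0}\mathcal{A}^f_\ell$, where $\mathcal{A}^f_\ell$ is the subring of $\mathbb{C}\{z,w,u\}$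 generated by $\mathcal{N}\{z,w,u\}$ and the components of the series $\partial^\alpha f(0,u)$ (the derivative $\partial^\alpha f$ evaluated at $(z,w)=(0,0)$), $\alpha\in\mathbb{N}^N$, $|\alpha|\le\ell$. -/

import Mathlib

open Filter Topology

noncomputable section

namespace KeyAlg

/-! ### Convergent power series, identified with germs of holomorphic functions at the origin -/

section Germs

variable {ι : Type} [Fintype ι]

/-- The ring `ℂ{x}`, `x = (x_i)_{i ∈ ι}`, of convergent power series, i.e. of germs at `0 ∈ ℂ^ι`
of holomorphic functions. -/
def HolGerm (ι : Type) [Fintype ι] : Subring ((𝓝 (0 : ι → ℂ)).Germ ℂ) where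
  carrier := {φ | ∃ g : (ι → ℂ) → ℂ, AnalyticAt ℂ g 0 ∧ φ = (g : (𝓝 (0 : ι → ℂ)).Germ ℂ)}
  mul_mem' := by
    rintro _ _ ⟨g, hg, rfl⟩ ⟨h, hh, rfl⟩
    exact ⟨g * h, hg.mul hh, rfl⟩
  one_mem' := ⟨fun _ => 1, analyticAt_const, rfl⟩
  add_mem' := by
    rintro _ _ ⟨g, hg, rfl⟩ ⟨h, hh, rfl⟩
    exact ⟨g + h, hg.add hh, rfl⟩
  zero_mem' := ⟨fun _ => 0, analyticAt_const, rfl⟩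
  neg_mem' := by
    rintro _ ⟨g, hg, rfl⟩
    exact ⟨-g, hg.neg, rfl⟩

/-- The germ at `0` of a function that is holomorphic near `0`. -/
def germOf (g : (ι → ℂ) → ℂ) (hg : AnalyticAt ℂ g 0) : HolGerm ι :=
  ⟨(g : (𝓝 (0 : ι → ℂ)).Germ ℂ), g, hg, rfl⟩

theorem analyticAt_mvPolynomial (p : MvPolynomial ι ℂ) :
    AnalyticAt ℂ (fun x : ι → ℂ => MvPolynomial.eval x p) 0 :=
  AnalyticOnNhd.eval_mvPolynomial p 0 (Set.mem_univ _)

/-- The inclusion `ℂ[x] → ℂ{x}`. -/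
def polyHom (ι : Type) [Fintype ι] : MvPolynomial ι ℂ →+* HolGerm ι where
  toFun p := germOf (fun x => MvPolynomial.eval x p) (analyticAt_mvPolynomial p)
  map_one' := by
    apply Subtype.ext
    simp only [germOf, map_one]
    rfl
  map_mul' p q := by
    apply Subtype.ext
    simp only [germOf, map_mul]
    rfl
  map_zero' := by
    apply Subtype.ext
    simp only [germOf, map_zero]
    rfl
  map_add' p q := by
    apply Subtype.ext
    simp only [germOf, map_add]
    rfl

/-- The set `𝒩{x}` of algebraic (Nash) power series: the elements of `ℂ{x}` that are algebraic over
the subring `ℂ[x]`. -/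
def nash (ι : Type) [Fintype ι] : Set (HolGerm ι) :=
  {φ | IsAlgebraic (polyHom ι).range φ}

/-- `g` is holomorphic near `0` and its germ is algebraic. -/
def IsNash (g : (ι → ℂ) → ℂ) : Prop :=
  ∃ hg : AnalyticAt ℂ g 0, germOf g hg ∈ nash ι

/-- The function `ḡ(x) = conj (g (conj x))`, whose Taylor coefficients at `0` are the complex
conjugates of those of `g`. -/
def conjFun (g : (ι → ℂ) → ℂ) : (ι → ℂ) → ℂ := fun x => star (g (star x))

/-- `iterPartial [i₁, …, i_k] g = ∂/∂x_{i₁} ⋯ ∂/∂x_{i_k} g`. As lists of length `k` vary, this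
gives exactly the derivatives `∂^α g` with `|α| = k`. -/
def iterPartial [DecidableEq ι] : List ι → ((ι → ℂ) → ℂ) → ((ι → ℂ) → ℂ)
  | [], g => g
  | i :: L, g => fun x => fderiv ℂ (iterPartial L g) x (Pi.single i 1)

theorem analyticAt_iterPartial [DecidableEq ι] (L : List ι) {g : (ι → ℂ) → ℂ}
    (hg : AnalyticAt ℂ g 0) : AnalyticAt ℂ (iterPartial L g) 0 := by
  induction L with
  | nil => exact hg
  | cons i L ih =>
    exact ((ContinuousLinearMap.apply ℂ ℂ (Pi.single i 1 : ι → ℂ)).analyticAt _).comp ih.fderiv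

/-- The multilinear map `v ↦ conj (P (conj v))`. -/
def conjMultilinear {k : ℕ} (P : ContinuousMultilinearMap ℂ (fun _ : Fin k => ι → ℂ) ℂ) :
    ContinuousMultilinearMap ℂ (fun _ : Fin k => ι → ℂ) ℂ where
  toFun v := star (P fun j => star (v j))
  map_update_add' := by
    intro _ v j x y
    have key : ∀ x : ι → ℂ, (fun l => star (Function.update v j x l)) =
        Function.update (fun l => star (v l)) j (star x) := by
      intro x
      funext l
      by_cases h : l = j
      · subst h; simp
      · simp [h]
    simp only [key, star_add, P.map_update_add]
  map_update_smul' := by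
    intro _ v j a x
    have key : ∀ x : ι → ℂ, (fun l => star (Function.update v j x l)) =
        Function.update (fun l => star (v l)) j (star x) := by
      intro x
      funext l
      by_cases h : l = j
      · subst h; simp
      · simp [h]
    simp only [key, star_smul, P.map_update_smul, star_star]
  cont := by
    refine continuous_star.comp (P.cont.comp ?_)
    exact continuous_pi fun j => continuous_star.comp (continuous_apply j)

theorem norm_conjMultilinear_le {k : ℕ}
    (P : ContinuousMultilinearMap ℂ (fun _ : Fin k => ι → ℂ) ℂ) :
    ‖conjMultilinear P‖ ≤ ‖P‖ := by
  refine ContinuousMultilinearMap.opNorm_le_bound (norm_nonneg _) fun v => ?_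
  have h := P.le_opNorm fun j => star (v j)
  simp only [norm_star] at h
  change ‖star (P fun j => star (v j))‖ ≤ _
  rwa [norm_star]

theorem analyticAt_conjFun {g : (ι → ℂ) → ℂ} (hg : AnalyticAt ℂ g 0) :
    AnalyticAt ℂ (conjFun g) 0 := by
  obtain ⟨p, r, hp⟩ := hg
  refine ⟨fun k => conjMultilinear (p k), r, ?_, hp.r_pos, ?_⟩
  · refine hp.r_le.trans ?_
    refine FormalMultilinearSeries.radius_le_of_le (fun k => norm_conjMultilinear_le _)
  · intro y hy
    have hy' : star y ∈ Metric.eball (0 : ι → ℂ) r := by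
      simpa [Metric.mem_eball, edist_zero_right, enorm, nnnorm_star] using hy
    have h := hp.hasSum hy'
    have h2 : HasSum (fun k => star (p k fun _ => star y)) (star (g (0 + star y))) := h.star
    have h3 : conjFun g (0 + y) = star (g (0 + star y)) := by simp [conjFun]
    rw [h3]
    exact h2

end Germs

/-! ### Real submanifolds of `ℂ^ι`, complex tangent vectors, dimension of the CR orbits -/

section CR

variable {ι : Type} [Fintype ι]

/-- `M` is, near `0 ∈ M`, a generic real-algebraic submanifold of `ℂ^ι` of (real) codimension `d`:
near `0` it is the zero set of `d` real-valued functions `ρ_j(Z) = R_j(Z, Z̄)`, with `R_j` an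
algebraic power series in `(Z, ζ)`, such that the complex covectors `∂ρ_j/∂Z (0)` are linearly
independent over `ℂ`. -/
def IsGenericRealAlgebraic [DecidableEq ι] (M : Set (ι → ℂ)) (d : ℕ) : Prop :=
  0 ∈ M ∧ ∃ R : Fin d → (ι ⊕ ι → ℂ) → ℂ,
    (∀ j, IsNash (R j)) ∧
    (∀ j, ∀ᶠ Z : ι → ℂ in 𝓝 0, (R j (Sum.elim Z (star Z))).im = 0) ∧
    (∀ᶠ Z : ι → ℂ in 𝓝 0, Z ∈ M ↔ ∀ j, R j (Sum.elim Z (star Z)) = 0) ∧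
    LinearIndependent ℂ fun (j : Fin d) (i : ι) =>
      fderiv ℂ (R j) 0 (Pi.single (Sum.inl i) 1)

/-- The complex tangent space `T_q M ∩ i T_q M` of `M` at `q`; for a submanifold, the tangent cone
is the (real) tangent space. -/
def complexTangent (M : Set (ι → ℂ)) (q : ι → ℂ) : Set (ι → ℂ) :=
  {v | v ∈ tangentConeAt ℝ M q ∧ Complex.I • v ∈ tangentConeAt ℝ M q}

/-- The real Lie algebra generated by the germs at `q` of real-analytic sections of the complex
tangent bundle of `M`; a section over `M` is given by a real-analytic vector field on a
neighbourhood of `q` in `ℂ^ι` that extends it (the values on `M` of a bracket of fields tangent to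
`M` do not depend on the extensions). Its complexification is the Lie algebra generated by the
sections of `T^{1,0}M` and `T^{0,1}M`. -/
inductive InCRLieAlgebra (M : Set (ι → ℂ)) (q : ι → ℂ) : ((ι → ℂ) → (ι → ℂ)) → Prop
  | section_mem (X : (ι → ℂ) → (ι → ℂ)) (hX : AnalyticAt ℝ X q)
      (hM : ∀ᶠ p in 𝓝[M] q, X p ∈ complexTangent M p) : InCRLieAlgebra M q X
  | add (X Y : (ι → ℂ) → (ι → ℂ)) :
      InCRLieAlgebra M q X → InCRLieAlgebra M q Y → InCRLieAlgebra M q (X + Y)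
  | smul (a : ℝ) (X : (ι → ℂ) → (ι → ℂ)) : InCRLieAlgebra M q X → InCRLieAlgebra M q (a • X)
  | bracket (X Y : (ι → ℂ) → (ι → ℂ)) :
      InCRLieAlgebra M q X → InCRLieAlgebra M q Y →
        InCRLieAlgebra M q (VectorField.lieBracket ℝ X Y)

/-- The tangent space at `q` of the local CR orbit of `q`: the space of values at `q` of the
elements of the Lie algebra above. -/
def orbitTangent (M : Set (ι → ℂ)) (q : ι → ℂ) : Submodule ℝ (ι → ℂ) :=
  Submodule.span ℝ {v | ∃ X, InCRLieAlgebra M q X ∧ v = X q}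

/-- The (real) dimension of the local CR orbit of `q` in `M`. -/
def orbitDim (M : Set (ι → ℂ)) (q : ι → ℂ) : ℕ := Module.finrank ℝ (orbitTangent M q)

/-- The dimension of the local CR orbits is constant on a neighbourhood of `p` in `M`. -/
def HasConstantOrbitDim (M : Set (ι → ℂ)) (p : ι → ℂ) : Prop :=
  ∀ᶠ q in 𝓝[M] p, orbitDim M q = orbitDim M p

end CR

/-! ### Normal coordinates `Z = (z, w, u) ∈ ℂ^n × ℂ^m × ℂ^c` -/

section Coordinates

variable {n m c : ℕ}

/-- The index set of the coordinates `(z, w, u)` of `ℂ^n × ℂ^m × ℂ^c`. -/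
abbrev Idx (n m c : ℕ) : Type := Fin n ⊕ (Fin m ⊕ Fin c)

/-- The point `(z, w, u)`. -/
def pt (z : Fin n → ℂ) (w : Fin m → ℂ) (u : Fin c → ℂ) : Idx n m c → ℂ :=
  Sum.elim z (Sum.elim w u)

/-- The `z`-part of a point. -/
def zPart (Z : Idx n m c → ℂ) : Fin n → ℂ := fun i => Z (Sum.inl i)

/-- The `w`-part of a point. -/
def wPart (Z : Idx n m c → ℂ) : Fin m → ℂ := fun i => Z (Sum.inr (Sum.inl i))

/-- The `u`-part of a point. -/
def uPart (Z : Idx n m c → ℂ) : Fin c → ℂ := fun i => Z (Sum.inr (Sum.inr i))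

/-- `(z, w, u)` are normal coordinates for the germ of `M` at `0`, adapted to the foliation by
`u = const`: `M` is given near `0` by `w = Q(z, z̄, w̄, ū)`, `u = ū`, with `Q = Q(z, χ, τ, u)` an
algebraic map near `0 ∈ ℂ^n × ℂ^(n+m+c)`, where `Θ = (Q, u)` satisfies the normality conditions
`Θ(z, 0, η) = Θ(0, χ, η) = η` and the reality condition `Θ(z, χ, Θ̄(χ, z, η)) = η`,
`η = (w, u)`. -/
structure IsNormalForm (M : Set (Idx n m c → ℂ))
    (Q : Fin m → (Fin n ⊕ Idx n m c → ℂ) → ℂ) : Prop where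
  algebraic : ∀ j, IsNash (Q j)
  normal_left : ∀ j, ∀ᶠ x : Idx n m c → ℂ in 𝓝 0,
    Q j (Sum.elim (zPart x) (pt 0 (wPart x) (uPart x))) = wPart x j
  normal_right : ∀ j, ∀ᶠ x : Idx n m c → ℂ in 𝓝 0, Q j (Sum.elim 0 x) = wPart x j
  reality : ∀ j, ∀ᶠ x : Fin n ⊕ Idx n m c → ℂ in 𝓝 0,
    let χ : Fin n → ℂ := fun i => x (Sum.inl i)
    let Z : Idx n m c → ℂ := fun i => x (Sum.inr i)
    Q j (Sum.elim (zPart Z) (pt χ (fun k => conjFun (Q k) (Sum.elim χ Z)) (uPart Z))) =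
      wPart Z j
  mem_iff : ∀ᶠ Z : Idx n m c → ℂ in 𝓝 0,
    Z ∈ M ↔ (∀ j, wPart Z j = Q j (Sum.elim (zPart Z) (star Z))) ∧ uPart Z = star (uPart Z)

/-- The complexification `𝓜 ⊂ ℂ^N_Z × ℂ^N_ζ`: with `Z = (z, η)`, `ζ = (χ, σ)` it is the set
`σ = Θ̄(χ, z, η)`, where `Θ̄(χ, z, w, u) = (Q̄(χ, z, w, u), u)`. Only its germ at `0` matters. -/
def complexification (Q : Fin m → (Fin n ⊕ Idx n m c → ℂ) → ℂ) :
    Set (Idx n m c ⊕ Idx n m c → ℂ) :=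
  {x | (∀ j, wPart (x ∘ Sum.inr) j =
        conjFun (Q j) (Sum.elim (zPart (x ∘ Sum.inr)) (x ∘ Sum.inl))) ∧
      uPart (x ∘ Sum.inr) = uPart (x ∘ Sum.inl)}

end Coordinates

/-! ### The rings and condition (♣) -/

section Rings

variable {ι : Type} [Fintype ι]

/-- The ideal of `ℂ{x}` of the germs that vanish on (the germ at `0` of) the set `V`. -/
def vanishingIdeal (V : Set (ι → ℂ)) : Ideal (HolGerm ι) where
  carrier := {φ | ∃ g : (ι → ℂ) → ℂ, (φ : (𝓝 (0 : ι → ℂ)).Germ ℂ) = g ∧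
    ∀ᶠ x in 𝓝[V] 0, g x = 0}
  add_mem' := by
    rintro φ ψ ⟨g, hg, hg0⟩ ⟨h, hh, hh0⟩
    refine ⟨g + h, ?_, ?_⟩
    · rw [Subring.coe_add, hg, hh]; rfl
    · filter_upwards [hg0, hh0] with x h1 h2
      simp [h1, h2]
  zero_mem' := ⟨0, rfl, by simp⟩
  smul_mem' := by
    rintro φ ψ ⟨g, hg, hg0⟩
    obtain ⟨_, h, hh, rfl⟩ := φ
    refine ⟨h * g, ?_, ?_⟩
    · rw [smul_eq_mul, Subring.coe_mul, hg]; rfl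
    · filter_upwards [hg0] with x h1
      simp [h1]

/-- The germ in `ℂ{Z, ζ}` of `(Z, ζ) ↦ g(Z)`. -/
def inZ (g : (ι → ℂ) → ℂ) (hg : AnalyticAt ℂ g 0) : HolGerm (ι ⊕ ι) :=
  germOf (fun x => g (x ∘ Sum.inl)) <| by
    have h : AnalyticAt ℂ (fun x : ι ⊕ ι → ℂ => (x ∘ Sum.inl : ι → ℂ)) 0 :=
      AnalyticAt.pi fun i => (ContinuousLinearMap.proj (R := ℂ)
        (φ := fun _ : ι ⊕ ι => ℂ) (Sum.inl i)).analyticAt 0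
    exact AnalyticAt.comp (g := g) (by simpa using hg) h

/-- The germ in `ℂ{Z, ζ}` of `(Z, ζ) ↦ g(ζ)`. -/
def inZeta (g : (ι → ℂ) → ℂ) (hg : AnalyticAt ℂ g 0) : HolGerm (ι ⊕ ι) :=
  germOf (fun x => g (x ∘ Sum.inr)) <| by
    have h : AnalyticAt ℂ (fun x : ι ⊕ ι → ℂ => (x ∘ Sum.inr : ι → ℂ)) 0 :=
      AnalyticAt.pi fun i => (ContinuousLinearMap.proj (R := ℂ)
        (φ := fun _ : ι ⊕ ι => ℂ) (Sum.inr i)).analyticAt 0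
    exact AnalyticAt.comp (g := g) (by simpa using hg) h

variable {n m c N' : ℕ}

/-- The ring `ℛ^f_ℓ ⊂ ℂ{Z, ζ}` of the series `C(Z, ζ, (∂^γ f̄(ζ))_{|γ| ≤ ℓ})`, where `C` is a
polynomial in its last arguments with coefficients in `𝒩{Z, ζ}`. -/
def ringR (f : Fin N' → (Idx n m c → ℂ) → ℂ) (hf : ∀ s, AnalyticAt ℂ (f s) 0) (ℓ : ℕ) :
    Subring (HolGerm (Idx n m c ⊕ Idx n m c)) :=
  Subring.closure (nash (Idx n m c ⊕ Idx n m c) ∪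
    {φ | ∃ (L : List (Idx n m c)) (s : Fin N'), L.length ≤ ℓ ∧
      φ = inZeta (iterPartial L (conjFun (f s)))
        (analyticAt_iterPartial L (analyticAt_conjFun (hf s)))})

/-- Condition (♣): for some `ℓ₀`, every component `f_s(Z)`, regarded as an element of
`ℂ{𝓜} = ℂ{Z, ζ} / I_𝓜`, is algebraic over (the quotient field of) the image `𝒮^f_{ℓ₀}` of
`ℛ^f_{ℓ₀}` in `ℂ{𝓜}`. -/
def Club (Q : Fin m → (Fin n ⊕ Idx n m c → ℂ) → ℂ)
    (f : Fin N' → (Idx n m c → ℂ) → ℂ) (hf : ∀ s, AnalyticAt ℂ (f s) 0) : Prop :=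
  ∃ ℓ₀ : ℕ, ∀ s : Fin N',
    IsAlgebraic
      ((ringR f hf ℓ₀).map (Ideal.Quotient.mk (vanishingIdeal (complexification Q))))
      (Ideal.Quotient.mk (vanishingIdeal (complexification Q)) (inZ (f s) (hf s)))

/-- The germ in `ℂ{z, w, u}` of `(z, w, u) ↦ g(0, 0, u)`. -/
def restrictU (g : (Idx n m c → ℂ) → ℂ) (hg : AnalyticAt ℂ g 0) : HolGerm (Idx n m c) :=
  germOf (fun Z => g (pt 0 0 (uPart Z))) <| by
    have h : AnalyticAt ℂ (fun Z : Idx n m c → ℂ => (pt 0 0 (uPart Z) : Idx n m c → ℂ)) 0 := by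
      refine AnalyticAt.pi fun i => ?_
      rcases i with i | i | i
      · exact analyticAt_const
      · exact analyticAt_const
      · exact (ContinuousLinearMap.proj (R := ℂ) (φ := fun _ : Idx n m c => ℂ)
          (Sum.inr (Sum.inr i))).analyticAt 0
    have h0 : (pt 0 0 (uPart (0 : Idx n m c → ℂ)) : Idx n m c → ℂ) = 0 := by
      funext i
      rcases i with i | i | i <;> rfl
    exact AnalyticAt.comp (g := g) (by rw [h0]; exact hg) h

/-- The ring `𝒜^f_ℓ ⊂ ℂ{z, w, u}` of the series `A(z, w, u, (∂^α f(0, u))_{|α| ≤ ℓ})`, where `A` is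
a polynomial in its last arguments with coefficients in `𝒩{z, w, u}`. -/
def ringALevel (f : Fin N' → (Idx n m c → ℂ) → ℂ) (hf : ∀ s, AnalyticAt ℂ (f s) 0) (ℓ : ℕ) :
    Subring (HolGerm (Idx n m c)) :=
  Subring.closure (nash (Idx n m c) ∪
    {φ | ∃ (L : List (Idx n m c)) (s : Fin N'), L.length ≤ ℓ ∧
      φ = restrictU (iterPartial L (f s)) (analyticAt_iterPartial L (hf s))})

/-- The ring `𝒜^f`, the union of the increasing sequence of rings `𝒜^f_ℓ`. -/
def ringA (f : Fin N' → (Idx n m c → ℂ) → ℂ) (hf : ∀ s, AnalyticAt ℂ (f s) 0) :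
    Subring (HolGerm (Idx n m c)) :=
  ⨆ ℓ : ℕ, ringALevel f hf ℓ

end Rings

end KeyAlg

end

/-! Differentiating the algebraic relations (♣) along `𝓜 ≅ (Z, χ)` shows that *all* jets `∂^α f(Z)`
are algebraic over the Nash germs and the jets of `f̄(ζ)` on `𝓜`. This persists along every
algebraic map into `𝓜`, although the coefficients of a relation may vanish there: a differential
operator of least order that does not annihilate the restricted coefficients yields a nontrivial
relation. Conjugation gives the reverse implication. Hence along a Segre chain, which starts at
`(0, 0, u)` and moves alternately along the fibres of the two projections of `𝓜`, each move
introducing new parameters, `f(Z)` stays algebraic over the jets of `f` at `(0, 0, u)`.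

A chain whose generic rank is maximal is tangent to the holomorphic and antiholomorphic leaf fields
of `𝓜`, hence to the Lie algebra they generate. As the CR orbit of `0` has dimension `2n + m`, the
`Z`-component `v` of this chain is generically submersive, and the algebraicity of `f ∘ v` descends
along `v` to that of `f`. -/

noncomputable section

namespace KeyAlg

/-! ### Differential operators and algebraic relations -/

section Derivations

variable {A B ι : Type*} [CommRing A] [CommRing B] (D : ι → Derivation ℤ A A)

/-- The differential operator `∂_{i₁} ⋯ ∂_{i_k}` attached to the list `[i₁, …, i_k]` and a family of
derivations `∂_i`. -/
def iterDerivation (L : List ι) : Module.End ℤ A :=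
  (L.map fun i => (D i : A →ₗ[ℤ] A)).prod

theorem iterDerivation_cons (i : ι) (L : List ι) (x : A) :
    iterDerivation D (i :: L) x = D i (iterDerivation D L x) := by
  simp only [iterDerivation, List.map_cons, List.prod_cons]
  rfl

theorem iterDerivation_concat (L : List ι) (i : ι) (x : A) :
    iterDerivation D (L ++ [i]) x = iterDerivation D L (D i x) := by
  simp only [iterDerivation, List.map_append, List.prod_append, List.map_singleton,
    List.prod_singleton]
  rfl

variable {D} in
theorem iterDerivation_mem {S : Subring A} (hD : ∀ i, ∀ x ∈ S, D i x ∈ S) (L : List ι) {x : A}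
    (hx : x ∈ S) : iterDerivation D L x ∈ S := by
  induction L with
  | nil => exact hx
  | cons i L ih => exact iterDerivation_cons D i L x ▸ hD i _ ih

/-- Only the leading term of the Leibniz formula survives. -/
theorem map_iterDerivation_mul (φ : A →+* B) (L : List ι) (x y : A)
    (h : ∀ L' : List ι, L'.length < L.length → φ (iterDerivation D L' x) = 0) :
    φ (iterDerivation D L (x * y)) = φ (iterDerivation D L x) * φ y := by
  induction L using List.reverseRecOn generalizing x y with
  | nil => exact map_mul φ x y
  | append_singleton L i ih =>
    have hx : φ (iterDerivation D L (x * D i y)) = 0 := by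
      rw [ih x _ fun L' hL' => h L' (by simp; omega), h L (by simp), zero_mul]
    have hDx : φ (iterDerivation D L (D i x * y)) = φ (iterDerivation D L (D i x)) * φ y := by
      refine ih _ _ fun L' hL' => ?_
      rw [← iterDerivation_concat]
      exact h _ (by simpa using hL')
    rw [iterDerivation_concat, iterDerivation_concat, Derivation.leibniz, smul_eq_mul, smul_eq_mul,
      map_add, map_add, hx, zero_add, mul_comm y, hDx]

theorem derivation_mem_closure (D : Derivation ℤ A A) {s : Set A}
    (h : ∀ x ∈ s, D x ∈ Subring.closure s) {x : A} (hx : x ∈ Subring.closure s) :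
    D x ∈ Subring.closure s := by
  induction hx using Subring.closure_induction with
  | mem x hx => exact h x hx
  | zero => rw [map_zero]; exact zero_mem _
  | one => rw [Derivation.map_one_eq_zero]; exact zero_mem _
  | add x y _ _ hx hy => rw [map_add]; exact add_mem hx hy
  | neg x _ hx => rw [map_neg]; exact neg_mem hx
  | mul x y hxS hyS hx hy =>
    rw [Derivation.leibniz]
    exact add_mem (mul_mem hxS hy) (mul_mem hyS hx)

end Derivations

section Algebraic

open Polynomial

theorem isAlgebraic_map_of_map_le {A B : Type*} [CommRing A] [CommRing B] {φ : A →+* B}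
    {S : Subring A} {S' : Subring B} (hφ : ∀ x ∈ S, φ x = 0 → x = 0) (hS : S.map φ ≤ S') {x : A}
    (hx : IsAlgebraic S x) : IsAlgebraic S' (φ x) := by
  let g : S →+* S' := (φ.comp S.subtype).codRestrict S' fun y => hS ⟨y, y.2, rfl⟩
  have hg : Function.Injective g := (injective_iff_map_eq_zero g).2 fun y hy =>
    Subtype.ext (hφ y y.2 (congrArg Subtype.val hy))
  exact hx.ringHom_of_comp_eq g φ hg (RingHom.ext fun _ => rfl)

variable {A B : Type*} [CommRing A] [IsDomain A] [CommRing B] [IsDomain B]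

/-- The subring of the elements of a domain that are algebraic over the subring `S` (equivalently,
over its quotient field). -/
def algClosure (S : Subring A) : Subring A := (Subalgebra.algebraicClosure S A).toSubring

theorem le_algClosure (S : Subring A) : S ≤ algClosure S := fun x hx =>
  isAlgebraic_algebraMap (R := S) (A := A) (⟨x, hx⟩ : S)

theorem map_mem_algClosure {φ : A →+* B} {S : Subring A} {S' : Subring B}
    (hφ : ∀ x ∈ S, φ x = 0 → x = 0) (hS : S.map φ ≤ S') {x : A} (hx : x ∈ algClosure S) :
    φ x ∈ algClosure S' :=
  isAlgebraic_map_of_map_le hφ hS hx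

theorem algClosure_mono {S S' : Subring A} (h : S ≤ S') : algClosure S ≤ algClosure S' :=
  fun _ hx => map_mem_algClosure (φ := RingHom.id A) (fun _ _ h => h) (by simpa using h) hx

theorem algClosure_idem (S : Subring A) : algClosure (algClosure S) ≤ algClosure S :=
  fun x (hx : IsAlgebraic (Subalgebra.algebraicClosure S A) x) => hx.restrictScalars S

theorem algClosure_le_algClosure {S S' : Subring A} (h : S ≤ algClosure S') :
    algClosure S ≤ algClosure S' :=
  (algClosure_mono h).trans (algClosure_idem S')

theorem mem_algClosure_of_mul_mem {S : Subring A} {y z : A} (hy : y ≠ 0) (hyS : y ∈ algClosure S)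
    (hyz : y * z ∈ algClosure S) : z ∈ algClosure S :=
  IsAlgebraic.of_mul (R := S) (mem_nonZeroDivisors_of_ne_zero hy) hyS hyz

theorem exists_aeval_eq_zero_aeval_derivative_ne_zero {R : Type*} [CommRing R] [Algebra R A]
    [FaithfulSMul R A] [CharZero A] {x : A} (hx : IsAlgebraic R x) :
    ∃ p : R[X], aeval x p = 0 ∧ aeval x (derivative p) ≠ 0 := by
  classical
  have hinj : Function.Injective (algebraMap R A) := FaithfulSMul.algebraMap_injective R A
  have : IsDomain R := hinj.isDomain _
  have : CharZero R := ⟨fun a b h => Nat.cast_injective (R := A) <| by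
    simpa using congrArg (algebraMap R A) h⟩
  have hex : ∃ d, ∃ p : R[X], p ≠ 0 ∧ aeval x p = 0 ∧ p.natDegree = d :=
    let ⟨p, hp0, hp⟩ := hx; ⟨_, p, hp0, hp, rfl⟩
  obtain ⟨p, hp0, hp, hdeg⟩ := Nat.find_spec hex
  have hdeg0 : p.natDegree ≠ 0 := fun h => by
    rw [eq_C_of_natDegree_eq_zero h, aeval_C, map_eq_zero_iff _ hinj] at hp
    exact hp0 (by rw [eq_C_of_natDegree_eq_zero h, hp, C_0])
  refine ⟨p, hp, fun h => Nat.find_min hex (hdeg ▸ natDegree_derivative_lt hdeg0)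
    ⟨_, fun h' => hdeg0 (derivative_eq_zero.1 h'), h, rfl⟩⟩

theorem derivation_mem_algClosure [CharZero A] (D : Derivation ℤ A A) {S : Subring A}
    (hD : ∀ x ∈ S, D x ∈ S) {x : A} (hx : x ∈ algClosure S) : D x ∈ algClosure S := by
  obtain ⟨p, hp, hp'⟩ := exists_aeval_eq_zero_aeval_derivative_ne_zero (R := S) hx
  have haeval (q : S[X]) : aeval x q = eval x (q.map S.subtype) := by
    rw [aeval_def, eval_map]; rfl
  have hterm {a : A} (ha : a ∈ S) (i : ℕ) : x ^ i * a ∈ algClosure S :=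
    mul_mem (pow_mem hx i) (le_algClosure S ha)
  have hrel := D.apply_eval_eq x (p.map S.subtype)
  rw [← haeval, hp, map_zero, derivative_map, ← haeval, smul_eq_mul] at hrel
  refine mem_algClosure_of_mul_mem hp' ?_ (z := D x) ?_
  · rw [haeval, eval_eq_sum]
    refine sum_mem fun i _ => ?_
    simp only [coeff_map, mul_comm _ (x ^ i)]
    exact hterm (p.derivative.coeff i).2 i
  · rw [eq_neg_of_add_eq_zero_right hrel.symm, PolynomialModule.eval_apply]
    refine neg_mem (sum_mem fun i _ => ?_)
    have hcoeff : (D.mapCoeffs (p.map S.subtype)).coeff i = D (p.coeff i) :=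
      congrArg D (coeff_map S.subtype i)
    simp only [hcoeff, smul_eq_mul]
    exact hterm (hD _ (p.coeff i).2) i

/-- Even if `φ` kills all the coefficients of an algebraic relation, `φ x` satisfies the relation
obtained by first applying a differential operator of least order for which they do not all die. -/
theorem map_mem_algClosure_map_of_iterDerivation {ι : Type*} {D : ι → Derivation ℤ A A}
    {φ : A →+* B} (hφ : ∀ x : A, x ≠ 0 → ∃ L, φ (iterDerivation D L x) ≠ 0) {S : Subring A}
    (hD : ∀ i, ∀ x ∈ S, D i x ∈ S) {x : A} (hx : x ∈ algClosure S) :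
    φ x ∈ algClosure (S.map φ) := by
  classical
  obtain ⟨p, hp0, hp⟩ : ∃ p : S[X], p ≠ 0 ∧ aeval x p = 0 := hx
  have hex : ∃ e, ∃ L : List ι, L.length = e ∧ ∃ j, φ (iterDerivation D L (p.coeff j)) ≠ 0 := by
    obtain ⟨j, hj⟩ : ∃ j, p.coeff j ≠ 0 := by
      by_contra! h
      exact hp0 (Polynomial.ext (by simpa using h))
    obtain ⟨L, hL⟩ := hφ (p.coeff j) (by simpa using hj)
    exact ⟨_, L, rfl, j, hL⟩
  obtain ⟨L, hL, j₀, hj₀⟩ := Nat.find_spec hex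
  have hmin (j : ℕ) (L' : List ι) (hL' : L'.length < L.length) :
      φ (iterDerivation D L' (p.coeff j)) = 0 := by
    by_contra h
    exact Nat.find_min hex (hL ▸ hL') ⟨L', rfl, j, h⟩
  let q : (S.map φ)[X] := ∑ j ∈ p.support,
    monomial j ⟨_, _, iterDerivation_mem hD L (p.coeff j).2, rfl⟩
  refine ⟨q, fun hq => hj₀ ?_, ?_⟩
  · have hq₀ := congrArg Subtype.val (congrArg (coeff · j₀) hq)
    simp only [q, finsetSum_coeff, coeff_monomial, Finset.sum_ite_eq', coeff_zero] at hq₀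
    split_ifs at hq₀ with hj
    · exact hq₀
    · rw [notMem_support_iff.1 hj]
      simp
  · have hpx : ∑ j ∈ p.support, (p.coeff j : A) * x ^ j = 0 := by
      rw [← hp, aeval_def, eval₂_eq_sum]; rfl
    have hφpx := congrArg (fun y => φ (iterDerivation D L y)) hpx
    simp only [map_sum, map_zero, map_iterDerivation_mul D φ L _ _ (hmin _), map_pow] at hφpx
    simp only [q, map_sum, aeval_monomial]
    exact hφpx

end Algebraic

/-! ### Germs, their derivatives and their pull-backs -/

section GermRing

theorem eventuallyEq_zero_of_frequently {𝕜 E F : Type*} [RCLike 𝕜] [NormedAddCommGroup E]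
    [NormedSpace 𝕜 E] [NormedAddCommGroup F] [NormedSpace 𝕜 F] [CompleteSpace F] {g : E → F}
    {a : E} (hg : AnalyticAt 𝕜 g a) (h : ∃ᶠ x in 𝓝 a, g =ᶠ[𝓝 x] 0) : g =ᶠ[𝓝 a] 0 := by
  obtain ⟨r, hr, hball⟩ := Metric.eventually_nhds_iff_ball.1 hg.eventually_analyticAt
  obtain ⟨x, hx, hxr⟩ := (h.and_eventually (Metric.ball_mem_nhds a hr)).exists
  let : NormedSpace ℝ E := NormedSpace.restrictScalars ℝ 𝕜 E
  have heq := AnalyticOnNhd.eqOn_zero_of_preconnected_of_eventuallyEq_zero (f := g) hball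
    (convex_ball a r).isPreconnected hxr hx
  exact heq.eventuallyEq_of_mem (Metric.ball_mem_nhds a hr)

theorem eventuallyEq_zero_or_of_mul {𝕜 E : Type*} [RCLike 𝕜] [NormedAddCommGroup E]
    [NormedSpace 𝕜 E] {g h : E → 𝕜} {a : E} (hg : AnalyticAt 𝕜 g a) (hh : AnalyticAt 𝕜 h a)
    (hgh : ∀ᶠ x in 𝓝 a, g x * h x = 0) : g =ᶠ[𝓝 a] 0 ∨ h =ᶠ[𝓝 a] 0 := by
  refine or_iff_not_imp_left.2 fun hg0 => eventuallyEq_zero_of_frequently hh ?_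
  have hgx : ∃ᶠ x in 𝓝 a, g x ≠ 0 := not_eventually.1 hg0
  refine (hgx.and_eventually (hgh.eventually_nhds.and hg.eventually_analyticAt)).mono ?_
  rintro x ⟨hx, hghx, hgx⟩
  filter_upwards [hghx, hgx.continuousAt.eventually_ne hx] with y hy hgy
  exact (mul_eq_zero.1 hy).resolve_left hgy

variable {ι T : Type} [Fintype ι] [Fintype T]

theorem germOf_eq_iff {g h : (ι → ℂ) → ℂ} {hg : AnalyticAt ℂ g 0} {hh : AnalyticAt ℂ h 0} :
    germOf g hg = germOf h hh ↔ g =ᶠ[𝓝 0] h :=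
  Subtype.ext_iff.trans Filter.Germ.coe_eq

theorem germOf_congr {g h : (ι → ℂ) → ℂ} {hg : AnalyticAt ℂ g 0} {hh : AnalyticAt ℂ h 0}
    (hgh : ∀ x, g x = h x) : germOf g hg = germOf h hh :=
  germOf_eq_iff.2 (Eventually.of_forall hgh)

theorem germOf_eq_zero_iff {g : (ι → ℂ) → ℂ} {hg : AnalyticAt ℂ g 0} :
    germOf g hg = 0 ↔ g =ᶠ[𝓝 0] 0 :=
  germOf_eq_iff (h := fun _ => 0) (hh := analyticAt_const)

theorem exists_eq_germOf (φ : HolGerm ι) :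
    ∃ (g : (ι → ℂ) → ℂ) (hg : AnalyticAt ℂ g 0), φ = germOf g hg := by
  obtain ⟨_, g, hg, rfl⟩ := φ
  exact ⟨g, hg, rfl⟩

theorem germOf_add {g h : (ι → ℂ) → ℂ} (hg : AnalyticAt ℂ g 0) (hh : AnalyticAt ℂ h 0) :
    germOf g hg + germOf h hh = germOf (fun x => g x + h x) (hg.add hh) := rfl

theorem germOf_mul {g h : (ι → ℂ) → ℂ} (hg : AnalyticAt ℂ g 0) (hh : AnalyticAt ℂ h 0) :
    germOf g hg * germOf h hh = germOf (fun x => g x * h x) (hg.mul hh) := rfl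

theorem germOf_sum {κ : Type*} (s : Finset κ) {g : κ → (ι → ℂ) → ℂ}
    (hg : ∀ k, AnalyticAt ℂ (g k) 0) :
    ∑ k ∈ s, germOf (g k) (hg k) =
      germOf (fun x => ∑ k ∈ s, g k x) (Finset.analyticAt_fun_sum s fun k _ => hg k) := by
  classical
  induction s using Finset.induction_on with
  | empty => simp only [Finset.sum_empty]; rfl
  | insert a s ha ih =>
    rw [Finset.sum_insert ha, ih, germOf_add]
    exact germOf_congr fun x => (Finset.sum_insert (f := fun k => g k x) ha).symm

instance : IsDomain (HolGerm ι) := by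
  have : Nontrivial (HolGerm ι) := ⟨1, 0, fun h => one_ne_zero (α := ℂ)
    (germOf_eq_zero_iff (hg := analyticAt_const).1 h).self_of_nhds⟩
  have : NoZeroDivisors (HolGerm ι) := ⟨fun {φ ψ} h => by
    obtain ⟨g, hg, rfl⟩ := exists_eq_germOf φ
    obtain ⟨k, hk, rfl⟩ := exists_eq_germOf ψ
    rw [germOf_mul, germOf_eq_zero_iff] at h
    rw [germOf_eq_zero_iff, germOf_eq_zero_iff]
    exact eventuallyEq_zero_or_of_mul hg hk h⟩
  exact NoZeroDivisors.to_isDomain _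

theorem polyHom_apply (p : MvPolynomial ι ℂ) :
    polyHom ι p = germOf (fun x => MvPolynomial.eval x p) (analyticAt_mvPolynomial p) := rfl

theorem polyHom_C (a : ℂ) :
    polyHom ι (MvPolynomial.C a) = germOf (fun _ => a) analyticAt_const :=
  germOf_congr (hg := analyticAt_mvPolynomial _) fun _ => MvPolynomial.eval_C a

theorem polyHom_X (i : ι) :
    polyHom ι (MvPolynomial.X i) = germOf (fun x => x i) (analyticAt_pi_iff.1 analyticAt_id i) :=
  germOf_congr (hg := analyticAt_mvPolynomial _) fun _ => MvPolynomial.eval_X i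

instance : CharZero (HolGerm ι) :=
  charZero_of_injective_ringHom ((polyHom ι).comp MvPolynomial.C).injective

/-- The pull-back `φ ↦ φ ∘ V` of germs along the germ of a holomorphic map `V`. -/
def pullback {V : (T → ℂ) → (ι → ℂ)} (hV : AnalyticAt ℂ V 0) (hV0 : V 0 = 0) :
    HolGerm ι →+* HolGerm T where
  toFun φ := ⟨φ.1.compTendsto V (by simpa only [hV0] using hV.continuousAt.tendsto), by
    obtain ⟨_, g, hg, rfl⟩ := φ
    exact ⟨g ∘ V, hg.comp_of_eq hV hV0, rfl⟩⟩
  map_one' := rfl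
  map_zero' := rfl
  map_mul' φ ψ := by
    obtain ⟨_, g, hg, rfl⟩ := φ
    obtain ⟨_, h, hh, rfl⟩ := ψ
    rfl
  map_add' φ ψ := by
    obtain ⟨_, g, hg, rfl⟩ := φ
    obtain ⟨_, h, hh, rfl⟩ := ψ
    rfl

theorem pullback_germOf {V : (T → ℂ) → (ι → ℂ)} (hV : AnalyticAt ℂ V 0) (hV0 : V 0 = 0)
    {g : (ι → ℂ) → ℂ} (hg : AnalyticAt ℂ g 0) :
    pullback hV hV0 (germOf g hg) = germOf (fun t => g (V t)) (hg.fun_comp_of_eq hV hV0) := rfl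

theorem conjFun_conjFun {ι : Type} (g : (ι → ℂ) → ℂ) : conjFun (conjFun g) = g := by
  funext x
  simp only [conjFun, star_star]

/-- The automorphism `φ ↦ φ̄` of the ring of germs. -/
def conjHom (ι : Type) [Fintype ι] : HolGerm ι →+* HolGerm ι where
  toFun φ := ⟨(φ.1.compTendsto (star : (ι → ℂ) → (ι → ℂ))
      (by simpa only [star_zero] using (continuous_star (R := ι → ℂ)).tendsto 0)).map star, by
    obtain ⟨_, g, hg, rfl⟩ := φ
    exact ⟨conjFun g, analyticAt_conjFun hg, rfl⟩⟩
  map_one' := Subtype.ext (congrArg (fun a : ℂ => ((fun _ => a : (ι → ℂ) → ℂ) :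
    (𝓝 (0 : ι → ℂ)).Germ ℂ)) (star_one ℂ))
  map_zero' := Subtype.ext (congrArg (fun a : ℂ => ((fun _ => a : (ι → ℂ) → ℂ) :
    (𝓝 (0 : ι → ℂ)).Germ ℂ)) (star_zero ℂ))
  map_mul' φ ψ := by
    obtain ⟨g, hg, rfl⟩ := exists_eq_germOf φ
    obtain ⟨h, hh, rfl⟩ := exists_eq_germOf ψ
    exact germOf_congr (hg := analyticAt_conjFun (hg.mul hh))
      (hh := (analyticAt_conjFun hg).mul (analyticAt_conjFun hh)) fun x => star_mul' _ _
  map_add' φ ψ := by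
    obtain ⟨g, hg, rfl⟩ := exists_eq_germOf φ
    obtain ⟨h, hh, rfl⟩ := exists_eq_germOf ψ
    exact germOf_congr (hg := analyticAt_conjFun (hg.add hh))
      (hh := (analyticAt_conjFun hg).add (analyticAt_conjFun hh)) fun x => star_add _ _

theorem conjHom_germOf {g : (ι → ℂ) → ℂ} (hg : AnalyticAt ℂ g 0) :
    conjHom ι (germOf g hg) = germOf (conjFun g) (analyticAt_conjFun hg) := rfl

theorem conjHom_conjHom (φ : HolGerm ι) : conjHom ι (conjHom ι φ) = φ := by
  obtain ⟨g, hg, rfl⟩ := exists_eq_germOf φ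
  rw [conjHom_germOf, conjHom_germOf]
  exact germOf_congr (congrFun (conjFun_conjFun g))

theorem conjHom_mem_algClosure {S S' : Subring (HolGerm ι)} (h : S.map (conjHom ι) ≤ S')
    {φ : HolGerm ι} (hφ : φ ∈ algClosure S) : conjHom ι φ ∈ algClosure S' :=
  map_mem_algClosure (fun x _ hx => by rw [← conjHom_conjHom x, hx, map_zero]) h hφ

end GermRing

section Derivatives

theorem iterPartial_singleton_congr {ι : Type} [DecidableEq ι] (i : ι) {g h : (ι → ℂ) → ℂ}
    {x : ι → ℂ} (hgh : g =ᶠ[𝓝 x] h) : iterPartial [i] g =ᶠ[𝓝 x] iterPartial [i] h :=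
  hgh.fderiv.fun_comp fun A => A (Pi.single i 1)

theorem fderiv_star_comp_star {E F : Type*} [NormedAddCommGroup E] [NormedSpace ℂ E]
    [StarAddMonoid E] [NormedStarGroup E] [StarModule ℂ E] [NormedAddCommGroup F] [NormedSpace ℂ F]
    [StarAddMonoid F] [NormedStarGroup F] [StarModule ℂ F] (g : E → F) (x v : E) :
    fderiv ℂ (fun y => star (g (star y))) x v = star (fderiv ℂ g (star x) (star v)) := by
  by_cases h : DifferentiableAt ℂ g (star x)
  · have hconj := h.hasFDerivAt.star_star
    rw [star_star] at hconj
    exact congrArg (· v) hconj.fderiv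
  · have hconj : ¬ DifferentiableAt ℂ (fun y => star (g (star y))) x := fun h' =>
      h (by simpa only [Function.comp_def, star_star] using h'.star_star)
    simp only [fderiv_zero_of_not_differentiableAt h, fderiv_zero_of_not_differentiableAt hconj,
      zero_apply, star_zero]

theorem iterPartial_conjFun {ι : Type} [Finite ι] [DecidableEq ι] (L : List ι)
    (g : (ι → ℂ) → ℂ) : iterPartial L (conjFun g) = conjFun (iterPartial L g) := by
  cases nonempty_fintype ι
  induction L with
  | nil => rfl
  | cons i L ih =>
    funext x
    have h := fderiv_star_comp_star (iterPartial L g) x (Pi.single i 1)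
    rw [← Pi.single_star, star_one] at h
    exact (congrArg (fun g => fderiv ℂ g x (Pi.single i 1)) ih).trans h

variable {ι T : Type} [Fintype ι] [Fintype T] [DecidableEq ι]

/-- The derivation `∂/∂x_i` of `ℂ{x}`. -/
def partialDeriv (i : ι) : Derivation ℤ (HolGerm ι) (HolGerm ι) :=
  let D (φ : HolGerm ι) : HolGerm ι :=
    ⟨φ.1.map' (iterPartial [i]) fun _ _ => iterPartial_singleton_congr i, by
      obtain ⟨_, g, hg, rfl⟩ := φ
      exact ⟨_, analyticAt_iterPartial [i] hg, rfl⟩⟩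
  Derivation.mk' (AddMonoidHom.toIntLinearMap (AddMonoidHom.mk' D (by
    intro φ ψ
    obtain ⟨g, hg, rfl⟩ := exists_eq_germOf φ
    obtain ⟨h, hh, rfl⟩ := exists_eq_germOf ψ
    refine (germOf_eq_iff (hg := analyticAt_iterPartial [i] (hg.add hh))
      (hh := (analyticAt_iterPartial [i] hg).add (analyticAt_iterPartial [i] hh))).2 ?_
    filter_upwards [hg.eventually_analyticAt, hh.eventually_analyticAt] with x hgx hhx
    exact congrArg (· (Pi.single i 1)) (fderiv_add hgx.differentiableAt hhx.differentiableAt))))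
    (by
    intro φ ψ
    obtain ⟨g, hg, rfl⟩ := exists_eq_germOf φ
    obtain ⟨h, hh, rfl⟩ := exists_eq_germOf ψ
    refine (germOf_eq_iff (hg := analyticAt_iterPartial [i] (hg.mul hh))
      (hh := (hg.mul (analyticAt_iterPartial [i] hh)).add
        (hh.mul (analyticAt_iterPartial [i] hg)))).2 ?_
    filter_upwards [hg.eventually_analyticAt, hh.eventually_analyticAt] with x hgx hhx
    exact congrArg (· (Pi.single i 1)) (fderiv_mul hgx.differentiableAt hhx.differentiableAt))

theorem partialDeriv_germOf (i : ι) {g : (ι → ℂ) → ℂ} (hg : AnalyticAt ℂ g 0) :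
    partialDeriv i (germOf g hg) = germOf (iterPartial [i] g) (analyticAt_iterPartial [i] hg) :=
  rfl

theorem iterDerivation_germOf (L : List ι) {g : (ι → ℂ) → ℂ} (hg : AnalyticAt ℂ g 0) :
    iterDerivation partialDeriv L (germOf g hg) =
      germOf (iterPartial L g) (analyticAt_iterPartial L hg) := by
  induction L with
  | nil => rfl
  | cons i L ih => rw [iterDerivation_cons, ih, partialDeriv_germOf]; rfl

theorem continuousLinearMap_apply_eq_sum_single {F : Type*} [NormedAddCommGroup F]
    [NormedSpace ℂ F] (A : (ι → ℂ) →L[ℂ] F) (v : ι → ℂ) :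
    A v = ∑ i, v i • A (Pi.single i 1) := by
  conv_lhs => rw [pi_eq_sum_univ' v]
  simp only [map_sum, map_smul]

theorem partialDeriv_pullback [DecidableEq T] {V : (T → ℂ) → (ι → ℂ)} (hV : AnalyticAt ℂ V 0)
    (hV0 : V 0 = 0) (j : T) (φ : HolGerm ι) :
    partialDeriv j (pullback hV hV0 φ) = ∑ i, pullback hV hV0 (partialDeriv i φ) *
      partialDeriv j (germOf (fun t => V t i) (analyticAt_pi_iff.1 hV i)) := by
  obtain ⟨g, hg, rfl⟩ := exists_eq_germOf φ
  simp only [pullback_germOf, partialDeriv_germOf, germOf_mul, germOf_sum]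
  refine germOf_eq_iff.2 ?_
  have hg' : ∀ᶠ t in 𝓝 (0 : T → ℂ), AnalyticAt ℂ g (V t) :=
    hV.continuousAt.eventually (by rw [hV0]; exact hg.eventually_analyticAt)
  filter_upwards [hV.eventually_analyticAt, hg'] with t hVt hgt
  have hchain := fderiv_comp t hgt.differentiableAt hVt.differentiableAt
  change fderiv ℂ (g ∘ V) t _ = _
  rw [hchain, ContinuousLinearMap.comp_apply, continuousLinearMap_apply_eq_sum_single]
  refine Finset.sum_congr rfl fun i _ => ?_
  simp only [iterPartial]
  rw [fderiv_apply hVt.differentiableAt, smul_eq_mul, mul_comm]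
  rfl

theorem iteratedFDeriv_apply_single {g : (ι → ℂ) → ℂ} {k : ℕ} (I : Fin k → ι)
    {x : ι → ℂ} (hg : AnalyticAt ℂ g x) :
    iteratedFDeriv ℂ k g x (fun j => Pi.single (I j) 1) = iterPartial (List.ofFn I) g x := by
  induction k generalizing x with
  | zero => simp [iterPartial]
  | succ k ih =>
    let v : Fin k → ι → ℂ := fun j => Pi.single (I j.succ) 1
    have hk : (fun y => iteratedFDeriv ℂ k g y v) =ᶠ[𝓝 x]
        iterPartial (List.ofFn fun j => I j.succ) g := by
      filter_upwards [hg.eventually_analyticAt] with y hy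
      exact ih _ hy
    have hdiff : DifferentiableAt ℂ (iteratedFDeriv ℂ k g) x :=
      ((hg.contDiffAt (n := ⊤)).iteratedFDeriv_right (m := 1) (by simp)).differentiableAt
        one_ne_zero
    have hderiv := ((ContinuousMultilinearMap.apply ℂ (fun _ : Fin k => ι → ℂ) ℂ v
      ).hasFDerivAt.comp x hdiff.hasFDerivAt).fderiv
    rw [iteratedFDeriv_succ_apply_left, List.ofFn_succ]
    exact (congrArg (· (Pi.single (I 0) 1)) hderiv).symm.trans
      (congrArg (fun A : (ι → ℂ) →L[ℂ] ℂ => A (Pi.single (I 0) 1)) hk.fderiv_eq)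

theorem exists_iterPartial_ne_zero {g : (ι → ℂ) → ℂ} (hg : AnalyticAt ℂ g 0)
    (h : ¬ g =ᶠ[𝓝 0] 0) : ∃ L, iterPartial L g 0 ≠ 0 := by
  contrapose! h
  have hzero (k : ℕ) : iteratedFDeriv ℂ k g 0 = 0 := by
    refine ContinuousMultilinearMap.toMultilinearMap_injective ?_
    refine Module.Basis.ext_multilinear (fun _ => Pi.basisFun ℂ ι) fun I => ?_
    simpa using (iteratedFDeriv_apply_single I hg).trans (h _)
  obtain ⟨p, r, hp⟩ := hg
  filter_upwards [Metric.eball_mem_nhds (0 : ι → ℂ) hp.r_pos] with y hy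
  have hsum := hp.hasSum_iteratedFDeriv hy
  simp only [hzero, zero_apply, smul_zero, zero_add] at hsum
  exact hsum.unique hasSum_zero

theorem partialDeriv_polyHom (i : ι) (p : MvPolynomial ι ℂ) :
    partialDeriv i (polyHom ι p) = polyHom ι (MvPolynomial.pderiv i p) := by
  induction p using MvPolynomial.induction_on with
  | C a =>
    rw [MvPolynomial.pderiv_C, map_zero, polyHom_C, partialDeriv_germOf, germOf_eq_zero_iff]
    exact Eventually.of_forall fun x => by simp [iterPartial]
  | add p q hp hq => simp only [map_add, hp, hq]
  | mul_X p j hp =>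
    have hX : partialDeriv i (polyHom ι (MvPolynomial.X j)) =
        polyHom ι ((Pi.single i 1 : ι → MvPolynomial ι ℂ) j) := by
      rw [polyHom_X, partialDeriv_germOf, polyHom_apply]
      refine germOf_congr fun x => ?_
      have hproj := (ContinuousLinearMap.proj (R := ℂ) (φ := fun _ : ι => ℂ) j).fderiv (x := x)
      refine (congrArg (· (Pi.single i 1)) hproj).trans ?_
      by_cases hij : j = i
      · subst hij; simp
      · simp [hij]
    simp only [Derivation.leibniz, smul_eq_mul, MvPolynomial.pderiv_X, map_add, map_mul, hp, hX]

theorem pullback_mem_algClosure {V : (T → ℂ) → (ι → ℂ)} (hV : AnalyticAt ℂ V 0) (hV0 : V 0 = 0)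
    {S : Subring (HolGerm ι)} (hS : ∀ i, ∀ φ ∈ S, partialDeriv i φ ∈ S) {φ : HolGerm ι}
    (hφ : φ ∈ algClosure S) : pullback hV hV0 φ ∈ algClosure (S.map (pullback hV hV0)) := by
  refine map_mem_algClosure_map_of_iterDerivation (fun ψ hψ => ?_) hS hφ
  obtain ⟨g, hg, rfl⟩ := exists_eq_germOf ψ
  obtain ⟨L, hL⟩ := exists_iterPartial_ne_zero hg (hψ ∘ germOf_eq_zero_iff.2)
  refine ⟨L, fun h => hL ?_⟩
  rw [iterDerivation_germOf, pullback_germOf, germOf_eq_zero_iff] at h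
  simpa only [hV0, Pi.zero_apply] using h.self_of_nhds

end Derivatives

/-! ### Algebraic germs and rings generated by jets -/

section Nash

variable {ι κ T : Type} [Fintype ι] [Fintype T]

/-- The ring `𝒩{x}` of algebraic germs. -/
def nashRing (ι : Type) [Fintype ι] : Subring (HolGerm ι) := algClosure (polyHom ι).range

theorem polyHom_mem_nashRing (p : MvPolynomial ι ℂ) : polyHom ι p ∈ nashRing ι :=
  le_algClosure _ ⟨p, rfl⟩

theorem isNash_coord (i : ι) : IsNash (fun x : ι → ℂ => x i) :=
  ⟨_, polyHom_X i ▸ polyHom_mem_nashRing _⟩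

theorem isNash_const (a : ℂ) : IsNash (fun _ : ι → ℂ => a) :=
  ⟨_, polyHom_C (ι := ι) a ▸ polyHom_mem_nashRing _⟩

theorem IsNash.add {g h : (ι → ℂ) → ℂ} (hg : IsNash g) (hh : IsNash h) :
    IsNash (fun x => g x + h x) :=
  ⟨hg.1.add hh.1, (nashRing ι).add_mem hg.2 hh.2⟩

theorem partialDeriv_mem_nashRing [DecidableEq ι] (i : ι) {φ : HolGerm ι}
    (hφ : φ ∈ nashRing ι) : partialDeriv i φ ∈ nashRing ι := by
  refine derivation_mem_algClosure _ ?_ hφ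
  rintro _ ⟨p, rfl⟩
  exact ⟨_, (partialDeriv_polyHom i p).symm⟩

theorem conjHom_polyHom (p : MvPolynomial ι ℂ) :
    conjHom ι (polyHom ι p) = polyHom ι (p.map (starRingEnd ℂ)) := by
  rw [polyHom_apply, polyHom_apply, conjHom_germOf]
  refine germOf_congr fun x => ?_
  have h := MvPolynomial.eval₂_comp_left (starRingEnd ℂ) (RingHom.id ℂ) (star x) p
  have hx : starRingEnd ℂ ∘ star x = x := star_star x
  rw [RingHom.comp_id, hx] at h
  rw [MvPolynomial.eval_map]
  exact h

theorem conjHom_mem_nashRing {φ : HolGerm ι} (hφ : φ ∈ nashRing ι) :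
    conjHom ι φ ∈ nashRing ι :=
  conjHom_mem_algClosure (by rintro _ ⟨_, ⟨p, rfl⟩, rfl⟩; exact ⟨_, (conjHom_polyHom p).symm⟩) hφ

theorem IsNash.conj {g : (ι → ℂ) → ℂ} (hg : IsNash g) : IsNash (conjFun g) :=
  ⟨analyticAt_conjFun hg.1, conjHom_mem_nashRing hg.2⟩

theorem pullback_polyHom_mem {V : (T → ℂ) → (ι → ℂ)} (hV : AnalyticAt ℂ V 0) (hV0 : V 0 = 0)
    {S : Subring (HolGerm T)} (hC : ∀ a, polyHom T (MvPolynomial.C a) ∈ S)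
    (hX : ∀ i, germOf (fun t => V t i) (analyticAt_pi_iff.1 hV i) ∈ S) (p : MvPolynomial ι ℂ) :
    pullback hV hV0 (polyHom ι p) ∈ S := by
  induction p using MvPolynomial.induction_on with
  | C a =>
    rw [polyHom_C, pullback_germOf, ← polyHom_C]
    exact hC a
  | add p q hp hq => rw [map_add, map_add]; exact add_mem hp hq
  | mul_X p i hp =>
    rw [map_mul, map_mul, polyHom_X, pullback_germOf]
    exact mul_mem hp (hX i)

/-- `V` is the germ at `0` of an algebraic map with `V(0) = 0`. -/
structure IsNashMap (V : (T → ℂ) → (κ → ℂ)) : Prop where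
  isNash : ∀ i, IsNash fun t => V t i
  map_zero : V 0 = 0

theorem IsNashMap.analyticAt {V : (T → ℂ) → (ι → ℂ)} (hV : IsNashMap V) : AnalyticAt ℂ V 0 :=
  AnalyticAt.pi fun i => (hV.isNash i).1

theorem IsNashMap.tendsto {V : (T → ℂ) → (κ → ℂ)} [Finite κ] (hV : IsNashMap V) :
    Tendsto V (𝓝 0) (𝓝 0) := by
  have := Fintype.ofFinite κ
  simpa only [hV.map_zero] using hV.analyticAt.continuousAt.tendsto

/-- The pull-back `φ ↦ φ ∘ V` of germs along an algebraic map `V`. -/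
abbrev IsNashMap.pullback {V : (T → ℂ) → (ι → ℂ)} (hV : IsNashMap V) :
    HolGerm ι →+* HolGerm T :=
  KeyAlg.pullback hV.analyticAt hV.map_zero

theorem IsNashMap.pullback_mem_nashRing {V : (T → ℂ) → (ι → ℂ)} (hV : IsNashMap V)
    {φ : HolGerm ι} (hφ : φ ∈ nashRing ι) : hV.pullback φ ∈ nashRing T := by
  classical
  refine algClosure_le_algClosure ?_ (pullback_mem_algClosure hV.analyticAt hV.map_zero
    (S := (polyHom ι).range) ?_ hφ)
  · rintro _ ⟨_, ⟨p, rfl⟩, rfl⟩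
    exact pullback_polyHom_mem _ _ (fun a => polyHom_mem_nashRing _) (fun i => (hV.isNash i).2) p
  · rintro i _ ⟨p, rfl⟩
    exact ⟨_, (partialDeriv_polyHom i p).symm⟩

theorem IsNash.comp {g : (ι → ℂ) → ℂ} (hg : IsNash g) {V : (T → ℂ) → (ι → ℂ)}
    (hV : IsNashMap V) : IsNash fun t => g (V t) :=
  ⟨hg.1.fun_comp_of_eq hV.analyticAt hV.map_zero, hV.pullback_mem_nashRing hg.2⟩

theorem IsNashMap.comp {V : (T → ℂ) → (ι → ℂ)} (hV : IsNashMap V) {W : (ι → ℂ) → (κ → ℂ)}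
    (hW : IsNashMap W) : IsNashMap fun t => W (V t) where
  isNash i := (hW.isNash i).comp hV
  map_zero := by rw [hV.map_zero, hW.map_zero]

theorem isNashMap_reindex (e : κ → T) : IsNashMap fun t : T → ℂ => t ∘ e where
  isNash i := isNash_coord (e i)
  map_zero := rfl

theorem IsNashMap.reindex {κ' : Type} {V : (T → ℂ) → (κ → ℂ)} (hV : IsNashMap V)
    (e : κ' → κ) : IsNashMap fun t => V t ∘ e where
  isNash i := hV.isNash (e i)
  map_zero := by rw [hV.map_zero]; rfl

theorem isNashMap_zero : IsNashMap fun _ : T → ℂ => (0 : κ → ℂ) where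
  isNash _ := isNash_const 0
  map_zero := rfl

theorem IsNashMap.add {V W : (T → ℂ) → (κ → ℂ)} (hV : IsNashMap V) (hW : IsNashMap W) :
    IsNashMap fun t => V t + W t where
  isNash i := (hV.isNash i).add (hW.isNash i)
  map_zero := by rw [hV.map_zero, hW.map_zero, add_zero]

theorem IsNashMap.sumElim {κ' : Type} {V : (T → ℂ) → (κ → ℂ)} {W : (T → ℂ) → (κ' → ℂ)}
    (hV : IsNashMap V) (hW : IsNashMap W) :
    IsNashMap fun t => (Sum.elim (V t) (W t) : κ ⊕ κ' → ℂ) where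
  isNash := Sum.rec hV.isNash hW.isNash
  map_zero := by
    rw [hV.map_zero, hW.map_zero]
    exact Sum.elim_zero_zero

theorem IsNashMap.conj {V : (T → ℂ) → (κ → ℂ)} (hV : IsNashMap V) :
    IsNashMap fun t => star (V (star t)) where
  isNash i := (hV.isNash i).conj
  map_zero := by rw [star_zero, hV.map_zero, star_zero]

end Nash

section Jets

variable {ι σ T T' : Type} [Fintype T] [Fintype T'] [DecidableEq ι]

/-- `g` is holomorphic near `0` and its germ is algebraic over `B`. -/
def IsAlgebraicOver (B : Subring (HolGerm T)) (g : (T → ℂ) → ℂ) : Prop :=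
  ∃ hg : AnalyticAt ℂ g 0, germOf g hg ∈ algClosure B

theorem IsAlgebraicOver.congr {B : Subring (HolGerm T)} {g h : (T → ℂ) → ℂ}
    (hg : IsAlgebraicOver B g) (hgh : g =ᶠ[𝓝 0] h) : IsAlgebraicOver B h := by
  refine ⟨hg.1.congr hgh, ?_⟩
  rw [← germOf_eq_iff (hg := hg.1) |>.2 hgh]
  exact hg.2

/-- All the derivatives of the components of `f` are algebraic over `B` along the map `W`. -/
def JetsAlgebraicOver (B : Subring (HolGerm T)) (f : σ → (ι → ℂ) → ℂ)
    (W : (T → ℂ) → (ι → ℂ)) : Prop :=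
  ∀ L s, IsAlgebraicOver B fun t => iterPartial L (f s) (W t)

theorem JetsAlgebraicOver.mono {B B' : Subring (HolGerm T)} {f : σ → (ι → ℂ) → ℂ}
    {W : (T → ℂ) → (ι → ℂ)} (h : JetsAlgebraicOver B f W) (hB : B ≤ algClosure B') :
    JetsAlgebraicOver B' f W := fun L s =>
  ⟨(h L s).1, algClosure_le_algClosure hB (h L s).2⟩

theorem JetsAlgebraicOver.congr {B : Subring (HolGerm T)} {f : σ → (ι → ℂ) → ℂ}
    {W W' : (T → ℂ) → (ι → ℂ)} (h : JetsAlgebraicOver B f W) (hW : W =ᶠ[𝓝 0] W') :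
    JetsAlgebraicOver B f W' := fun L s =>
  (h L s).congr (hW.fun_comp _)

theorem JetsAlgebraicOver.conj [Finite ι] {B B' : Subring (HolGerm T)} {f : σ → (ι → ℂ) → ℂ}
    {W : (T → ℂ) → (ι → ℂ)} (h : JetsAlgebraicOver B f W) (hB : B.map (conjHom T) ≤ B') :
    JetsAlgebraicOver B' (fun s => conjFun (f s)) fun t => star (W (star t)) := fun L s => by
  refine IsAlgebraicOver.congr (g := conjFun fun t => iterPartial L (f s) (W t))
    ⟨analyticAt_conjFun (h L s).1, conjHom_mem_algClosure hB (h L s).2⟩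
    (Eventually.of_forall fun t => ?_)
  simp only [iterPartial_conjFun, conjFun, star_star]

theorem JetsAlgebraicOver.pullback [DecidableEq T] {B : Subring (HolGerm T)}
    {f : σ → (ι → ℂ) → ℂ} {W : (T → ℂ) → (ι → ℂ)} (h : JetsAlgebraicOver B f W)
    (hB : ∀ i, ∀ φ ∈ B, partialDeriv i φ ∈ B) {V : (T' → ℂ) → (T → ℂ)} (hV : IsNashMap V) :
    JetsAlgebraicOver (B.map hV.pullback) f fun t => W (V t) := fun L s =>
  ⟨(h L s).1.fun_comp_of_eq hV.analyticAt hV.map_zero,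
    pullback_mem_algClosure hV.analyticAt hV.map_zero hB (h L s).2⟩

theorem partialDeriv_germOf_reindex [Fintype ι] [DecidableEq T] {e : ι → T}
    (he : Function.Injective e) (k : ι) {g : (ι → ℂ) → ℂ} (hg : AnalyticAt ℂ g 0) :
    partialDeriv (e k) ((isNashMap_reindex e).pullback (germOf g hg)) =
      (isNashMap_reindex e).pullback (partialDeriv k (germOf g hg)) := by
  have hcoord (i : ι) : partialDeriv (e k) (germOf (fun t : T → ℂ => (t ∘ e) i)
      (analyticAt_pi_iff.1 (isNashMap_reindex e).analyticAt i)) = if i = k then 1 else 0 := by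
    change partialDeriv (e k) (germOf (fun t : T → ℂ => t (e i)) _) = _
    rw [← polyHom_X, partialDeriv_polyHom, MvPolynomial.pderiv_X, Pi.single_apply]
    simp only [he.eq_iff]
    split_ifs
    exacts [map_one _, map_zero _]
  rw [partialDeriv_pullback, Finset.sum_eq_single_of_mem k (Finset.mem_univ k)]
  · rw [hcoord k, if_pos rfl, mul_one]
  · intro i _ hik
    rw [hcoord i, if_neg hik, mul_zero]

theorem jetsAlgebraicOver_reindex [Fintype ι] [DecidableEq T] {B : Subring (HolGerm T)}
    (hB : ∀ i, ∀ φ ∈ B, partialDeriv i φ ∈ B) {e : ι → T} (he : Function.Injective e)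
    {f : σ → (ι → ℂ) → ℂ} (hf : ∀ s, AnalyticAt ℂ (f s) 0)
    (h : ∀ s, IsAlgebraicOver B fun t => f s (t ∘ e)) :
    JetsAlgebraicOver B f fun t => t ∘ e := fun L s => by
  refine ⟨(analyticAt_iterPartial L (hf s)).fun_comp_of_eq
    (isNashMap_reindex e).analyticAt rfl, ?_⟩
  induction L with
  | nil => exact (h s).2
  | cons k L ih =>
    exact (partialDeriv_germOf_reindex he k (analyticAt_iterPartial L (hf s))).subst
      (motive := (· ∈ algClosure B)) (derivation_mem_algClosure (partialDeriv (e k)) (hB (e k)) ih)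

/-- The ring generated by the algebraic germs and by the derivatives of the components of `f` along
the map `W`. -/
def jetRing (f : σ → (ι → ℂ) → ℂ) (W : (T → ℂ) → (ι → ℂ)) : Subring (HolGerm T) :=
  Subring.closure (nash T ∪ {φ | ∃ (L : List ι) (s : σ)
    (hg : AnalyticAt ℂ (fun t => iterPartial L (f s) (W t)) 0), φ = germOf _ hg})

theorem nashRing_le_jetRing (f : σ → (ι → ℂ) → ℂ) (W : (T → ℂ) → (ι → ℂ)) :
    nashRing T ≤ jetRing f W := fun _ hφ => Subring.subset_closure (Or.inl hφ)

theorem germOf_mem_jetRing {f : σ → (ι → ℂ) → ℂ} {W : (T → ℂ) → (ι → ℂ)} (L : List ι)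
    (s : σ) (hg : AnalyticAt ℂ (fun t => iterPartial L (f s) (W t)) 0) :
    germOf _ hg ∈ jetRing f W :=
  Subring.subset_closure (Or.inr ⟨L, s, hg, rfl⟩)

theorem jetRing_le {f : σ → (ι → ℂ) → ℂ} {W : (T → ℂ) → (ι → ℂ)} {B : Subring (HolGerm T)}
    (hB : nashRing T ≤ B)
    (h : ∀ L s (hg : AnalyticAt ℂ (fun t => iterPartial L (f s) (W t)) 0), germOf _ hg ∈ B) :
    jetRing f W ≤ B := by
  refine Subring.closure_le.2 ?_
  rintro φ (hφ | ⟨L, s, hg, rfl⟩)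
  exacts [hB hφ, h L s hg]

theorem JetsAlgebraicOver.jetRing_le {f : σ → (ι → ℂ) → ℂ} {W : (T → ℂ) → (ι → ℂ)}
    {B : Subring (HolGerm T)} (h : JetsAlgebraicOver B f W) (hB : nashRing T ≤ B) :
    jetRing f W ≤ algClosure B :=
  KeyAlg.jetRing_le (hB.trans (le_algClosure B)) fun L s _ => (h L s).2

theorem jetsAlgebraicOver_jetRing [Fintype ι] {f : σ → (ι → ℂ) → ℂ}
    (hf : ∀ s, AnalyticAt ℂ (f s) 0) {W : (T → ℂ) → (ι → ℂ)} (hW : IsNashMap W) :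
    JetsAlgebraicOver (jetRing f W) f W := fun L s =>
  ⟨(analyticAt_iterPartial L (hf s)).fun_comp_of_eq hW.analyticAt hW.map_zero,
    le_algClosure _ (germOf_mem_jetRing L s _)⟩

theorem partialDeriv_mem_jetRing [Fintype ι] [DecidableEq T] {f : σ → (ι → ℂ) → ℂ}
    (hf : ∀ s, AnalyticAt ℂ (f s) 0) {W : (T → ℂ) → (ι → ℂ)} (hW : IsNashMap W) (i : T)
    {φ : HolGerm T} (hφ : φ ∈ jetRing f W) : partialDeriv i φ ∈ jetRing f W := by
  refine derivation_mem_closure (partialDeriv i) ?_ hφ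
  rintro φ (hφ | ⟨L, s, hg, rfl⟩)
  · exact nashRing_le_jetRing f W (partialDeriv_mem_nashRing i hφ)
  · change partialDeriv i (hW.pullback (germOf _ (analyticAt_iterPartial L (hf s)))) ∈ jetRing f W
    rw [partialDeriv_pullback]
    exact sum_mem fun k _ => mul_mem (germOf_mem_jetRing (k :: L) s
        ((analyticAt_iterPartial (k :: L) (hf s)).fun_comp_of_eq hW.analyticAt hW.map_zero))
      (nashRing_le_jetRing f W (partialDeriv_mem_nashRing i (hW.isNash k).2))

theorem map_pullback_jetRing_le {f : σ → (ι → ℂ) → ℂ} {W : (T → ℂ) → (ι → ℂ)}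
    {V : (T' → ℂ) → (T → ℂ)} (hV : IsNashMap V) :
    (jetRing f W).map hV.pullback ≤ jetRing f fun t => W (V t) :=
  Subring.map_le_iff_le_comap.2 <| jetRing_le
    (fun _ hφ => nashRing_le_jetRing _ _ (hV.pullback_mem_nashRing hφ))
    fun L s hg => germOf_mem_jetRing L s (hg.fun_comp_of_eq hV.analyticAt hV.map_zero)

theorem map_conjHom_jetRing_le [Finite ι] (f : σ → (ι → ℂ) → ℂ) (W : (T → ℂ) → (ι → ℂ)) :
    (jetRing f W).map (conjHom T) ≤
      jetRing (fun s => conjFun (f s)) fun t => star (W (star t)) := by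
  refine Subring.map_le_iff_le_comap.2 <| jetRing_le
    (fun _ hφ => nashRing_le_jetRing _ _ (conjHom_mem_nashRing hφ)) fun L s hg => ?_
  have heq : conjFun (fun t => iterPartial L (f s) (W t)) =
      fun t => iterPartial L (conjFun (f s)) (star (W (star t))) := by
    funext t
    simp only [iterPartial_conjFun, conjFun, star_star]
  have hmem := germOf_mem_jetRing (f := fun s => conjFun (f s))
    (W := fun t => star (W (star t))) L s (heq ▸ analyticAt_conjFun hg)
  simpa only [Subring.mem_comap, conjHom_germOf, heq] using hmem

end Jets

/-! ### The algebraic relations on `𝓜` -/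

section NormalForm

variable {n m c : ℕ} {M : Set (Idx n m c → ℂ)} {Q : Fin m → (Fin n ⊕ Idx n m c → ℂ) → ℂ}
  {T : Type} [Fintype T]

theorem IsNormalForm.map_zero (hQ : IsNormalForm M Q) (j : Fin m) : Q j 0 = 0 := by
  have h := (hQ.normal_right j).self_of_nhds
  rwa [Sum.elim_zero_zero] at h

theorem isNashMap_pt {z : (T → ℂ) → (Fin n → ℂ)} {w : (T → ℂ) → (Fin m → ℂ)}
    {u : (T → ℂ) → (Fin c → ℂ)} (hz : IsNashMap z) (hw : IsNashMap w) (hu : IsNashMap u) :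
    IsNashMap fun t => pt (z t) (w t) (u t) :=
  hz.sumElim (hw.sumElim hu)

/-- The coordinates `(χ, Z)` on `𝓜`: the map `(χ, Z) ↦ (Z, (χ, Θ̄(χ, Z)))`. -/
def complexificationParam (Q : Fin m → (Fin n ⊕ Idx n m c → ℂ) → ℂ) (x : Fin n ⊕ Idx n m c → ℂ) :
    Idx n m c ⊕ Idx n m c → ℂ :=
  Sum.elim (x ∘ Sum.inr) (pt (x ∘ Sum.inl) (fun j => conjFun (Q j) x) (uPart (x ∘ Sum.inr)))

theorem isNashMap_complexificationParam (hQ : IsNormalForm M Q) :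
    IsNashMap (complexificationParam Q) :=
  (isNashMap_reindex Sum.inr).sumElim (isNashMap_pt (isNashMap_reindex Sum.inl)
    { isNash := fun j => (hQ.algebraic j).conj
      map_zero := funext fun j => by
        rw [conjFun, star_zero, hQ.map_zero, star_zero, Pi.zero_apply] }
    (isNashMap_reindex fun i => Sum.inr (Sum.inr (Sum.inr i))))

theorem complexificationParam_mem (x : Fin n ⊕ Idx n m c → ℂ) :
    complexificationParam Q x ∈ complexification Q :=
  ⟨fun j => congrArg (conjFun (Q j)) (Sum.elim_comp_inl_inr x).symm, rfl⟩

theorem complexificationParam_of_mem {x : Idx n m c ⊕ Idx n m c → ℂ}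
    (hx : x ∈ complexification Q) :
    complexificationParam Q (Sum.elim (zPart (x ∘ Sum.inr)) (x ∘ Sum.inl)) = x := by
  ext (i | i | i | i)
  exacts [rfl, rfl, (hx.1 i).symm, (congrFun hx.2 i).symm]

theorem pullback_complexificationParam_eq_zero_iff (hQ : IsNormalForm M Q)
    {φ : HolGerm (Idx n m c ⊕ Idx n m c)} :
    (isNashMap_complexificationParam hQ).pullback φ = 0 ↔
      φ ∈ vanishingIdeal (complexification Q) := by
  obtain ⟨g, hg, rfl⟩ := exists_eq_germOf φ
  rw [pullback_germOf, germOf_eq_zero_iff]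
  constructor
  · intro h
    have hcoord : Tendsto (fun x : Idx n m c ⊕ Idx n m c → ℂ =>
        (Sum.elim (zPart (x ∘ Sum.inr)) (x ∘ Sum.inl) : Fin n ⊕ Idx n m c → ℂ)) (𝓝 0) (𝓝 0) :=
      ((isNashMap_reindex fun i => Sum.inr (Sum.inl i)).sumElim
        (isNashMap_reindex Sum.inl)).tendsto
    refine ⟨g, rfl, ?_⟩
    filter_upwards [(hcoord.mono_left nhdsWithin_le_nhds).eventually h, self_mem_nhdsWithin]
      with x hx hmem
    rwa [complexificationParam_of_mem hmem] at hx
  · rintro ⟨g', hg', h⟩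
    have htendsto : Tendsto (complexificationParam Q) (𝓝 0) (𝓝[complexification Q] 0) :=
      tendsto_nhdsWithin_iff.2 ⟨(isNashMap_complexificationParam hQ).tendsto,
        Eventually.of_forall complexificationParam_mem⟩
    filter_upwards [(isNashMap_complexificationParam hQ).tendsto.eventually (Germ.coe_eq.1 hg'),
      htendsto.eventually h] with x hx hx'
    exact hx.trans hx'

end NormalForm

section Club

variable {n m c N' : ℕ} {M : Set (Idx n m c → ℂ)} {Q : Fin m → (Fin n ⊕ Idx n m c → ℂ) → ℂ}
  {f : Fin N' → (Idx n m c → ℂ) → ℂ} {T : Type} [Fintype T]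

theorem Club.isAlgebraicOver (hQ : IsNormalForm M Q) {hf : ∀ s, AnalyticAt ℂ (f s) 0}
    (hclub : Club Q f hf) (s : Fin N') :
    IsAlgebraicOver (jetRing (fun s => conjFun (f s))
      fun x => complexificationParam Q x ∘ Sum.inr) fun x => f s (x ∘ Sum.inr) := by
  obtain ⟨ℓ, h⟩ := hclub
  have hP := isNashMap_complexificationParam hQ
  refine ⟨(hf s).fun_comp_of_eq (isNashMap_reindex Sum.inr).analyticAt rfl, ?_⟩
  let restrict := Ideal.Quotient.lift (vanishingIdeal (complexification Q)) hP.pullback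
    fun φ hφ => (pullback_complexificationParam_eq_zero_iff hQ).2 hφ
  refine isAlgebraic_map_of_map_le (φ := restrict) ?_ ?_ (h s)
  · intro x _ hx
    obtain ⟨φ, rfl⟩ := Ideal.Quotient.mk_surjective x
    exact Ideal.Quotient.eq_zero_iff_mem.2 ((pullback_complexificationParam_eq_zero_iff hQ).1 hx)
  · rw [Subring.map_map, Subring.map_le_iff_le_comap]
    refine Subring.closure_le.2 ?_
    rintro φ (hφ | ⟨L, s, -, rfl⟩)
    · exact nashRing_le_jetRing _ _ (hP.pullback_mem_nashRing hφ)
    · exact germOf_mem_jetRing (f := fun s => conjFun (f s)) L s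
        ((analyticAt_iterPartial L (analyticAt_conjFun (hf s))).fun_comp_of_eq
          (hP.reindex Sum.inr).analyticAt (hP.reindex Sum.inr).map_zero)

theorem Club.jetsAlgebraicOver_Z (hQ : IsNormalForm M Q) {hf : ∀ s, AnalyticAt ℂ (f s) 0}
    (hclub : Club Q f hf) {V : (T → ℂ) → (Idx n m c ⊕ Idx n m c → ℂ)} (hV : IsNashMap V)
    (hVM : ∀ᶠ t in 𝓝 0, V t ∈ complexification Q) {B : Subring (HolGerm T)}
    (hB : nashRing T ≤ B)
    (h : JetsAlgebraicOver B (fun s => conjFun (f s)) fun t => V t ∘ Sum.inr) :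
    JetsAlgebraicOver B f fun t => V t ∘ Sum.inl := by
  have hjets := jetsAlgebraicOver_reindex
    (fun i _ => partialDeriv_mem_jetRing (fun s => analyticAt_conjFun (hf s))
      ((isNashMap_complexificationParam hQ).reindex Sum.inr) i)
    Sum.inr_injective hf (hclub.isAlgebraicOver hQ)
  have hW : IsNashMap fun t => (Sum.elim (zPart (V t ∘ Sum.inr)) (V t ∘ Sum.inl) :
      Fin n ⊕ Idx n m c → ℂ) :=
    (hV.reindex fun i => Sum.inr (Sum.inl i)).sumElim (hV.reindex Sum.inl)
  refine (hjets.pullback (fun i _ => partialDeriv_mem_jetRing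
    (fun s => analyticAt_conjFun (hf s))
    ((isNashMap_complexificationParam hQ).reindex Sum.inr) i) hW).mono ?_
  refine (map_pullback_jetRing_le hW).trans (JetsAlgebraicOver.jetRing_le (h.congr ?_) hB)
  filter_upwards [hVM] with t ht
  rw [complexificationParam_of_mem ht]

/-- The anti-holomorphic involution `(Z, ζ) ↦ (ζ̄, Z̄)`, which preserves `𝓜`. -/
def reflect {ι : Type} (x : ι ⊕ ι → ℂ) : ι ⊕ ι → ℂ := star (x ∘ Sum.swap)

theorem reflect_reflect {ι : Type} (x : ι ⊕ ι → ℂ) : reflect (reflect x) = x := by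
  ext (i | i) <;> exact star_star _

theorem reflect_add {ι : Type} (x y : ι ⊕ ι → ℂ) : reflect (x + y) = reflect x + reflect y :=
  star_add _ _

theorem reflect_smul {ι : Type} (a : ℂ) (x : ι ⊕ ι → ℂ) :
    reflect (a • x) = star a • reflect x := by
  ext (i | i) <;> exact star_smul a _

/-- The map `Z ↦ ((z, Q(z, ζ), u), ζ)`, where `u` is the last component of `ζ`: it parametrizes `𝓜`
by `(z, ζ)`, and its restrictions to `ζ = const` parametrize the leaves of the foliation of `𝓜`
whose tangent spaces complexify `T^{1,0}M`. -/
def leafParam (Q : Fin m → (Fin n ⊕ Idx n m c → ℂ) → ℂ) (x : Fin n ⊕ Idx n m c → ℂ) :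
    Idx n m c ⊕ Idx n m c → ℂ :=
  Sum.elim (pt (x ∘ Sum.inl) (fun j => Q j x) (uPart (x ∘ Sum.inr))) (x ∘ Sum.inr)

theorem isNashMap_leafParam (hQ : IsNormalForm M Q) : IsNashMap (leafParam Q) :=
  (isNashMap_pt (isNashMap_reindex Sum.inl) ⟨hQ.algebraic, funext hQ.map_zero⟩
    (isNashMap_reindex fun i => Sum.inr (Sum.inr (Sum.inr i)))).sumElim (isNashMap_reindex Sum.inr)

/-- The coordinates `(z, ζ)` of a point `(Z, ζ)`. -/
def leafCoords (x : Idx n m c ⊕ Idx n m c → ℂ) : Fin n ⊕ Idx n m c → ℂ :=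
  Sum.elim (zPart (x ∘ Sum.inl)) (x ∘ Sum.inr)

theorem IsNashMap.leafCoords {V : (T → ℂ) → (Idx n m c ⊕ Idx n m c → ℂ)} (hV : IsNashMap V) :
    IsNashMap fun t => leafCoords (V t) :=
  (hV.reindex fun i => Sum.inl (Sum.inl i)).sumElim (hV.reindex Sum.inr)

theorem reflect_mem_complexification_iff {x : Idx n m c ⊕ Idx n m c → ℂ} :
    reflect x ∈ complexification Q ↔
      (∀ j, wPart (x ∘ Sum.inl) j = Q j (leafCoords x)) ∧
        uPart (x ∘ Sum.inr) = uPart (x ∘ Sum.inl) := by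
  have hconj (j : Fin m) : conjFun (Q j) (Sum.elim (zPart (reflect x ∘ Sum.inr))
      (reflect x ∘ Sum.inl)) = star (Q j (leafCoords x)) := by
    rw [conjFun]
    congr 2
    ext (i | i) <;> exact star_star _
  refine and_congr (forall_congr' fun j => ?_) ?_
  · rw [hconj j]
    exact star_injective.eq_iff
  · exact star_injective.eq_iff (a := uPart (x ∘ Sum.inl)) |>.trans eq_comm

theorem eventually_reflect_mem (hQ : IsNormalForm M Q) :
    ∀ᶠ x in 𝓝 0, x ∈ complexification Q → reflect x ∈ complexification Q := by
  have hcoord : Tendsto (fun x : Idx n m c ⊕ Idx n m c → ℂ =>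
      (Sum.elim (zPart (x ∘ Sum.inr)) (x ∘ Sum.inl) : Fin n ⊕ Idx n m c → ℂ)) (𝓝 0) (𝓝 0) :=
    ((isNashMap_reindex fun i => Sum.inr (Sum.inl i)).sumElim
      (isNashMap_reindex Sum.inl)).tendsto
  filter_upwards [hcoord.eventually (eventually_all.2 hQ.reality)] with x hx hmem
  refine reflect_mem_complexification_iff.2 ⟨fun j => (hx j).symm.trans (congrArg (Q j) ?_), hmem.2⟩
  ext (i | i | i | i)
  exacts [rfl, rfl, (hmem.1 i).symm, (congrFun hmem.2 i).symm]

theorem tendsto_reflect {ι : Type} : Tendsto (reflect : (ι ⊕ ι → ℂ) → _) (𝓝 0) (𝓝 0) := by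
  have h : Continuous (reflect : (ι ⊕ ι → ℂ) → _) :=
    continuous_pi fun i => (continuous_apply i.swap).star
  have h0 : reflect (0 : ι ⊕ ι → ℂ) = 0 := star_zero _
  simpa only [h0] using h.tendsto 0

theorem eventually_reflect_mem_iff (hQ : IsNormalForm M Q) :
    ∀ᶠ x in 𝓝 0, reflect x ∈ complexification Q ↔ x ∈ complexification Q := by
  filter_upwards [eventually_reflect_mem hQ, tendsto_reflect.eventually (eventually_reflect_mem hQ)]
    with x h h'
  exact ⟨fun hx => reflect_reflect x ▸ h' hx, h⟩

theorem eventually_leafParam_mem (hQ : IsNormalForm M Q) :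
    ∀ᶠ x in 𝓝 0, leafParam Q x ∈ complexification Q := by
  filter_upwards [(isNashMap_leafParam hQ).tendsto.eventually (eventually_reflect_mem_iff hQ)]
    with x hx
  exact hx.1 (reflect_mem_complexification_iff.2
    ⟨fun j => congrArg (Q j) (Sum.elim_comp_inl_inr x).symm, rfl⟩)

theorem eventually_leafParam_leafCoords (hQ : IsNormalForm M Q) :
    ∀ᶠ x in 𝓝 0, x ∈ complexification Q → leafParam Q (leafCoords x) = x := by
  filter_upwards [eventually_reflect_mem_iff hQ] with x hx hmem
  obtain ⟨hw, hu⟩ := reflect_mem_complexification_iff.1 (hx.2 hmem)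
  ext ((i | i | i) | i)
  exacts [rfl, (hw i).symm, congrFun hu i, rfl]

/-- The map `t ↦ σ(V(t̄))`, where `σ(Z, ζ) = (ζ̄, Z̄)`. -/
def reflectMap {ι : Type} (V : (T → ℂ) → (ι ⊕ ι → ℂ)) (t : T → ℂ) : ι ⊕ ι → ℂ :=
  reflect (V (star t))

theorem IsNashMap.reflectMap {ι : Type} {V : (T → ℂ) → (ι ⊕ ι → ℂ)} (hV : IsNashMap V) :
    IsNashMap (reflectMap V) :=
  (hV.reindex Sum.swap).conj

theorem tendsto_star_zero {ι : Type} : Tendsto (star : (ι → ℂ) → (ι → ℂ)) (𝓝 0) (𝓝 0) := by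
  simpa only [star_zero] using (continuous_star (R := ι → ℂ)).tendsto 0

theorem eventually_reflectMap_mem (hQ : IsNormalForm M Q)
    {V : (T → ℂ) → (Idx n m c ⊕ Idx n m c → ℂ)} (hV : IsNashMap V)
    (hVM : ∀ᶠ t in 𝓝 0, V t ∈ complexification Q) :
    ∀ᶠ t in 𝓝 0, reflectMap V t ∈ complexification Q := by
  filter_upwards [tendsto_star_zero.eventually hVM,
    tendsto_star_zero.eventually (hV.tendsto.eventually (eventually_reflect_mem hQ))] with t h h'
  exact h' h

theorem Club.jetsAlgebraicOver_zeta (hQ : IsNormalForm M Q) {hf : ∀ s, AnalyticAt ℂ (f s) 0}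
    (hclub : Club Q f hf) {V : (T → ℂ) → (Idx n m c ⊕ Idx n m c → ℂ)} (hV : IsNashMap V)
    (hVM : ∀ᶠ t in 𝓝 0, V t ∈ complexification Q) {B : Subring (HolGerm T)}
    (hB : nashRing T ≤ B) (h : JetsAlgebraicOver B f fun t => V t ∘ Sum.inl) :
    JetsAlgebraicOver B (fun s => conjFun (f s)) fun t => V t ∘ Sum.inr := by
  have hnash : nashRing T ≤ B.map (conjHom T) := fun φ hφ =>
    ⟨conjHom T φ, hB (conjHom_mem_nashRing hφ), conjHom_conjHom φ⟩
  have hZ := hclub.jetsAlgebraicOver_Z hQ hV.reflectMap (eventually_reflectMap_mem hQ hV hVM)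
    hnash (h.conj le_rfl)
  have hconj : (B.map (conjHom T)).map (conjHom T) ≤ B := by
    rintro _ ⟨_, ⟨φ, hφ, rfl⟩, rfl⟩
    exact (conjHom_conjHom φ).symm ▸ hφ
  refine (hZ.conj hconj).congr (Eventually.of_forall fun t => ?_)
  simp only [reflectMap, star_star]
  exact star_star (V t ∘ Sum.inr)

end Club

/-! ### Segre chains -/

section Chains

variable {n m c N' : ℕ} {M : Set (Idx n m c → ℂ)} {Q : Fin m → (Fin n ⊕ Idx n m c → ℂ) → ℂ}
  {f : Fin N' → (Idx n m c → ℂ) → ℂ} {T : Type}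
  {V : (T → ℂ) → (Idx n m c ⊕ Idx n m c → ℂ)} {j : Fin c → T}

/-- The point `(0, 0, u)` with `u_i = t_{j(i)}`. -/
def uPoint (j : Fin c → T) (t : T → ℂ) : Idx n m c → ℂ := pt 0 0 (t ∘ j)

theorem isNashMap_uPoint [Fintype T] (j : Fin c → T) :
    IsNashMap (uPoint j : (T → ℂ) → (Idx n m c → ℂ)) :=
  isNashMap_pt isNashMap_zero isNashMap_zero (isNashMap_reindex j)

theorem star_uPoint (j : Fin c → T) (t : T → ℂ) :
    star (uPoint j t : Idx n m c → ℂ) = uPoint j (star t) := by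
  ext (_ | _ | _)
  exacts [star_zero _, star_zero _, rfl]

/-- The diagonal map `t ↦ ((0, 0, u), (0, 0, u))`, where `u_i = t_{j(i)}`. -/
def baseMap (j : Fin c → T) (t : T → ℂ) : Idx n m c ⊕ Idx n m c → ℂ :=
  Sum.elim (uPoint j t) (uPoint j t)

theorem eventually_baseMap_mem [Finite T] (hQ : IsNormalForm M Q) (j : Fin c → T) :
    ∀ᶠ t in 𝓝 0, baseMap j t ∈ complexification Q := by
  have := Fintype.ofFinite T
  have htendsto := (isNashMap_uPoint (n := n) (m := m) j).tendsto.comp tendsto_star_zero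
  filter_upwards [htendsto.eventually (eventually_all.2 hQ.normal_right)] with t ht
  refine ⟨fun k => ?_, rfl⟩
  have hstar : star (Sum.elim (zPart (baseMap (m := m) j t ∘ Sum.inr)) (baseMap j t ∘ Sum.inl)) =
      (Sum.elim 0 (uPoint j (star t)) : Fin n ⊕ Idx n m c → ℂ) := by
    ext (_ | i)
    · exact star_zero _
    · exact congrFun (star_uPoint j t) i
  rw [conjFun, hstar]
  exact ((congrArg star (ht k)).trans (star_zero _)).symm

variable [Fintype T]

theorem isNashMap_baseMap (j : Fin c → T) :
    IsNashMap (baseMap j : (T → ℂ) → (Idx n m c ⊕ Idx n m c → ℂ)) :=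
  (isNashMap_uPoint j).sumElim (isNashMap_uPoint j)

/-- The ring generated by the algebraic germs and the derivatives of `f` and `f̄` at `(0, 0, u)`,
where `u_i = t_{j(i)}`. -/
def symRing (f : Fin N' → (Idx n m c → ℂ) → ℂ) (j : Fin c → T) : Subring (HolGerm T) :=
  jetRing (Sum.elim f fun s => conjFun (f s)) (uPoint j)

theorem analyticAt_sumElim_conjFun (hf : ∀ s, AnalyticAt ℂ (f s) 0) (s : Fin N' ⊕ Fin N') :
    AnalyticAt ℂ (Sum.elim f (fun s => conjFun (f s)) s) 0 :=
  s.rec hf fun s => analyticAt_conjFun (hf s)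

theorem map_conjHom_symRing_le (f : Fin N' → (Idx n m c → ℂ) → ℂ) (j : Fin c → T) :
    (symRing f j).map (conjHom T) ≤ symRing f j := by
  refine (map_conjHom_jetRing_le _ _).trans (jetRing_le (nashRing_le_jetRing _ _) ?_)
  simp only [star_uPoint, star_star]
  rintro L (s | s) hg
  · exact germOf_mem_jetRing (f := Sum.elim f fun s => conjFun (f s)) L (Sum.inr s) hg
  · simp only [Sum.elim_inr, conjFun_conjFun]
    exact germOf_mem_jetRing (f := Sum.elim f fun s => conjFun (f s)) L (Sum.inl s) _

theorem Club.jetsAlgebraicOver_uPoint (hQ : IsNormalForm M Q)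
    {hf : ∀ s, AnalyticAt ℂ (f s) 0} (hclub : Club Q f hf) (j : Fin c → T) :
    JetsAlgebraicOver (jetRing f (uPoint j)) (Sum.elim f fun s => conjFun (f s)) (uPoint j) := by
  have hjets := jetsAlgebraicOver_jetRing hf (isNashMap_uPoint (n := n) (m := m) j)
  rintro L (s | s)
  · exact hjets L s
  · exact hclub.jetsAlgebraicOver_zeta hQ (isNashMap_baseMap j) (eventually_baseMap_mem hQ j)
      (nashRing_le_jetRing _ _) hjets L s

theorem Club.symRing_le (hQ : IsNormalForm M Q) {hf : ∀ s, AnalyticAt ℂ (f s) 0}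
    (hclub : Club Q f hf) (j : Fin c → T) :
    symRing f j ≤ algClosure (jetRing f (uPoint j)) :=
  (hclub.jetsAlgebraicOver_uPoint hQ j).jetRing_le (nashRing_le_jetRing _ _)

variable (Q f V j) in
/-- An algebraic map `V` into `𝓜`, with `u`-part `(t_{j(i)})_i`, along which the derivatives of
`f(Z)` and `f̄(ζ)` are algebraic over the ring generated by the algebraic germs and the derivatives
of `f` and `f̄` at `(0, 0, u)`. -/
structure IsChain : Prop where
  isNashMap : IsNashMap V
  mem : ∀ᶠ t in 𝓝 0, V t ∈ complexification Q
  injective : Function.Injective j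
  uPart_eq : ∀ᶠ t in 𝓝 0, uPart (V t ∘ Sum.inl) = t ∘ j
  jets_Z : JetsAlgebraicOver (symRing f j) f fun t => V t ∘ Sum.inl
  jets_zeta : JetsAlgebraicOver (symRing f j) (fun s => conjFun (f s)) fun t => V t ∘ Sum.inr

theorem IsChain.reflectMap (hQ : IsNormalForm M Q) (h : IsChain Q f V j) :
    IsChain Q f (reflectMap V) j where
  isNashMap := h.isNashMap.reflectMap
  mem := eventually_reflectMap_mem hQ h.isNashMap h.mem
  injective := h.injective
  uPart_eq := by
    filter_upwards [tendsto_star_zero.eventually h.mem, tendsto_star_zero.eventually h.uPart_eq]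
      with t hmem hu
    exact (congrArg star (hmem.2.trans hu)).trans (star_star (t ∘ j))
  jets_Z := by
    have hconj := h.jets_zeta.conj (map_conjHom_symRing_le f j)
    simp only [conjFun_conjFun] at hconj
    exact hconj
  jets_zeta := h.jets_Z.conj (map_conjHom_symRing_le f j)

theorem isChain_baseMap (hQ : IsNormalForm M Q) (hf : ∀ s, AnalyticAt ℂ (f s) 0) :
    IsChain Q f (baseMap id) id where
  isNashMap := isNashMap_baseMap _
  mem := eventually_baseMap_mem hQ _
  injective := Function.injective_id
  uPart_eq := Eventually.of_forall fun _ => rfl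
  jets_Z L s := jetsAlgebraicOver_jetRing (analyticAt_sumElim_conjFun hf)
    (isNashMap_uPoint id) L (Sum.inl s)
  jets_zeta L s := jetsAlgebraicOver_jetRing (analyticAt_sumElim_conjFun hf)
    (isNashMap_uPoint id) L (Sum.inr s)

/-- The map `(t, s) ↦ ((z + s, Q(z + s, ζ), u), ζ)`, where `V(t) = ((z, w, u), ζ)`. -/
def stepMap (Q : Fin m → (Fin n ⊕ Idx n m c → ℂ) → ℂ)
    (V : (T → ℂ) → (Idx n m c ⊕ Idx n m c → ℂ)) (y : T ⊕ Fin n → ℂ) :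
    Idx n m c ⊕ Idx n m c → ℂ :=
  leafParam Q (leafCoords (V (y ∘ Sum.inl)) + Sum.elim (y ∘ Sum.inr) 0)

theorem isNashMap_stepArg (hV : IsNashMap V) : IsNashMap fun y : T ⊕ Fin n → ℂ =>
    leafCoords (V (y ∘ Sum.inl)) + Sum.elim (y ∘ Sum.inr) 0 :=
  ((isNashMap_reindex Sum.inl).comp hV.leafCoords).add
    ((isNashMap_reindex Sum.inr).sumElim isNashMap_zero)

theorem IsChain.stepMap (hQ : IsNormalForm M Q) {hf : ∀ s, AnalyticAt ℂ (f s) 0}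
    (hclub : Club Q f hf) (h : IsChain Q f V j) :
    IsChain Q f (stepMap Q V) fun i => (Sum.inl (j i) : T ⊕ Fin n) := by
  classical
  have hfst : IsNashMap fun y : T ⊕ Fin n → ℂ => y ∘ Sum.inl := isNashMap_reindex Sum.inl
  have hnash : IsNashMap (KeyAlg.stepMap Q V) :=
    (isNashMap_stepArg h.isNashMap).comp (isNashMap_leafParam hQ)
  have hmem : ∀ᶠ y in 𝓝 0, KeyAlg.stepMap Q V y ∈ complexification Q :=
    (isNashMap_stepArg h.isNashMap).tendsto.eventually (eventually_leafParam_mem hQ)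
  have hinr (y : T ⊕ Fin n → ℂ) :
      KeyAlg.stepMap Q V y ∘ Sum.inr = V (y ∘ Sum.inl) ∘ Sum.inr := add_zero _
  have hzeta : JetsAlgebraicOver (symRing f fun i => (Sum.inl (j i) : T ⊕ Fin n))
      (fun s => conjFun (f s)) fun y => KeyAlg.stepMap Q V y ∘ Sum.inr := by
    simp only [hinr]
    exact (h.jets_zeta.pullback (fun i _ => partialDeriv_mem_jetRing
      (analyticAt_sumElim_conjFun hf) (isNashMap_uPoint j) i) hfst).mono
        ((map_pullback_jetRing_le hfst).trans (le_algClosure _))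
  exact
  { isNashMap := hnash
    mem := hmem
    injective := Sum.inl_injective.comp h.injective
    uPart_eq := by
      filter_upwards [hmem, hfst.tendsto.eventually h.mem, hfst.tendsto.eventually h.uPart_eq]
        with y hy hV hu
      rw [← hy.2, hinr, hV.2, hu]
      rfl
    jets_Z := hclub.jetsAlgebraicOver_Z hQ hnash hmem (nashRing_le_jetRing _ _) hzeta
    jets_zeta := hzeta }

end Chains

/-! ### Fields that are generically tangent to the image of a holomorphic map -/

theorem analyticAt_clm_apply {𝕜 E F G : Type*} [NontriviallyNormedField 𝕜]
    [NormedAddCommGroup E] [NormedSpace 𝕜 E] [NormedAddCommGroup F] [NormedSpace 𝕜 F]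
    [NormedAddCommGroup G] [NormedSpace 𝕜 G] {A : E → F →L[𝕜] G} {v : E → F} {x : E}
    (hA : AnalyticAt 𝕜 A x) (hv : AnalyticAt 𝕜 v x) : AnalyticAt 𝕜 (fun y => A y (v y)) x :=
  AnalyticAt.comp (f := fun y => (A y, v y)) (x := x)
    ((ContinuousLinearMap.id 𝕜 (F →L[𝕜] G)).analyticAt_bilinear (A x, v x)) (hA.prod hv)

section Tangent

variable {E F : Type*} [NormedAddCommGroup E] [NormedSpace ℂ E] [NormedAddCommGroup F]
  [NormedSpace ℂ F]

/-- The field `y` along `V` is generically tangent to the image of `V`: up to multiplication by a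
nonzero germ, it takes its values in the range of the derivative of `V`. -/
def TangentAlong (V : E → F) (y : E → F) : Prop :=
  ∃ (b : E → ℂ) (a : E → E), AnalyticAt ℂ b 0 ∧ AnalyticAt ℂ a 0 ∧ ¬ b =ᶠ[𝓝 0] 0 ∧
    ∀ᶠ t in 𝓝 0, b t • y t = fderiv ℂ V t (a t)

theorem not_eventuallyEq_zero_mul {b b' : E → ℂ} (hb : AnalyticAt ℂ b 0) (hb' : AnalyticAt ℂ b' 0)
    (h : ¬ b =ᶠ[𝓝 0] 0) (h' : ¬ b' =ᶠ[𝓝 0] 0) : ¬ (fun t => b t * b' t) =ᶠ[𝓝 0] 0 := fun H =>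
  (eventuallyEq_zero_or_of_mul hb hb' H).elim h h'

theorem TangentAlong.add {V y y' : E → F} (h : TangentAlong V y) (h' : TangentAlong V y') :
    TangentAlong V fun t => y t + y' t := by
  obtain ⟨b, a, hb, ha, hb0, h⟩ := h
  obtain ⟨b', a', hb', ha', hb0', h'⟩ := h'
  refine ⟨fun t => b t * b' t, fun t => b' t • a t + b t • a' t, hb.mul hb',
    (hb'.smul ha).add (hb.smul ha'), not_eventuallyEq_zero_mul hb hb' hb0 hb0', ?_⟩
  filter_upwards [h, h'] with t ht ht'
  rw [map_add, map_smul, map_smul, ← ht, ← ht']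
  module

theorem TangentAlong.const_smul {V y : E → F} (h : TangentAlong V y) (k : ℂ) :
    TangentAlong V fun t => k • y t := by
  obtain ⟨b, a, hb, ha, hb0, h⟩ := h
  refine ⟨b, fun t => k • a t, hb, analyticAt_const.smul ha, hb0, ?_⟩
  filter_upwards [h] with t ht
  rw [map_smul, ← ht, smul_comm]

theorem TangentAlong.zero {V : E → F} : TangentAlong V fun _ => 0 :=
  ⟨fun _ => 1, fun _ => 0, analyticAt_const, analyticAt_const,
    fun h => one_ne_zero h.self_of_nhds, by simp⟩

theorem eventually_smul_fderiv_apply_eq [CompleteSpace E] [CompleteSpace F] {V : E → F}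
    {Y : F → F} {a a' : E → E} {b b' : E → ℂ} (hV : AnalyticAt ℂ V 0)
    (hY : AnalyticAt ℂ Y (V 0)) (hb : AnalyticAt ℂ b 0) (ha : AnalyticAt ℂ a 0)
    (h : ∀ᶠ t in 𝓝 0, b t • Y (V t) = fderiv ℂ V t (a t))
    {y' : E → F} (h' : ∀ᶠ t in 𝓝 0, b' t • y' t = fderiv ℂ V t (a' t)) :
    ∀ᶠ t in 𝓝 0, (b t * b' t) • fderiv ℂ Y (V t) (y' t) =
      fderiv ℂ (fderiv ℂ V) t (a' t) (a t) + fderiv ℂ V t (fderiv ℂ a t (a' t))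
        - fderiv ℂ b t (a' t) • Y (V t) := by
  filter_upwards [h.eventually_nhds, h', hV.eventually_analyticAt, hb.eventually_analyticAt,
    ha.eventually_analyticAt, hV.continuousAt.eventually hY.eventually_analyticAt]
    with t ht ht' hVt hbt hat hYt
  have hleft : HasFDerivAt (fun t => b t • Y (V t)) _ t :=
    hbt.differentiableAt.hasFDerivAt.smul
      (hYt.differentiableAt.hasFDerivAt.comp t hVt.differentiableAt.hasFDerivAt)
  have hright : HasFDerivAt (fun t => fderiv ℂ V t (a t)) _ t :=
    hVt.fderiv.differentiableAt.hasFDerivAt.clm_apply hat.differentiableAt.hasFDerivAt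
  have heq := congrArg (fun A : E →L[ℂ] F => A (a' t))
    (hleft.unique (hright.congr_of_eventuallyEq ht))
  simp only [add_apply, smul_apply,
    ContinuousLinearMap.comp_apply, ContinuousLinearMap.smulRight_apply,
    ContinuousLinearMap.flip_apply] at heq
  rw [← ht', map_smul, smul_smul] at heq
  rw [eq_sub_iff_add_eq, add_comm (fderiv ℂ (fderiv ℂ V) t (a' t) (a t)), ← heq]

theorem TangentAlong.lieBracket [CompleteSpace E] [CompleteSpace F] {V : E → F} {Y Y' : F → F}
    (hV : AnalyticAt ℂ V 0) (hY : AnalyticAt ℂ Y (V 0)) (hY' : AnalyticAt ℂ Y' (V 0))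
    (h : TangentAlong V fun t => Y (V t)) (h' : TangentAlong V fun t => Y' (V t)) :
    TangentAlong V fun t => VectorField.lieBracket ℂ Y Y' (V t) := by
  obtain ⟨b, a, hb, ha, hb0, h⟩ := h
  obtain ⟨b', a', hb', ha', hb0', h'⟩ := h'
  have hbb := not_eventuallyEq_zero_mul hb hb' hb0 hb0'
  refine ⟨fun t => (b t * b' t) * (b t * b' t), fun t =>
    (b t * b' t) • (fderiv ℂ a' t (a t) - fderiv ℂ a t (a' t)) -
      (fderiv ℂ b' t (a t) * b t) • a' t + (fderiv ℂ b t (a' t) * b' t) • a t,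
    (hb.mul hb').mul (hb.mul hb'),
    (((hb.mul hb').smul ((analyticAt_clm_apply ha'.fderiv ha).sub
      (analyticAt_clm_apply ha.fderiv ha'))).sub
        (((analyticAt_clm_apply hb'.fderiv ha).mul hb).smul ha')).add
      (((analyticAt_clm_apply hb.fderiv ha').mul hb').smul ha),
    not_eventuallyEq_zero_mul (hb.mul hb') (hb.mul hb') hbb hbb, ?_⟩
  filter_upwards [h, h', eventually_smul_fderiv_apply_eq hV hY hb ha h h',
    eventually_smul_fderiv_apply_eq hV hY' hb' ha' h' h, hV.eventually_analyticAt]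
    with t hYt hY't hDY hDY' hVt
  have hsymm : fderiv ℂ (fderiv ℂ V) t (a' t) (a t) = fderiv ℂ (fderiv ℂ V) t (a t) (a' t) :=
    (hVt.contDiffAt (n := ⊤)).isSymmSndFDerivAt (by simp) _ _
  -- the symmetric second derivatives of `V` cancel in the bracket
  have hbracket : (b t * b' t) • VectorField.lieBracket ℂ Y Y' (V t) =
      fderiv ℂ V t (fderiv ℂ a' t (a t) - fderiv ℂ a t (a' t)) - fderiv ℂ b' t (a t) • Y' (V t)
        + fderiv ℂ b t (a' t) • Y (V t) := by
    rw [VectorField.lieBracket_eq, smul_sub, hDY, mul_comm, hDY', hsymm, map_sub]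
    abel
  simp only [mul_smul (b t * b' t) (b t * b' t), hbracket, map_add, map_sub, map_smul,
    ← hYt, ← hY't]
  module

end Tangent

/-! ### Generic rank -/

section Rank

variable {E F : Type*} [NormedAddCommGroup E] [NormedSpace ℂ E] [NormedAddCommGroup F]
  [NormedSpace ℂ F]

theorem analyticAt_det {ι : Type*} [Fintype ι] [DecidableEq ι] {A : E → Matrix ι ι ℂ} {t : E}
    (hA : ∀ i j, AnalyticAt ℂ (fun t => A t i j) t) : AnalyticAt ℂ (fun t => (A t).det) t := by
  simp only [Matrix.det_apply']
  exact Finset.analyticAt_fun_sum _ fun σ _ =>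
    analyticAt_const.mul (Finset.analyticAt_fun_prod _ fun i _ => hA _ _)

theorem analyticAt_adjugate {ι : Type*} [Fintype ι] [DecidableEq ι] {A : E → Matrix ι ι ℂ} {t : E}
    (hA : ∀ i j, AnalyticAt ℂ (fun t => A t i j) t) (i j : ι) :
    AnalyticAt ℂ (fun t => (A t).adjugate i j) t := by
  simp only [Matrix.adjugate_apply]
  refine analyticAt_det fun k l => ?_
  by_cases h : k = j
  · subst h
    simp only [Matrix.updateRow_self]
    exact analyticAt_const
  · simp only [Matrix.updateRow_ne h]
    exact hA k l

/-- The Gram-type matrix `ℓᵢ(vⱼ)` of a family of vectors `v` against the coordinates of a linear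
map `ℓ`; its determinant detects the independence of `v`. -/
def pairing {K G ι κ : Type*} [Field K] [AddCommGroup G] [Module K G] (ℓ : G →ₗ[K] (ι → K))
    (v : κ → G) : Matrix ι κ K :=
  Matrix.of fun i j => ℓ (v j) i

theorem linearIndependent_of_det_pairing_ne_zero {K G ι : Type*} [Field K] [AddCommGroup G]
    [Module K G] [Fintype ι] [DecidableEq ι] {ℓ : G →ₗ[K] (ι → K)} {v : ι → G}
    (h : (pairing ℓ v).det ≠ 0) : LinearIndependent K v :=
  LinearIndependent.of_comp ℓ (Matrix.linearIndependent_cols_of_det_ne_zero h)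

theorem exists_pairing_eq_one {K G ι : Type*} [Field K] [AddCommGroup G] [Module K G] [Finite ι]
    [DecidableEq ι] {v : ι → G} (hv : LinearIndependent K v) :
    ∃ ℓ : G →ₗ[K] (ι → K), pairing ℓ v = 1 := by
  have := Fintype.ofFinite ι
  obtain ⟨ℓ, hℓ⟩ := LinearMap.exists_leftInverse_of_injective (Fintype.linearCombination K v)
    (LinearMap.ker_eq_bot.2 hv.fintypeLinearCombination_injective)
  refine ⟨ℓ, Matrix.ext fun i j => ?_⟩
  have hj := congrFun (LinearMap.congr_fun hℓ (Pi.single j 1)) i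
  rw [LinearMap.comp_apply, Fintype.linearCombination_apply_single, one_smul] at hj
  rw [pairing, Matrix.of_apply, hj, LinearMap.id_apply, Matrix.one_apply, Pi.single_apply]

theorem det_pairing_smul_eq {K G ι : Type*} [Field K] [AddCommGroup G] [Module K G] [Fintype ι]
    [DecidableEq ι] (ℓ : G →ₗ[K] (ι → K)) {v : ι → G} {y : G}
    (hy : y ∈ Submodule.span K (Set.range v)) :
    (pairing ℓ v).det • y = ∑ j, ((pairing ℓ v).adjugate.mulVec (ℓ y)) j • v j := by
  obtain ⟨x, rfl⟩ := (Submodule.mem_span_range_iff_exists_fun K).1 hy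
  have hℓ : ℓ (∑ i, x i • v i) = (pairing ℓ v).mulVec x := by
    funext i
    simp [Matrix.mulVec, dotProduct, pairing, mul_comm]
  rw [hℓ, Matrix.mulVec_mulVec, Matrix.adjugate_mul, Matrix.smul_mulVec, Matrix.one_mulVec,
    Finset.smul_sum]
  exact Finset.sum_congr rfl fun j _ => by rw [Pi.smul_apply, smul_eq_mul, mul_smul]

/-- The linear map `A` has rank at least `r`. -/
def RankGE (A : E →L[ℂ] F) (r : ℕ) : Prop :=
  ∃ κ : Fin r → E, LinearIndependent ℂ fun i => A (κ i)

variable [CompleteSpace F] [FiniteDimensional ℂ F]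

theorem analyticAt_pairing_fderiv {ι : Type*} [Finite ι] {V : E → F} {t : E}
    (hV : AnalyticAt ℂ V t) (ℓ : F →ₗ[ℂ] (ι → ℂ)) (κ : ι → E) (i j : ι) :
    AnalyticAt ℂ (fun t => pairing ℓ (fun k => fderiv ℂ V t (κ k)) i j) t :=
  have := Fintype.ofFinite ι
  analyticAt_pi_iff.1 (((LinearMap.toContinuousLinearMap ℓ).analyticAt _).comp
    (analyticAt_clm_apply hV.fderiv analyticAt_const)) i

theorem exists_minor_not_eventuallyEq_zero {V : E → F} {r : ℕ} (hV : AnalyticAt ℂ V 0)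
    (hr : ∃ᶠ t in 𝓝 0, RankGE (fderiv ℂ V t) r) :
    ∃ (κ : Fin r → E) (ℓ : F →ₗ[ℂ] (Fin r → ℂ)),
      ¬ (fun t => (pairing ℓ fun i => fderiv ℂ V t (κ i)).det) =ᶠ[𝓝 0] 0 := by
  obtain ⟨ρ, hρ, hball⟩ := Metric.eventually_nhds_iff_ball.1 hV.eventually_analyticAt
  obtain ⟨t₀, ⟨κ, hκ⟩, ht₀⟩ := (hr.and_eventually (Metric.ball_mem_nhds 0 hρ)).exists
  obtain ⟨ℓ, hℓ⟩ := exists_pairing_eq_one hκ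
  refine ⟨κ, ℓ, fun h => ?_⟩
  have hdet : AnalyticOnNhd ℂ (fun t => (pairing ℓ fun i => fderiv ℂ V t (κ i)).det)
      (Metric.ball 0 ρ) := fun t ht => analyticAt_det (analyticAt_pairing_fderiv (hball t ht) ℓ κ)
  let : NormedSpace ℝ E := NormedSpace.restrictScalars ℝ ℂ E
  have hzero := hdet.eqOn_zero_of_preconnected_of_eventuallyEq_zero
    (convex_ball (0 : E) ρ).isPreconnected (Metric.mem_ball_self hρ) h ht₀
  simp only [hℓ, Matrix.det_one, Pi.zero_apply, one_ne_zero] at hzero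

theorem tangentAlong_of_rank {V y : E → F} {r : ℕ} (hV : AnalyticAt ℂ V 0)
    (hy : AnalyticAt ℂ y 0) (hr : ∃ᶠ t in 𝓝 0, RankGE (fderiv ℂ V t) r)
    (hmax : ∀ᶠ t in 𝓝 0, ∀ κ : Fin r → E,
      ¬ LinearIndependent ℂ (Fin.cons (y t) fun i => fderiv ℂ V t (κ i) : Fin (r + 1) → F)) :
    TangentAlong V y := by
  obtain ⟨κ, ℓ, hdet⟩ := exists_minor_not_eventuallyEq_zero hV hr
  let A : E → Matrix (Fin r) (Fin r) ℂ := fun t => pairing ℓ fun i => fderiv ℂ V t (κ i)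
  have hA : ∀ i j, AnalyticAt ℂ (fun t => A t i j) 0 := analyticAt_pairing_fderiv hV ℓ κ
  have hℓy : AnalyticAt ℂ (fun t => ℓ (y t)) 0 :=
    ((LinearMap.toContinuousLinearMap ℓ).analyticAt _).comp hy
  have hx : AnalyticAt ℂ (fun t => ∑ j, ((A t).adjugate.mulVec (ℓ (y t))) j • κ j) 0 := by
    refine Finset.analyticAt_fun_sum _ fun j _ => AnalyticAt.smul ?_ analyticAt_const
    simp only [Matrix.mulVec, dotProduct]
    exact Finset.analyticAt_fun_sum _ fun i _ =>
      (analyticAt_adjugate hA j i).mul (analyticAt_pi_iff.1 hℓy i)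
  have hAdet := analyticAt_det hA
  refine ⟨fun t => (A t).det * (A t).det, fun t => (A t).det •
    ∑ j, ((A t).adjugate.mulVec (ℓ (y t))) j • κ j, hAdet.mul hAdet,
    hAdet.smul hx, not_eventuallyEq_zero_mul hAdet hAdet hdet hdet, ?_⟩
  filter_upwards [hmax] with t ht
  obtain hd | hd := eq_or_ne (A t).det 0
  · simp [hd]
  · have hspan : y t ∈ Submodule.span ℂ (Set.range fun i => fderiv ℂ V t (κ i)) := by
      by_contra h
      exact ht κ (linearIndependent_finCons.2 ⟨linearIndependent_of_det_pairing_ne_zero hd, h⟩)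
    rw [mul_smul, map_smul, det_pairing_smul_eq ℓ hspan, map_sum]
    simp only [map_smul, A]

end Rank

/-! ### A chain of maximal generic rank -/

section MaxRank

theorem tendsto_sumElim_zero {S T : Type} :
    Tendsto (fun t : T → ℂ => (Sum.elim t 0 : T ⊕ S → ℂ)) (𝓝 0) (𝓝 0) := by
  have h : Continuous (fun t : T → ℂ => (Sum.elim t 0 : T ⊕ S → ℂ)) :=
    continuous_pi (Sum.rec (fun i => continuous_apply i) fun _ => continuous_const)
  simpa only [Sum.elim_zero_zero] using h.tendsto 0

theorem fderiv_reflectMap {T ι : Type} [Finite T] [Finite ι] {V : (T → ℂ) → (ι ⊕ ι → ℂ)}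
    {t : T → ℂ} (hV : DifferentiableAt ℂ V (star t)) (h : T → ℂ) :
    fderiv ℂ (reflectMap V) t h = reflect (fderiv ℂ V (star t) (star h)) := by
  have := Fintype.ofFinite T
  have := Fintype.ofFinite ι
  have hswap : HasFDerivAt (fun y => V y ∘ Sum.swap)
      ((ContinuousLinearMap.pi fun i => ContinuousLinearMap.proj (Sum.swap i)).comp
        (fderiv ℂ V (star t))) (star t) :=
    (ContinuousLinearMap.pi fun i : ι ⊕ ι => ContinuousLinearMap.proj (R := ℂ)
      (φ := fun _ : ι ⊕ ι => ℂ) i.swap).hasFDerivAt.comp _ hV.hasFDerivAt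
  refine (fderiv_star_comp_star (fun y => V y ∘ Sum.swap) t h).trans ?_
  rw [hswap.fderiv]
  rfl

variable {n m c N' : ℕ} {M : Set (Idx n m c → ℂ)} {Q : Fin m → (Fin n ⊕ Idx n m c → ℂ) → ℂ}
  {f : Fin N' → (Idx n m c → ℂ) → ℂ} {T : Type} [Fintype T]
  {V : (T → ℂ) → (Idx n m c ⊕ Idx n m c → ℂ)}

/-- The vector field on `𝓜` that is `∂/∂z_k` in the coordinates `(z, ζ)`. -/
def leafField (Q : Fin m → (Fin n ⊕ Idx n m c → ℂ) → ℂ) (k : Fin n)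
    (x : Idx n m c ⊕ Idx n m c → ℂ) : Idx n m c ⊕ Idx n m c → ℂ :=
  fderiv ℂ (leafParam Q) (leafCoords x) (Pi.single (Sum.inl k) 1)

theorem isNashMap_leafCoords :
    IsNashMap (leafCoords : (Idx n m c ⊕ Idx n m c → ℂ) → (Fin n ⊕ Idx n m c → ℂ)) :=
  (isNashMap_reindex id).leafCoords

theorem analyticAt_leafField (hQ : IsNormalForm M Q) (k : Fin n) :
    AnalyticAt ℂ (leafField Q k) 0 :=
  analyticAt_clm_apply ((isNashMap_leafParam hQ).analyticAt.fderiv.fun_comp_of_eq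
    isNashMap_leafCoords.analyticAt isNashMap_leafCoords.map_zero) analyticAt_const

theorem eventually_leafField_eq (hQ : IsNormalForm M Q) :
    ∀ᶠ x in 𝓝 0, ∀ k, leafField Q k x = Sum.elim (pt (Pi.single k 1)
      (fun l => fderiv ℂ (Q l) (leafCoords x) (Pi.single (Sum.inl k) 1)) 0) 0 := by
  filter_upwards [isNashMap_leafCoords.tendsto.eventually
    (isNashMap_leafParam hQ).analyticAt.eventually_analyticAt] with x hx k
  have happly (i) : leafField Q k x i =
      fderiv ℂ (fun p => leafParam Q p i) (leafCoords x) (Pi.single (Sum.inl k) 1) :=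
    (DFunLike.congr_fun (fderiv_apply hx.differentiableAt i) _).symm
  have hcoord (i : Fin n ⊕ Idx n m c) :
      fderiv ℂ (fun p : Fin n ⊕ Idx n m c → ℂ => p i) (leafCoords x) (Pi.single (Sum.inl k) 1) =
        (Pi.single (Sum.inl k) 1 : Fin n ⊕ Idx n m c → ℂ) i :=
    DFunLike.congr_fun (hasFDerivAt_apply i _).fderiv _
  ext ((i | i | i) | i) <;> rw [happly]
  · exact (hcoord (Sum.inl i)).trans (by simp [pt, Pi.single_apply])
  · rfl
  · exact hcoord (Sum.inr (Sum.inr (Sum.inr i)))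
  · exact hcoord (Sum.inr i)

theorem isNashMap_stepMap (hQ : IsNormalForm M Q) (hV : IsNashMap V) : IsNashMap (stepMap Q V) :=
  (isNashMap_stepArg hV).comp (isNashMap_leafParam hQ)

theorem eventually_stepMap_eq (hQ : IsNormalForm M Q) (hV : IsNashMap V)
    (hVM : ∀ᶠ t in 𝓝 0, V t ∈ complexification Q) :
    ∀ᶠ t in 𝓝 0, stepMap Q V (Sum.elim t 0) = V t := by
  filter_upwards [hVM, hV.tendsto.eventually (eventually_leafParam_leafCoords hQ)]
    with t hmem hleaf
  rw [stepMap, Sum.elim_comp_inl, Sum.elim_comp_inr, Sum.elim_zero_zero, add_zero, hleaf hmem]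

theorem eventually_fderiv_stepMap_inl (hQ : IsNormalForm M Q) (hV : IsNashMap V)
    (hVM : ∀ᶠ t in 𝓝 0, V t ∈ complexification Q) :
    ∀ᶠ t in 𝓝 0, ∀ h, fderiv ℂ (stepMap Q V) (Sum.elim t 0) (Sum.elim h 0) = fderiv ℂ V t h := by
  filter_upwards [(eventually_stepMap_eq hQ hV hVM).eventually_nhds,
    hV.analyticAt.eventually_analyticAt, tendsto_sumElim_zero.eventually
      (isNashMap_stepMap hQ hV).analyticAt.eventually_analyticAt] with t heq hVt hstep h
  have hline : Tendsto (fun s : ℂ => t + s • h) (𝓝 0) (𝓝 t) := by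
    have hcont : Continuous fun s : ℂ => t + s • h := by fun_prop
    simpa only [zero_smul, add_zero] using hcont.tendsto 0
  rw [← hstep.differentiableAt.lineDeriv_eq_fderiv, ← hVt.differentiableAt.lineDeriv_eq_fderiv]
  refine EventuallyEq.deriv_eq ?_
  filter_upwards [hline.eventually heq] with s hs
  rw [← hs]
  congr 1
  ext (i | i) <;> simp

theorem eventually_fderiv_stepMap_inr [DecidableEq T] (hQ : IsNormalForm M Q) (hV : IsNashMap V)
    (k : Fin n) :
    ∀ᶠ t in 𝓝 0, fderiv ℂ (stepMap Q V) (Sum.elim t 0) (Pi.single (Sum.inr k) 1) =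
      leafField Q k (V t) := by
  filter_upwards [hV.leafCoords.tendsto.eventually
    (isNashMap_leafParam hQ).analyticAt.eventually_analyticAt, tendsto_sumElim_zero.eventually
      (isNashMap_stepMap hQ hV).analyticAt.eventually_analyticAt] with t hleaf hstep
  rw [leafField, ← hstep.differentiableAt.lineDeriv_eq_fderiv,
    ← hleaf.differentiableAt.lineDeriv_eq_fderiv]
  refine congrArg (deriv · 0) (funext fun s => ?_)
  have hinl : (Sum.elim t 0 + s • Pi.single (Sum.inr k) 1 : T ⊕ Fin n → ℂ) ∘ Sum.inl = t := by
    ext i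
    simp
  rw [stepMap, hinl]
  congr 2
  ext (i | i) <;> simp [Pi.single_apply]

section Reflect

variable {ι : Type} [Fintype ι] {V : (T → ℂ) → (ι ⊕ ι → ℂ)}

theorem rankGE_reflectMap {t : T → ℂ} {r : ℕ} (hV : DifferentiableAt ℂ V t)
    (h : RankGE (fderiv ℂ V t) r) : RankGE (fderiv ℂ (reflectMap V) (star t)) r := by
  obtain ⟨κ, hκ⟩ := h
  refine ⟨fun i => star (κ i), ?_⟩
  have hfderiv (i) :
      fderiv ℂ (reflectMap V) (star t) (star (κ i)) = reflect (fderiv ℂ V t (κ i)) := by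
    rw [fderiv_reflectMap (by rwa [star_star]), star_star, star_star]
  simp only [hfderiv]
  exact hκ.map_of_injective_injective star (AddMonoidHom.mk' reflect reflect_add)
    (fun _ => star_eq_zero.1) (fun x (hx : reflect x = 0) => by
      rw [← reflect_reflect x, hx]; exact star_zero _)
    fun a x => (reflect_smul _ x).trans (by rw [star_star]; rfl)

theorem TangentAlong.of_reflectMap (hV : AnalyticAt ℂ V 0) {y : (T → ℂ) → (ι ⊕ ι → ℂ)}
    (h : TangentAlong (reflectMap V) y) : TangentAlong V fun t => reflect (y (star t)) := by
  obtain ⟨b, a, hb, ha, hb0, h⟩ := h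
  refine ⟨conjFun b, fun t => star (a (star t)), analyticAt_conjFun hb,
    analyticAt_pi_iff.2 fun i => analyticAt_conjFun (analyticAt_pi_iff.1 ha i),
    fun hb' => hb0 ?_, ?_⟩
  · filter_upwards [tendsto_star_zero.eventually hb'] with t ht
    simpa only [conjFun, star_star, Pi.zero_apply, star_eq_zero] using ht
  · filter_upwards [tendsto_star_zero.eventually h, hV.eventually_analyticAt] with t ht hVt
    rw [fderiv_reflectMap (by rw [star_star]; exact hVt.differentiableAt), star_star] at ht
    rw [conjFun, ← reflect_smul, ht, reflect_reflect]

end Reflect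

theorem tangentAlong_leafField (hQ : IsNormalForm M Q) (hV : IsNashMap V)
    (hVM : ∀ᶠ t in 𝓝 0, V t ∈ complexification Q) {r : ℕ}
    (hr : ∃ᶠ t in 𝓝 0, RankGE (fderiv ℂ V t) r)
    (hmax : ¬ ∃ᶠ y in 𝓝 0, RankGE (fderiv ℂ (stepMap Q V) y) (r + 1)) (k : Fin n) :
    TangentAlong V fun t => leafField Q k (V t) := by
  classical
  refine tangentAlong_of_rank hV.analyticAt
    ((analyticAt_leafField hQ k).fun_comp_of_eq hV.analyticAt hV.map_zero) hr ?_
  filter_upwards [tendsto_sumElim_zero.eventually (not_frequently.1 hmax),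
    eventually_fderiv_stepMap_inl hQ hV hVM, eventually_fderiv_stepMap_inr hQ hV k]
    with t hrank hinl hinr κ hκ
  refine hrank ⟨Fin.cons (Pi.single (Sum.inr k) 1) fun i => Sum.elim (κ i) 0, ?_⟩
  convert hκ using 1
  funext i
  refine Fin.cases ?_ (fun i => ?_) i
  · simp only [Fin.cons_zero, hinr]
  · simp only [Fin.cons_succ, hinl]

theorem exists_isChain_maximal_rank (hQ : IsNormalForm M Q) (hf : ∀ s, AnalyticAt ℂ (f s) 0) :
    ∃ (r : ℕ) (T : Type) (_ : Fintype T) (V : (T → ℂ) → (Idx n m c ⊕ Idx n m c → ℂ))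
      (j : Fin c → T), IsChain Q f V j ∧ (∃ᶠ t in 𝓝 0, RankGE (fderiv ℂ V t) r) ∧
        ∀ (T' : Type) [Fintype T'] (V' : (T' → ℂ) → (Idx n m c ⊕ Idx n m c → ℂ))
          (j' : Fin c → T'), IsChain Q f V' j' →
            ¬ ∃ᶠ t in 𝓝 0, RankGE (fderiv ℂ V' t) (r + 1) := by
  classical
  let P : ℕ → Prop := fun r => ∃ (T : Type) (_ : Fintype T)
    (V : (T → ℂ) → (Idx n m c ⊕ Idx n m c → ℂ)) (j : Fin c → T), IsChain Q f V j ∧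
      ∃ᶠ t in 𝓝 0, RankGE (fderiv ℂ V t) r
  have hzero : P 0 := ⟨Fin c, inferInstance, _, _, isChain_baseMap hQ hf,
    (Eventually.of_forall fun t => ⟨Fin.elim0, linearIndependent_empty_type⟩).frequently⟩
  have hbound (r) (h : P r) : r ≤ Fintype.card (Idx n m c ⊕ Idx n m c) := by
    obtain ⟨T, _, V, j, -, h⟩ := h
    obtain ⟨t, κ, hκ⟩ := h.exists
    simpa using hκ.fintype_card_le_finrank
  obtain ⟨T, hT, V, j, hV, hr⟩ := Nat.findGreatest_spec (Nat.zero_le _) hzero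
  exact ⟨_, T, hT, V, j, hV, hr, fun T' hT' V' j' hV' h =>
    have hP : P _ := ⟨T', hT', V', j', hV', h⟩
    (Nat.le_findGreatest (hbound _ hP) hP).not_gt (Nat.lt_succ_self _)⟩

theorem exists_isChain_tangentAlong (hQ : IsNormalForm M Q) {hf : ∀ s, AnalyticAt ℂ (f s) 0}
    (hclub : Club Q f hf) :
    ∃ (T : Type) (_ : Fintype T) (V : (T → ℂ) → (Idx n m c ⊕ Idx n m c → ℂ)) (j : Fin c → T),
      IsChain Q f V j ∧ (∀ k, TangentAlong V fun t => leafField Q k (V t)) ∧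
        ∀ k, TangentAlong V fun t => reflect (leafField Q k (reflect (V t))) := by
  obtain ⟨r, T, _, V, j, hV, hr, hmax⟩ := exists_isChain_maximal_rank hQ hf
  have htangent (V : (T → ℂ) → (Idx n m c ⊕ Idx n m c → ℂ)) (hV : IsChain Q f V j)
      (hr : ∃ᶠ t in 𝓝 0, RankGE (fderiv ℂ V t) r) (k : Fin n) :
      TangentAlong V fun t => leafField Q k (V t) :=
    tangentAlong_leafField hQ hV.isNashMap hV.mem hr
      (hmax _ (stepMap Q V) _ (hV.stepMap hQ hclub)) k
  have hreflect : ∃ᶠ t in 𝓝 0, RankGE (fderiv ℂ (reflectMap V) t) r :=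
    tendsto_star_zero.frequently
      ((hr.and_eventually hV.isNashMap.analyticAt.eventually_analyticAt).mono fun t ht =>
        rankGE_reflectMap ht.2.differentiableAt ht.1)
  refine ⟨T, _, V, j, hV, htangent V hV hr, fun k => ?_⟩
  have h := (htangent (reflectMap V) (hV.reflectMap hQ) hreflect k).of_reflectMap
    hV.isNashMap.analyticAt
  simpa only [reflectMap, star_star] using h

end MaxRank

/-! ### Real-analytic vector fields on `M` as combinations of tangent holomorphic fields -/

section ConjDiag

variable {ι : Type}

variable (ι) in
/-- The embedding `Z ↦ (Z, Z̄)`, which identifies `M` with a totally real subset of `𝓜`. -/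
def conjDiag : (ι → ℂ) →L[ℝ] (ι ⊕ ι → ℂ) :=
  ContinuousLinearMap.pi (Sum.elim (fun i => ContinuousLinearMap.proj (R := ℝ) i)
    (fun i => (Complex.conjCLE : ℂ →L[ℝ] ℂ).comp (ContinuousLinearMap.proj (R := ℝ) i)))

theorem reflect_conjDiag (v : ι → ℂ) : reflect (conjDiag ι v) = conjDiag ι v := by
  ext (i | i)
  · exact star_star (v i)
  · rfl

theorem tendsto_conjDiag : Tendsto (conjDiag ι) (𝓝 0) (𝓝 0) := by
  simpa only [map_zero] using (conjDiag ι).continuous.tendsto 0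

theorem analyticAt_comp_conjDiag [Fintype ι] {E : Type*} [NormedAddCommGroup E] [NormedSpace ℂ E]
    {Y : (ι ⊕ ι → ℂ) → E} (hY : AnalyticAt ℂ Y 0) :
    AnalyticAt ℝ (fun Z => Y (conjDiag ι Z)) 0 :=
  hY.restrictScalars.fun_comp_of_eq ((conjDiag ι).analyticAt 0) (map_zero _)

theorem hasFDerivAt_sum_smul_comp_conjDiag {κ : Type} [Fintype κ] [Finite ι]
    {a : κ → (ι → ℂ) → ℂ} {Y : κ → (ι ⊕ ι → ℂ) → (ι ⊕ ι → ℂ)} {Z : ι → ℂ}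
    (ha : ∀ i, DifferentiableAt ℝ (a i) Z) (hY : ∀ i, DifferentiableAt ℂ (Y i) (conjDiag ι Z)) :
    HasFDerivAt (fun Z => ∑ i, a i Z • Y i (conjDiag ι Z))
      (∑ i, (a i Z • ((fderiv ℂ (Y i) (conjDiag ι Z)).restrictScalars ℝ).comp (conjDiag ι) +
        (fderiv ℝ (a i) Z).smulRight (Y i (conjDiag ι Z)))) Z :=
  have := Fintype.ofFinite ι
  HasFDerivAt.fun_sum fun i _ => (ha i).hasFDerivAt.smul
    (((hY i).hasFDerivAt.restrictScalars ℝ).comp Z (conjDiag ι).hasFDerivAt)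

end ConjDiag

theorem analyticAt_lieBracket {𝕜 E : Type*} [NontriviallyNormedField 𝕜] [NormedAddCommGroup E]
    [NormedSpace 𝕜 E] [CompleteSpace E] {X Y : E → E} {x : E} (hX : AnalyticAt 𝕜 X x)
    (hY : AnalyticAt 𝕜 Y x) : AnalyticAt 𝕜 (VectorField.lieBracket 𝕜 X Y) x :=
  (analyticAt_clm_apply hY.fderiv hX).sub (analyticAt_clm_apply hX.fderiv hY)

theorem analyticAt_reflect_comp_reflect {ι : Type} [Fintype ι] {Y : (ι ⊕ ι → ℂ) → (ι ⊕ ι → ℂ)}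
    (hY : AnalyticAt ℂ Y 0) : AnalyticAt ℂ (fun x => reflect (Y (reflect x))) 0 :=
  analyticAt_pi_iff.2 fun i => (analyticAt_conjFun (analyticAt_pi_iff.1 hY i.swap)).fun_comp_of_eq
    (isNashMap_reindex Sum.swap).analyticAt rfl

section CRFields

variable {n m c : ℕ} {M : Set (Idx n m c → ℂ)} {T : Type} [Fintype T]
  {V : (T → ℂ) → (Idx n m c ⊕ Idx n m c → ℂ)}
  {Y Y' : (Idx n m c ⊕ Idx n m c → ℂ) → (Idx n m c ⊕ Idx n m c → ℂ)}
  {G G' : (Idx n m c → ℂ) → (Idx n m c ⊕ Idx n m c → ℂ)}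
  {X X' : (Idx n m c → ℂ) → (Idx n m c → ℂ)}

variable (V Y) in
/-- The holomorphic vector field `Y` on `ℂ^N_Z × ℂ^N_ζ` is generically tangent to the image of `V`
and does not involve `∂/∂u`. -/
structure IsTangentField : Prop where
  analyticAt : AnalyticAt ℂ Y 0
  tangentAlong : TangentAlong V fun t => Y (V t)
  uPart_eq : ∀ᶠ x in 𝓝 0, uPart (Y x ∘ Sum.inl) = 0

theorem IsTangentField.add (h : IsTangentField V Y) (h' : IsTangentField V Y') :
    IsTangentField V (Y + Y') where
  analyticAt := h.analyticAt.add h'.analyticAt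
  tangentAlong := h.tangentAlong.add h'.tangentAlong
  uPart_eq := by
    filter_upwards [h.uPart_eq, h'.uPart_eq] with x hx hx'
    calc uPart ((Y + Y') x ∘ Sum.inl) = uPart (Y x ∘ Sum.inl) + uPart (Y' x ∘ Sum.inl) := rfl
      _ = 0 := by rw [hx, hx', add_zero]

theorem IsTangentField.const_smul (h : IsTangentField V Y) (a : ℂ) :
    IsTangentField V (a • Y) where
  analyticAt := analyticAt_const.smul h.analyticAt
  tangentAlong := h.tangentAlong.const_smul a
  uPart_eq := by
    filter_upwards [h.uPart_eq] with x hx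
    calc uPart ((a • Y) x ∘ Sum.inl) = a • uPart (Y x ∘ Sum.inl) := rfl
      _ = 0 := by rw [hx, smul_zero]

theorem isTangentField_zero : IsTangentField (n := n) (m := m) (c := c) V 0 :=
  ⟨analyticAt_const, TangentAlong.zero, Eventually.of_forall fun _ => rfl⟩

theorem IsTangentField.eventually_uPart_fderiv (h : IsTangentField V Y) :
    ∀ᶠ x in 𝓝 0, ∀ v, uPart (fderiv ℂ Y x v ∘ Sum.inl) = 0 := by
  filter_upwards [h.uPart_eq.eventually_nhds, h.analyticAt.eventually_analyticAt]
    with x hx hYx v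
  ext i
  have hcoord : (fun x => Y x (Sum.inl (Sum.inr (Sum.inr i)))) =ᶠ[𝓝 x] fun _ => 0 :=
    hx.mono fun y hy => congrFun hy i
  exact (DFunLike.congr_fun (fderiv_apply hYx.differentiableAt _) v).symm.trans
    (by rw [hcoord.fderiv_eq, fderiv_fun_const]; rfl)

theorem IsTangentField.lieBracket (hV : IsNashMap V) (h : IsTangentField V Y)
    (h' : IsTangentField V Y') : IsTangentField V (VectorField.lieBracket ℂ Y Y') where
  analyticAt := analyticAt_lieBracket h.analyticAt h'.analyticAt
  tangentAlong := TangentAlong.lieBracket hV.analyticAt (by rw [hV.map_zero]; exact h.analyticAt)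
    (by rw [hV.map_zero]; exact h'.analyticAt) h.tangentAlong h'.tangentAlong
  uPart_eq := by
    filter_upwards [h.eventually_uPart_fderiv, h'.eventually_uPart_fderiv] with x hx hx'
    calc uPart (VectorField.lieBracket ℂ Y Y' x ∘ Sum.inl)
        = uPart (fderiv ℂ Y' x (Y x) ∘ Sum.inl) - uPart (fderiv ℂ Y x (Y' x) ∘ Sum.inl) := rfl
      _ = 0 := by rw [hx, hx', sub_zero]

variable (M V G) in
/-- On `M` near `0`, the map `G` is a combination, with real-analytic coefficients, of the
restrictions of fields that are generically tangent to the image of `V`. -/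
def IsCombination : Prop :=
  ∃ (κ : Type) (_ : Fintype κ) (a : κ → (Idx n m c → ℂ) → ℂ)
    (Y : κ → (Idx n m c ⊕ Idx n m c → ℂ) → (Idx n m c ⊕ Idx n m c → ℂ)),
    (∀ i, AnalyticAt ℝ (a i) 0) ∧ (∀ i, IsTangentField V (Y i)) ∧
      ∀ᶠ Z in 𝓝[M] 0, G Z = ∑ i, a i Z • Y i (conjDiag _ Z)

theorem IsCombination.add (h : IsCombination M V G) (h' : IsCombination M V G') :
    IsCombination M V (G + G') := by
  obtain ⟨κ, _, a, Y, ha, hY, h⟩ := h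
  obtain ⟨κ', _, a', Y', ha', hY', h'⟩ := h'
  refine ⟨κ ⊕ κ', inferInstance, Sum.elim a a', Sum.elim Y Y', Sum.rec ha ha', Sum.rec hY hY', ?_⟩
  filter_upwards [h, h'] with Z hZ hZ'
  rw [Pi.add_apply, hZ, hZ', Fintype.sum_sum_type]
  rfl

theorem IsCombination.smul (h : IsCombination M V G) {b : (Idx n m c → ℂ) → ℂ}
    (hb : AnalyticAt ℝ b 0) : IsCombination M V fun Z => b Z • G Z := by
  obtain ⟨κ, _, a, Y, ha, hY, h⟩ := h
  refine ⟨κ, inferInstance, fun i Z => b Z * a i Z, Y, fun i => hb.mul (ha i), hY, ?_⟩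
  filter_upwards [h] with Z hZ
  simp only [hZ, Finset.smul_sum, mul_smul]

theorem IsCombination.congr (h : IsCombination M V G) (hG : ∀ᶠ Z in 𝓝[M] 0, G' Z = G Z) :
    IsCombination M V G' := by
  obtain ⟨κ, _, a, Y, ha, hY, h⟩ := h
  refine ⟨κ, inferInstance, a, Y, ha, hY, ?_⟩
  filter_upwards [h, hG] with Z hZ hGZ
  rw [hGZ, hZ]

theorem IsTangentField.isCombination (hY : IsTangentField V Y) :
    IsCombination M V fun Z => Y (conjDiag _ Z) :=
  ⟨Unit, inferInstance, fun _ _ => 1, fun _ => Y, fun _ => analyticAt_const, fun _ => hY,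
    Eventually.of_forall fun Z => by simp⟩

theorem isCombination_sum {κ : Type} [Fintype κ]
    {G : κ → (Idx n m c → ℂ) → (Idx n m c ⊕ Idx n m c → ℂ)}
    (h : ∀ i, IsCombination M V (G i)) : IsCombination M V fun Z => ∑ i, G i Z := by
  simpa only [Finset.sum_fn] using Finset.sum_induction G (IsCombination M V)
    (fun _ _ => IsCombination.add) isTangentField_zero.isCombination fun i _ => h i

variable (M V X) in
/-- The properties shared by all elements `X` of the Lie algebra generated by the sections of the
complex tangent bundle of `M`, when the leaf fields and their reflections are generically tangent
to the image of `V`. -/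
structure IsCRField : Prop where
  analyticAt : AnalyticAt ℝ X 0
  fderiv_eq_zero : ∀ g : (Idx n m c → ℂ) → ℂ, AnalyticAt ℝ g 0 → (∀ᶠ Z in 𝓝[M] 0, g Z = 0) →
    ∀ᶠ Z in 𝓝[M] 0, fderiv ℝ g Z (X Z) = 0
  isCombination : IsCombination M V fun Z => conjDiag _ (X Z)

theorem IsCRField.fderiv_pi_eq_zero (h : IsCRField M V X) {ι : Type} [Fintype ι]
    {g : (Idx n m c → ℂ) → ι → ℂ} (hg : AnalyticAt ℝ g 0) (hg0 : ∀ᶠ Z in 𝓝[M] 0, g Z = 0) :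
    ∀ᶠ Z in 𝓝[M] 0, fderiv ℝ g Z (X Z) = 0 := by
  have hcoord (i) : ∀ᶠ Z in 𝓝[M] 0, fderiv ℝ (fun Z => g Z i) Z (X Z) = 0 :=
    h.fderiv_eq_zero _ (analyticAt_pi_iff.1 hg i) (hg0.mono fun Z hZ => congrFun hZ i)
  filter_upwards [eventually_all.2 hcoord, nhdsWithin_le_nhds hg.eventually_analyticAt]
    with Z hZ hgZ
  exact funext fun i =>
    (DFunLike.congr_fun (fderiv_apply hgZ.differentiableAt i) _).symm.trans (hZ i)

theorem IsCRField.add (h : IsCRField M V X) (h' : IsCRField M V X') : IsCRField M V (X + X') where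
  analyticAt := h.analyticAt.add h'.analyticAt
  fderiv_eq_zero g hg hg0 := by
    filter_upwards [h.fderiv_eq_zero g hg hg0, h'.fderiv_eq_zero g hg hg0] with Z hZ hZ'
    rw [Pi.add_apply, map_add, hZ, hZ', add_zero]
  isCombination := (h.isCombination.add h'.isCombination).congr
    (Eventually.of_forall fun _ => map_add _ _ _)

theorem IsCRField.smul (h : IsCRField M V X) (a : ℝ) : IsCRField M V (a • X) where
  analyticAt := analyticAt_const.smul h.analyticAt
  fderiv_eq_zero g hg hg0 := by
    filter_upwards [h.fderiv_eq_zero g hg hg0] with Z hZ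
    rw [Pi.smul_apply, map_smul, hZ, smul_zero]
  isCombination := (h.isCombination.smul (b := fun _ => (a : ℂ)) analyticAt_const).congr
    (Eventually.of_forall fun Z => by rw [Pi.smul_apply, map_smul, Complex.coe_smul])

theorem IsCRField.eventually_conjDiag_fderiv (h : IsCRField M V X) (h' : IsCRField M V X')
    {κ : Type} [Fintype κ] {a : κ → (Idx n m c → ℂ) → ℂ}
    {Y : κ → (Idx n m c ⊕ Idx n m c → ℂ) → (Idx n m c ⊕ Idx n m c → ℂ)}
    (ha : ∀ i, AnalyticAt ℝ (a i) 0) (hY : ∀ i, IsTangentField V (Y i))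
    (hX' : ∀ᶠ Z in 𝓝[M] 0, conjDiag _ (X' Z) = ∑ i, a i Z • Y i (conjDiag _ Z)) :
    ∀ᶠ Z in 𝓝[M] 0, conjDiag _ (fderiv ℝ X' Z (X Z)) =
      ∑ i, (a i Z • fderiv ℂ (Y i) (conjDiag _ Z) (conjDiag _ (X Z)) +
        fderiv ℝ (a i) Z (X Z) • Y i (conjDiag _ Z)) := by
  have hdiff : AnalyticAt ℝ
      (fun Z => conjDiag _ (X' Z) - ∑ i, a i Z • Y i (conjDiag _ Z)) 0 :=
    (((conjDiag _).analyticAt _).fun_comp h'.analyticAt).fun_sub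
      (Finset.analyticAt_fun_sum _ fun i _ =>
        (ha i).fun_smul (analyticAt_comp_conjDiag (hY i).analyticAt))
  filter_upwards [h.fderiv_pi_eq_zero hdiff (hX'.mono fun Z hZ => sub_eq_zero.2 hZ),
    nhdsWithin_le_nhds h'.analyticAt.eventually_analyticAt,
    nhdsWithin_le_nhds (eventually_all.2 fun i => (ha i).eventually_analyticAt),
    nhdsWithin_le_nhds (tendsto_conjDiag.eventually
      (eventually_all.2 fun i => (hY i).analyticAt.eventually_analyticAt))]
    with Z hZ hX'Z haZ hYZ
  have hcomp : HasFDerivAt (fun Z => conjDiag _ (X' Z)) ((conjDiag _).comp (fderiv ℝ X' Z)) Z :=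
    (conjDiag _).hasFDerivAt.comp Z hX'Z.differentiableAt.hasFDerivAt
  rw [(hcomp.fun_sub (hasFDerivAt_sum_smul_comp_conjDiag
    (fun i => (haZ i).differentiableAt) fun i => (hYZ i).differentiableAt)).fderiv] at hZ
  simpa [sub_eq_zero] using hZ

theorem isCombination_lieBracket (hV : IsNashMap V) (h : IsCRField M V X)
    (h' : IsCRField M V X') :
    IsCombination M V fun Z => conjDiag _ (VectorField.lieBracket ℝ X X' Z) := by
  obtain ⟨κ, _, a, Y, ha, hY, hX⟩ := h.isCombination
  obtain ⟨κ', _, a', Y', ha', hY', hX'⟩ := h'.isCombination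
  have hcoeff' : IsCombination M V fun Z =>
      ∑ i, fderiv ℝ (a' i) Z (X Z) • Y' i (conjDiag _ Z) :=
    isCombination_sum fun i => (hY' i).isCombination.smul
      (analyticAt_clm_apply (ha' i).fderiv h.analyticAt)
  have hcoeff : IsCombination M V fun Z =>
      ∑ i, (-fderiv ℝ (a i) Z (X' Z)) • Y i (conjDiag _ Z) :=
    isCombination_sum fun i => (hY i).isCombination.smul
      (analyticAt_clm_apply (ha i).fderiv h'.analyticAt).neg
  have hbracket : IsCombination M V fun Z => ∑ i, ∑ j, (a' i Z * a j Z) •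
      VectorField.lieBracket ℂ (Y j) (Y' i) (conjDiag _ Z) :=
    isCombination_sum fun i => isCombination_sum fun j =>
      ((hY j).lieBracket hV (hY' i)).isCombination.smul ((ha' i).mul (ha j))
  refine ((hcoeff'.add hcoeff).add hbracket).congr ?_
  filter_upwards [h.eventually_conjDiag_fderiv h' ha' hY' hX',
    h'.eventually_conjDiag_fderiv h ha hY hX, hX, hX'] with Z hDX' hDX hXZ hX'Z
  rw [VectorField.lieBracket_eq, map_sub, hDX', hDX, hXZ, hX'Z]
  simp only [Pi.add_apply, VectorField.lieBracket_eq, map_sum, map_smul, smul_sub, smul_smul,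
    Finset.smul_sum, Finset.sum_sub_distrib, Finset.sum_add_distrib, neg_smul,
    Finset.sum_neg_distrib]
  rw [Finset.sum_comm (s := (Finset.univ : Finset κ))]
  simp only [mul_comm]
  abel

theorem IsCRField.lieBracket (hV : IsNashMap V) (h : IsCRField M V X) (h' : IsCRField M V X') :
    IsCRField M V (VectorField.lieBracket ℝ X X') where
  analyticAt := analyticAt_lieBracket h.analyticAt h'.analyticAt
  fderiv_eq_zero g hg hg0 := by
    filter_upwards [h.fderiv_eq_zero _ (analyticAt_clm_apply hg.fderiv h'.analyticAt)
        (h'.fderiv_eq_zero g hg hg0),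
      h'.fderiv_eq_zero _ (analyticAt_clm_apply hg.fderiv h.analyticAt)
        (h.fderiv_eq_zero g hg hg0),
      nhdsWithin_le_nhds hg.eventually_analyticAt,
      nhdsWithin_le_nhds h.analyticAt.eventually_analyticAt,
      nhdsWithin_le_nhds h'.analyticAt.eventually_analyticAt] with Z hXX' hX'X hgZ hXZ hX'Z
    rw [VectorField.fderiv_apply_lieBracket (n := ⊤) hgZ.contDiffAt (by simp)
      hX'Z.differentiableAt hXZ.differentiableAt, hXX', hX'X, sub_zero]
  isCombination := isCombination_lieBracket hV h h'

end CRFields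

/-! ### The orbit of the origin -/

theorem fderiv_eq_zero_of_mem_tangentConeAt {E F : Type*} [NormedAddCommGroup E] [NormedSpace ℝ E]
    [NormedAddCommGroup F] [NormedSpace ℝ F] {M : Set E} {g : E → F} {p v : E}
    (hg : DifferentiableAt ℝ g p) (h0 : ∀ᶠ q in 𝓝[M] p, g q = 0) (hp : p ∈ M)
    (hv : v ∈ tangentConeAt ℝ M p) : fderiv ℝ g p v = 0 :=
  hg.hasFDerivAt.hasFDerivWithinAt.unique_on
    ((hasFDerivWithinAt_const (0 : F) p M).congr_of_eventuallyEq h0 (h0.self_of_nhdsWithin hp)) hv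

section ComplexTangent

variable {ι : Type} [Finite ι] {g : (ι ⊕ ι → ℂ) → ℂ} {Z : ι → ℂ}

theorem fderiv_comp_conjDiag (hg : DifferentiableAt ℂ g (conjDiag ι Z)) (v : ι → ℂ) :
    fderiv ℝ (fun Z => g (conjDiag ι Z)) Z v = fderiv ℂ g (conjDiag ι Z) (conjDiag ι v) :=
  have := Fintype.ofFinite ι
  DFunLike.congr_fun
    ((hg.hasFDerivAt.restrictScalars ℝ).comp Z (conjDiag ι).hasFDerivAt).fderiv v

theorem fderiv_eq_zero_of_mem_complexTangent {M : Set (ι → ℂ)} {v : ι → ℂ}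
    (hg : DifferentiableAt ℂ g (conjDiag ι Z)) (h0 : ∀ᶠ Z in 𝓝[M] Z, g (conjDiag ι Z) = 0)
    (hZ : Z ∈ M) (hv : v ∈ complexTangent M Z) :
    fderiv ℂ g (conjDiag ι Z) (Sum.elim v 0) = 0 := by
  have := Fintype.ofFinite ι
  have hreal {v} (hv : v ∈ tangentConeAt ℝ M Z) :
      fderiv ℂ g (conjDiag ι Z) (conjDiag ι v) = 0 := by
    rw [← fderiv_comp_conjDiag hg]
    exact fderiv_eq_zero_of_mem_tangentConeAt ((hg.restrictScalars ℝ).fun_comp' _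
      (conjDiag ι).differentiableAt) h0 hZ hv
  have hsplit : (2 : ℂ) • (Sum.elim v 0 : ι ⊕ ι → ℂ) =
      conjDiag ι v - Complex.I • conjDiag ι (Complex.I • v) := by
    ext (i | i) <;> simp [conjDiag, ← mul_assoc, two_mul]
  have h2 : (2 : ℂ) • fderiv ℂ g (conjDiag ι Z) (Sum.elim v 0) = 0 := by
    rw [← map_smul, hsplit, map_sub, map_smul, hreal hv.1, hreal hv.2, smul_zero, sub_zero]
  exact (smul_eq_zero.1 h2).resolve_left two_ne_zero

end ComplexTangent

section Orbits

variable {n m c : ℕ} {M : Set (Idx n m c → ℂ)} {Q : Fin m → (Fin n ⊕ Idx n m c → ℂ) → ℂ}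
  {T : Type} [Fintype T] {V : (T → ℂ) → (Idx n m c ⊕ Idx n m c → ℂ)}
  {X : (Idx n m c → ℂ) → (Idx n m c → ℂ)}

variable (n m c) in
/-- The linear map `leafCoords` as a continuous linear map. -/
def leafCoordsCLM : (Idx n m c ⊕ Idx n m c → ℂ) →L[ℂ] (Fin n ⊕ Idx n m c → ℂ) :=
  LinearMap.toContinuousLinearMap
    { toFun := leafCoords
      map_add' := fun x y => by ext (i | i) <;> rfl
      map_smul' := fun a x => by ext (i | i) <;> rfl }

/-- The holomorphic function `(Z, ζ) ↦ w_l - Q_l(z, ζ)`, whose restriction to `ζ = Z̄` is one of the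
defining functions of `M`. -/
def wDefect (Q : Fin m → (Fin n ⊕ Idx n m c → ℂ) → ℂ) (l : Fin m)
    (x : Idx n m c ⊕ Idx n m c → ℂ) : ℂ :=
  wPart (x ∘ Sum.inl) l - Q l (leafCoords x)

theorem hasFDerivAt_wPart_inl (l : Fin m) (x : Idx n m c ⊕ Idx n m c → ℂ) :
    HasFDerivAt (fun x : Idx n m c ⊕ Idx n m c → ℂ => wPart (x ∘ Sum.inl) l)
      (ContinuousLinearMap.proj (R := ℂ) (φ := fun _ => ℂ) (Sum.inl (Sum.inr (Sum.inl l)))) x :=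
  hasFDerivAt_apply _ x

theorem analyticAt_wDefect (hQ : IsNormalForm M Q) (l : Fin m) : AnalyticAt ℂ (wDefect Q l) 0 :=
  (analyticAt_pi_iff.1 (isNashMap_reindex id).analyticAt (Sum.inl (Sum.inr (Sum.inl l)))).sub
    ((hQ.algebraic l).1.fun_comp_of_eq isNashMap_leafCoords.analyticAt
      isNashMap_leafCoords.map_zero)

theorem fderiv_wDefect {l : Fin m} {x : Idx n m c ⊕ Idx n m c → ℂ}
    (h : DifferentiableAt ℂ (Q l) (leafCoords x)) (v : Idx n m c ⊕ Idx n m c → ℂ) :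
    fderiv ℂ (wDefect Q l) x v =
      wPart (v ∘ Sum.inl) l - fderiv ℂ (Q l) (leafCoords x) (leafCoords v) :=
  DFunLike.congr_fun ((hasFDerivAt_wPart_inl l x).fun_sub
    (h.hasFDerivAt.comp x (leafCoordsCLM n m c).hasFDerivAt)).fderiv v

theorem eventually_wDefect_eq_zero (hQ : IsNormalForm M Q) (l : Fin m) :
    ∀ᶠ Z in 𝓝[M] 0, wDefect Q l (conjDiag _ Z) = 0 := by
  filter_upwards [nhdsWithin_le_nhds hQ.mem_iff, self_mem_nhdsWithin] with Z hZ hZM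
  exact sub_eq_zero.2 ((hZ.1 hZM).1 l)

theorem eventually_wPart_complexTangent_eq (hQ : IsNormalForm M Q) :
    ∀ᶠ Z in 𝓝[M] 0, ∀ v ∈ complexTangent M Z, ∀ l, wPart v l = ∑ k, zPart v k *
      fderiv ℂ (Q l) (leafCoords (conjDiag _ Z)) (Pi.single (Sum.inl k) 1) := by
  filter_upwards [self_mem_nhdsWithin,
    eventually_all.2 fun l => eventually_eventually_nhdsWithin.2 (eventually_wDefect_eq_zero hQ l),
    nhdsWithin_le_nhds (tendsto_conjDiag.eventually
      (eventually_all.2 fun l => (analyticAt_wDefect hQ l).eventually_analyticAt)),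
    nhdsWithin_le_nhds ((isNashMap_leafCoords.tendsto.comp tendsto_conjDiag).eventually
      (eventually_all.2 fun l => (hQ.algebraic l).1.eventually_analyticAt))]
    with Z hZ h0 hdefect hQZ v hv l
  have hzero := fderiv_eq_zero_of_mem_complexTangent (hdefect l).differentiableAt (h0 l) hZ hv
  rw [fderiv_wDefect (hQZ l).differentiableAt, sub_eq_zero, Sum.elim_comp_inl] at hzero
  rw [hzero, continuousLinearMap_apply_eq_sum_single, Fintype.sum_sum_type]
  simp [leafCoords, zPart]

theorem eventually_uPart_complexTangent_eq (hQ : IsNormalForm M Q) :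
    ∀ᶠ Z in 𝓝[M] 0, ∀ v ∈ complexTangent M Z, uPart v = 0 := by
  have hu : ∀ᶠ Z in 𝓝[M] 0, uPart Z = star (uPart Z) := by
    filter_upwards [nhdsWithin_le_nhds hQ.mem_iff, self_mem_nhdsWithin] with Z hZ hZM
    exact (hZ.1 hZM).2
  filter_upwards [self_mem_nhdsWithin, eventually_eventually_nhdsWithin.2 hu] with Z hZ hu v hv
  ext i
  let D : (Idx n m c ⊕ Idx n m c → ℂ) →L[ℂ] ℂ :=
    ContinuousLinearMap.proj (R := ℂ) (φ := fun _ => ℂ) (Sum.inl (Sum.inr (Sum.inr i))) -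
      ContinuousLinearMap.proj (R := ℂ) (φ := fun _ => ℂ) (Sum.inr (Sum.inr (Sum.inr i)))
  have hzero := fderiv_eq_zero_of_mem_complexTangent D.differentiableAt
    (hu.mono fun Z hZ => sub_eq_zero.2 (congrFun hZ i)) hZ hv
  rw [D.fderiv] at hzero
  exact (sub_zero _).symm.trans hzero

theorem eventually_sumElim_complexTangent_eq (hQ : IsNormalForm M Q) :
    ∀ᶠ Z in 𝓝[M] 0, ∀ v ∈ complexTangent M Z,
      Sum.elim v 0 = ∑ k, zPart v k • leafField Q k (conjDiag _ Z) := by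
  filter_upwards [eventually_wPart_complexTangent_eq hQ, eventually_uPart_complexTangent_eq hQ,
    nhdsWithin_le_nhds (tendsto_conjDiag.eventually (eventually_leafField_eq hQ))]
    with Z hw hu hleaf v hv
  ext ((i | i | i) | i) <;> simp only [hleaf, Finset.sum_apply, Pi.smul_apply, Sum.elim_inl,
    Sum.elim_inr, pt, smul_eq_mul]
  · simp [zPart, Pi.single_apply]
  · exact hw v hv i
  · exact (congrFun (hu v hv) i).trans (by simp)
  · simp

theorem isTangentField_leafField (hQ : IsNormalForm M Q) {k : Fin n}
    (h : TangentAlong V fun t => leafField Q k (V t)) : IsTangentField V (leafField Q k) where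
  analyticAt := analyticAt_leafField hQ k
  tangentAlong := h
  uPart_eq := (eventually_leafField_eq hQ).mono fun x hx => by rw [hx k]; rfl

theorem isTangentField_reflect_leafField (hQ : IsNormalForm M Q) {k : Fin n}
    (h : TangentAlong V fun t => reflect (leafField Q k (reflect (V t)))) :
    IsTangentField V fun x => reflect (leafField Q k (reflect x)) where
  analyticAt := analyticAt_reflect_comp_reflect (analyticAt_leafField hQ k)
  tangentAlong := h
  uPart_eq := (tendsto_reflect.eventually (eventually_leafField_eq hQ)).mono fun x hx => by
    rw [hx k]
    exact star_zero _

theorem reflect_sum_smul {ι κ : Type} [Fintype κ] (a : κ → ℂ) (y : κ → ι ⊕ ι → ℂ) :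
    reflect (∑ k, a k • y k) = ∑ k, star (a k) • reflect (y k) := by
  simp only [← reflect_smul]
  exact map_sum (AddMonoidHom.mk' reflect reflect_add) _ _

theorem conjDiag_eq_add_reflect {ι : Type} (v : ι → ℂ) :
    conjDiag ι v = Sum.elim v 0 + reflect (Sum.elim v 0) := by
  ext (i | i) <;> simp [conjDiag, reflect]

theorem isCRField_of_section (hQ : IsNormalForm M Q)
    (hleaf : ∀ k, TangentAlong V fun t => leafField Q k (V t))
    (hleaf' : ∀ k, TangentAlong V fun t => reflect (leafField Q k (reflect (V t))))
    (hX : AnalyticAt ℝ X 0) (hXM : ∀ᶠ Z in 𝓝[M] 0, X Z ∈ complexTangent M Z) :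
    IsCRField M V X where
  analyticAt := hX
  fderiv_eq_zero g hg hg0 := by
    filter_upwards [hXM, eventually_eventually_nhdsWithin.2 hg0, self_mem_nhdsWithin,
      nhdsWithin_le_nhds hg.eventually_analyticAt] with Z hXZ hg0 hZ hgZ
    exact fderiv_eq_zero_of_mem_tangentConeAt hgZ.differentiableAt hg0 hZ hXZ.1
  isCombination := by
    have hz (k : Fin n) : AnalyticAt ℝ (fun Z => zPart (X Z) k) 0 := analyticAt_pi_iff.1 hX _
    have hz' (k : Fin n) : AnalyticAt ℝ (fun Z => star (zPart (X Z) k)) 0 :=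
      ((Complex.conjCLE : ℂ →L[ℝ] ℂ).analyticAt _).comp (hz k)
    have hcomb := (isCombination_sum (M := M) fun k =>
      (isTangentField_leafField hQ (hleaf k)).isCombination.smul (hz k)).add
      (isCombination_sum fun k =>
        (isTangentField_reflect_leafField hQ (hleaf' k)).isCombination.smul (hz' k))
    refine hcomb.congr ?_
    filter_upwards [hXM, eventually_sumElim_complexTangent_eq hQ] with Z hXZ hZ
    rw [conjDiag_eq_add_reflect, hZ _ hXZ, reflect_sum_smul]
    simp only [Pi.add_apply, reflect_conjDiag]

theorem isCRField_of_inCRLieAlgebra (hQ : IsNormalForm M Q) (hV : IsNashMap V)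
    (hleaf : ∀ k, TangentAlong V fun t => leafField Q k (V t))
    (hleaf' : ∀ k, TangentAlong V fun t => reflect (leafField Q k (reflect (V t))))
    (hX : InCRLieAlgebra M 0 X) : IsCRField M V X := by
  induction hX with
  | section_mem X hX hXM => exact isCRField_of_section hQ hleaf hleaf' hX hXM
  | add X Y _ _ hX hY => exact hX.add hY
  | smul a X _ hX => exact hX.smul a
  | bracket X Y _ _ hX hY => exact hX.lieBracket hV hY

variable (n m c) in
/-- The space `{(z, w, u) : Im w = 0, u = 0}`, which contains the tangent space at `0` of the
CR orbit of `0`. -/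
def orbitSpace : Submodule ℝ (Idx n m c → ℂ) where
  carrier := {v | (∀ l, (wPart v l).im = 0) ∧ uPart v = 0}
  add_mem' := fun {v w} hv hw => ⟨fun l => by
    calc (wPart (v + w) l).im = (wPart v l).im + (wPart w l).im := rfl
      _ = 0 := by rw [hv.1, hw.1, add_zero], by
    calc uPart (v + w) = uPart v + uPart w := rfl
      _ = 0 := by rw [hv.2, hw.2, add_zero]⟩
  zero_mem' := ⟨fun _ => rfl, rfl⟩
  smul_mem' := fun a v hv => ⟨fun l => by
    calc (wPart (a • v) l).im = a * (wPart v l).im := Complex.smul_im a _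
      _ = 0 := by rw [hv.1, mul_zero], by
    calc uPart (a • v) = a • uPart v := rfl
      _ = 0 := by rw [hv.2, smul_zero]⟩

theorem finrank_orbitSpace_le : Module.finrank ℝ (orbitSpace n m c) ≤ 2 * n + m := by
  let L : (Idx n m c → ℂ) →ₗ[ℝ] (Fin n → ℂ) × (Fin m → ℝ) :=
    (LinearMap.pi fun i => LinearMap.proj (Sum.inl i)).prod
      (LinearMap.pi fun l => Complex.reLm.comp (LinearMap.proj (Sum.inr (Sum.inl l))))
  have hL : Function.Injective (L.comp (orbitSpace n m c).subtype) := by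
    rw [injective_iff_map_eq_zero]
    rintro ⟨v, hw, hu⟩ hv
    refine Subtype.ext (funext fun i => ?_)
    rcases i with i | i | i
    · exact congrFun (congrArg Prod.fst hv) i
    · exact Complex.ext (congrFun (congrArg Prod.snd hv) i) (hw i)
    · exact congrFun hu i
  refine (LinearMap.finrank_le_finrank_of_injective hL).trans (le_of_eq ?_)
  rw [Module.finrank_prod, Module.finrank_pi_fintype]
  simp [Complex.finrank_real_complex, mul_comm]

theorem fderiv_zero_apply (hQ : IsNormalForm M Q) (l : Fin m) (a : Fin n → ℂ)
    (b : Idx n m c → ℂ) : fderiv ℂ (Q l) 0 (Sum.elim a b) = wPart b l := by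
  have hline {v : Fin n ⊕ Idx n m c → ℂ} {x : Idx n m c → ℂ}
      (h : ∀ᶠ s : ℂ in 𝓝 0, Q l (s • v) = wPart (s • x) l) :
      fderiv ℂ (Q l) 0 v = wPart x l := by
    rw [← (hQ.algebraic l).1.differentiableAt.lineDeriv_eq_fderiv, lineDeriv]
    have hderiv : HasDerivAt (fun s : ℂ => wPart (s • x) l) (wPart x l) 0 := by
      simpa [wPart] using (hasDerivAt_id (0 : ℂ)).mul_const (wPart x l)
    simp only [zero_add]
    exact (hderiv.congr_of_eventuallyEq h).deriv
  have htendsto (x : Idx n m c → ℂ) : Tendsto (fun s : ℂ => s • x) (𝓝 0) (𝓝 0) :=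
    (continuous_id.smul continuous_const).tendsto' 0 0 (zero_smul ℂ x)
  have hleft : fderiv ℂ (Q l) 0 (Sum.elim a 0) = 0 := by
    refine hline (x := pt a 0 0) ?_
    filter_upwards [(htendsto (pt a 0 0)).eventually (hQ.normal_left l)] with s hs
    convert hs using 2
    ext (i | i | i | i) <;> simp [pt, zPart, wPart, uPart]
  have hright : fderiv ℂ (Q l) 0 (Sum.elim 0 b) = wPart b l := by
    refine hline ?_
    filter_upwards [(htendsto b).eventually (hQ.normal_right l)] with s hs
    convert hs using 2
    ext (i | i) <;> simp
  have hsplit : (Sum.elim a b : Fin n ⊕ Idx n m c → ℂ) =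
      Sum.elim a 0 + (Sum.elim 0 b : Fin n ⊕ Idx n m c → ℂ) := by
    ext (i | i) <;> simp
  rw [hsplit, map_add, hleft, hright, zero_add]

theorem leafCoords_zero : leafCoords (0 : Idx n m c ⊕ Idx n m c → ℂ) = 0 :=
  isNashMap_leafCoords.map_zero

theorem IsCRField.apply_zero_mem (hQ : IsNormalForm M Q) (h0 : 0 ∈ M) (hX : IsCRField M V X) :
    X 0 ∈ orbitSpace n m c := by
  refine ⟨fun l => ?_, ?_⟩
  · have hdefect := (hX.fderiv_eq_zero _ (analyticAt_comp_conjDiag (analyticAt_wDefect hQ l))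
      (eventually_wDefect_eq_zero hQ l)).self_of_nhdsWithin h0
    rw [fderiv_comp_conjDiag (by rw [map_zero]; exact (analyticAt_wDefect hQ l).differentiableAt),
      map_zero, fderiv_wDefect (by rw [leafCoords_zero]; exact (hQ.algebraic l).1.differentiableAt),
      leafCoords_zero, leafCoords, fderiv_zero_apply hQ, sub_eq_zero] at hdefect
    exact Complex.conj_eq_iff_im.1 hdefect.symm
  · obtain ⟨κ, _, a, Y, -, hY, h⟩ := hX.isCombination
    ext i
    have hi := congrFun (h.self_of_nhdsWithin h0) (Sum.inl (Sum.inr (Sum.inr i)))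
    rw [map_zero, Finset.sum_apply] at hi
    refine hi.trans (Finset.sum_eq_zero fun k _ => ?_)
    exact mul_eq_zero_of_right _ (congrFun (hY k).uPart_eq.self_of_nhds i)

theorem IsCRField.exists_isTangentField (h0 : 0 ∈ M) (hX : IsCRField M V X) :
    ∃ Y, IsTangentField V Y ∧ Y 0 = conjDiag _ (X 0) := by
  obtain ⟨κ, _, a, Y, -, hY, h⟩ := hX.isCombination
  refine ⟨∑ i, a i 0 • Y i, Finset.sum_induction _ (IsTangentField V) (fun _ _ => .add)
    isTangentField_zero fun i _ => (hY i).const_smul _, ?_⟩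
  refine Eq.trans ?_ (h.self_of_nhdsWithin h0).symm
  rw [map_zero, Finset.sum_apply]
  rfl

theorem exists_isTangentField_of_mem_orbitSpace (hQ : IsNormalForm M Q) (h0 : 0 ∈ M)
    (hdim : orbitDim M 0 = 2 * n + m) (hV : IsNashMap V)
    (hleaf : ∀ k, TangentAlong V fun t => leafField Q k (V t))
    (hleaf' : ∀ k, TangentAlong V fun t => reflect (leafField Q k (reflect (V t))))
    {v : Idx n m c → ℂ} (hv : v ∈ orbitSpace n m c) :
    ∃ Y, IsTangentField V Y ∧ Y 0 = conjDiag _ v := by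
  have hle : orbitTangent M 0 ≤ orbitSpace n m c := by
    refine Submodule.span_le.2 ?_
    rintro _ ⟨X, hX, rfl⟩
    exact (isCRField_of_inCRLieAlgebra hQ hV hleaf hleaf' hX).apply_zero_mem hQ h0
  rw [← Submodule.eq_of_le_of_finrank_le hle (finrank_orbitSpace_le.trans hdim.ge)] at hv
  induction hv using Submodule.span_induction with
  | mem _ hv =>
    obtain ⟨X, hX, rfl⟩ := hv
    exact (isCRField_of_inCRLieAlgebra hQ hV hleaf hleaf' hX).exists_isTangentField h0
  | zero => exact ⟨0, isTangentField_zero, (map_zero _).symm⟩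
  | add v w _ _ hv hw =>
    obtain ⟨⟨Y, hY, hY0⟩, Y', hY', hY'0⟩ := hv, hw
    exact ⟨_, hY.add hY', by rw [Pi.add_apply, hY0, hY'0, map_add]⟩
  | smul a v _ hv =>
    obtain ⟨Y, hY, hY0⟩ := hv
    exact ⟨_, hY.const_smul (a : ℂ), by rw [Pi.smul_apply, hY0, map_smul, Complex.coe_smul]⟩

end Orbits

/-! ### Generic submersivity of chains of maximal rank -/

section FrequentlySurjective

variable {E F : Type*} [NormedAddCommGroup E] [NormedSpace ℂ E] [NormedAddCommGroup F]
  [NormedSpace ℂ F] {V : E → F}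

theorem TangentAlong.clm_comp {G : Type*} [NormedAddCommGroup G] [NormedSpace ℂ G] [CompleteSpace F]
    {y : E → F} (hV : AnalyticAt ℂ V 0) (h : TangentAlong V y) (L : F →L[ℂ] G) :
    TangentAlong (fun t => L (V t)) fun t => L (y t) := by
  obtain ⟨b, a, hb, ha, hb0, h⟩ := h
  refine ⟨b, a, hb, ha, hb0, ?_⟩
  filter_upwards [h, hV.eventually_analyticAt] with t ht hVt
  have hcomp : HasFDerivAt (fun t => L (V t)) (L.comp (fderiv ℂ V t)) t :=
    L.hasFDerivAt.comp t hVt.differentiableAt.hasFDerivAt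
  rw [hcomp.fderiv, ← map_smul, ht, ContinuousLinearMap.comp_apply]

theorem tangentAlong_fderiv_apply (V : E → F) (v : E) : TangentAlong V fun t => fderiv ℂ V t v :=
  ⟨fun _ => 1, fun _ => v, analyticAt_const, analyticAt_const,
    fun h => one_ne_zero h.self_of_nhds, Eventually.of_forall fun _ => one_smul ℂ _⟩

theorem not_eventuallyEq_zero_prod {κ : Type*} (s : Finset κ) {b : κ → E → ℂ}
    (hb : ∀ k, AnalyticAt ℂ (b k) 0) (h : ∀ k, ¬ b k =ᶠ[𝓝 0] 0) :
    ¬ (fun t => ∏ k ∈ s, b k t) =ᶠ[𝓝 0] 0 := by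
  classical
  induction s using Finset.induction_on with
  | empty => exact fun h => one_ne_zero h.self_of_nhds
  | insert k s hk ih =>
    simp only [Finset.prod_insert hk]
    exact not_eventuallyEq_zero_mul (hb k) (Finset.analyticAt_fun_prod _ fun k _ => hb k) (h k) ih

theorem frequently_forall_mem_range {κ : Type*} [Finite κ] {y : κ → E → F}
    (h : ∀ k, TangentAlong V (y k)) : ∃ᶠ t in 𝓝 0, ∀ k, y k t ∈ (fderiv ℂ V t).range := by
  have := Fintype.ofFinite κ
  choose b a hb _ hb0 hba using h
  have hprod : ∃ᶠ t in 𝓝 0, ∏ k, b k t ≠ 0 := fun h =>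
    not_eventuallyEq_zero_prod Finset.univ hb hb0 (h.mono fun t ht => not_not.1 ht)
  refine (hprod.and_eventually (eventually_all.2 hba)).mono fun t ⟨hbt, hbat⟩ k => ?_
  refine ⟨(b k t)⁻¹ • a k t, ?_⟩
  have hbk : b k t ≠ 0 := Finset.prod_ne_zero_iff.1 hbt k (Finset.mem_univ k)
  rw [map_smul]
  exact (inv_smul_eq_iff₀ hbk).2 (hbat k).symm

theorem frequently_surjective_fderiv [FiniteDimensional ℂ F] {κ : Type*} [Fintype κ]
    {y : κ → E → F} (hy : ∀ k, ContinuousAt (y k) 0) (h : ∀ k, TangentAlong V (y k))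
    (hli : LinearIndependent ℂ fun k => y k 0) (hcard : Fintype.card κ = Module.finrank ℂ F) :
    ∃ᶠ t in 𝓝 0, Function.Surjective (fderiv ℂ V t) := by
  refine ((frequently_forall_mem_range h).and_eventually
    ((continuousAt_pi.2 hy).eventually hli.eventually)).mono fun t ⟨hrange, hlit⟩ => ?_
  rw [← ContinuousLinearMap.coe_coe, ← LinearMap.range_eq_top, eq_top_iff,
    ← hlit.span_eq_top_of_card_eq_finrank' hcard, Submodule.span_le]
  rintro _ ⟨k, rfl⟩
  exact hrange k

end FrequentlySurjective

section Chains

variable {n m c N' : ℕ} {M : Set (Idx n m c → ℂ)} {Q : Fin m → (Fin n ⊕ Idx n m c → ℂ) → ℂ}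
  {f : Fin N' → (Idx n m c → ℂ) → ℂ} {T : Type} [Fintype T]
  {V : (T → ℂ) → (Idx n m c ⊕ Idx n m c → ℂ)} {j : Fin c → T}

/-- The coordinates `z` and `w` as a subset of the coordinates `(z, w, u)`. -/
def zwIdx : Fin n ⊕ Fin m → Idx n m c := Sum.map id Sum.inl

theorem single_zwIdx_mem_orbitSpace (i : Fin n ⊕ Fin m) :
    Pi.single (zwIdx i) 1 ∈ orbitSpace n m c := by
  rcases i with i | i
  · exact ⟨fun l => by simp [wPart, zwIdx], funext fun k => by simp [uPart, zwIdx]⟩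
  · exact ⟨fun l => by by_cases h : l = i <;> simp [wPart, zwIdx, Pi.single_apply, h],
      funext fun k => by simp [uPart, zwIdx]⟩

theorem linearIndependent_sumElim_single_zwIdx {e : Fin c → Idx n m c → ℂ}
    (he : ∀ k, uPart (e k) = Pi.single k 1) :
    LinearIndependent ℂ (Sum.elim (fun i : Fin n ⊕ Fin m => Pi.single (zwIdx i) 1) e) := by
  rw [Fintype.linearIndependent_iff]
  intro a ha
  have hcoord (i : Idx n m c) : ∑ k, a (Sum.inl k) * (Pi.single (zwIdx k) 1 : Idx n m c → ℂ) i +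
      ∑ k, a (Sum.inr k) * e k i = 0 := by
    simpa [Fintype.sum_sum_type] using congrFun ha i
  have hu (k) : a (Sum.inr k) = 0 := by
    have he' (l) : e l (Sum.inr (Sum.inr k)) = (Pi.single l 1 : Fin c → ℂ) k := congrFun (he l) k
    simpa [he', zwIdx, Pi.single_apply] using hcoord (Sum.inr (Sum.inr k))
  rintro ((i | i) | i)
  · simpa [hu, zwIdx, Pi.single_apply] using hcoord (Sum.inl i)
  · simpa [hu, zwIdx, Pi.single_apply] using hcoord (Sum.inr (Sum.inl i))
  · exact hu i

theorem IsChain.uPart_fderiv_single [DecidableEq T] (hV : IsChain Q f V j) (k : Fin c) :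
    uPart (fderiv ℂ (fun t => V t ∘ Sum.inl) 0 (Pi.single (j k) 1)) = Pi.single k 1 := by
  have hdiff := (hV.isNashMap.reindex Sum.inl).analyticAt.differentiableAt
  ext i
  have hcoord : (fun t => V t (Sum.inl (Sum.inr (Sum.inr i)))) =ᶠ[𝓝 0] fun t => t (j i) :=
    hV.uPart_eq.mono fun t ht => congrFun ht i
  calc fderiv ℂ (fun t => V t ∘ Sum.inl) 0 (Pi.single (j k) 1) (Sum.inr (Sum.inr i))
      = fderiv ℂ (fun t => V t (Sum.inl (Sum.inr (Sum.inr i)))) 0 (Pi.single (j k) 1) :=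
        (DFunLike.congr_fun (fderiv_apply hdiff _) _).symm
    _ = (Pi.single (j k) 1 : T → ℂ) (j i) := by
        rw [hcoord.fderiv_eq]
        exact DFunLike.congr_fun (hasFDerivAt_apply (𝕜 := ℂ) (j i) (0 : T → ℂ)).fderiv _
    _ = (Pi.single k 1 : Fin c → ℂ) i := by
        simp only [Pi.single_apply, hV.injective.eq_iff]

theorem IsChain.frequently_surjective_fderiv (hQ : IsNormalForm M Q) (h0 : 0 ∈ M)
    (hdim : orbitDim M 0 = 2 * n + m) (hV : IsChain Q f V j)
    (hleaf : ∀ k, TangentAlong V fun t => leafField Q k (V t))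
    (hleaf' : ∀ k, TangentAlong V fun t => reflect (leafField Q k (reflect (V t)))) :
    ∃ᶠ t in 𝓝 0, Function.Surjective (fderiv ℂ (fun t => V t ∘ Sum.inl) t) := by
  classical
  choose Y hY hY0 using fun i => exists_isTangentField_of_mem_orbitSpace hQ h0 hdim hV.isNashMap
    hleaf hleaf' (single_zwIdx_mem_orbitSpace (n := n) (m := m) (c := c) i)
  let L : (Idx n m c ⊕ Idx n m c → ℂ) →L[ℂ] (Idx n m c → ℂ) :=
    ContinuousLinearMap.pi fun i => ContinuousLinearMap.proj (Sum.inl i)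
  have hVa := hV.isNashMap.analyticAt
  have hYV (i) : AnalyticAt ℂ (fun t => L (Y i (V t))) 0 :=
    (L.analyticAt _).comp ((hY i).analyticAt.fun_comp_of_eq hVa hV.isNashMap.map_zero)
  have hZ : AnalyticAt ℂ (fun t => V t ∘ Sum.inl) 0 := (hV.isNashMap.reindex Sum.inl).analyticAt
  let y : (Fin n ⊕ Fin m) ⊕ Fin c → (T → ℂ) → Idx n m c → ℂ :=
    Sum.elim (fun i t => L (Y i (V t)))
      fun k t => fderiv ℂ (fun t => V t ∘ Sum.inl) t (Pi.single (j k) 1)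
  have hy0 : (fun k => y k 0) = Sum.elim (fun i => Pi.single (zwIdx i) 1)
      fun k => fderiv ℂ (fun t => V t ∘ Sum.inl) 0 (Pi.single (j k) 1) := by
    ext (i | k) : 1
    · simp only [y, Sum.elim_inl, hV.isNashMap.map_zero, hY0]
      rfl
    · rfl
  refine KeyAlg.frequently_surjective_fderiv (y := y) ?_ ?_ ?_ ?_
  · exact Sum.rec (fun i => (hYV i).continuousAt)
      fun k => (analyticAt_clm_apply hZ.fderiv analyticAt_const).continuousAt
  · exact Sum.rec (fun i => (hY i).tangentAlong.clm_comp hVa L)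
      fun k => tangentAlong_fderiv_apply _ _
  · rw [hy0]
    exact linearIndependent_sumElim_single_zwIdx hV.uPart_fderiv_single
  · simp [add_assoc]

end Chains

/-! ### Descent along a generically submersive map -/

section TranscendenceDegree

variable {A B K κ T : Type*} [CommRing A] [CommRing B] [Field K]

theorem derivation_mem_sup (D : Derivation ℤ A A) {S S' : Subring A}
    (hS : ∀ x ∈ S, D x ∈ S ⊔ S') (hS' : ∀ x ∈ S', D x ∈ S ⊔ S') {x : A} (hx : x ∈ S ⊔ S') :
    D x ∈ S ⊔ S' := by
  have hsup : S ⊔ S' = Subring.closure (S ∪ S' : Set A) := by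
    rw [Subring.closure_union, Subring.closure_eq, Subring.closure_eq]
  rw [hsup] at hx hS hS' ⊢
  exact derivation_mem_closure D (fun y hy => hy.elim (hS y) (hS' y)) hx

variable [IsDomain A] [IsDomain B]

theorem mem_algClosure_of_map_injective {φ : A →+* B} (hφ : Function.Injective φ) {S : Subring A}
    {x : A} (hx : φ x ∈ algClosure (S.map φ)) : x ∈ algClosure S := by
  let g : S →+* S.map φ := φ.restrict S (S.map φ) fun y hy => ⟨y, hy, rfl⟩
  have hg : Function.Surjective g := by
    rintro ⟨_, y, hy, rfl⟩
    exact ⟨⟨y, hy⟩, rfl⟩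
  have hx' : IsAlgebraic (S.map φ) (φ x) := hx
  exact hx'.of_ringHom_of_comp_eq g φ hg hφ rfl

theorem mem_algClosure_adjoin_of_card_le [Algebra K A] [Fintype κ] [Fintype T] {x : κ → A}
    {y : T → A} (hx : AlgebraicIndependent K x)
    (hxy : ∀ k, x k ∈ algClosure (Algebra.adjoin K (Set.range y)).toSubring)
    (hcard : Fintype.card T ≤ Fintype.card κ) (j : T) :
    y j ∈ algClosure (Algebra.adjoin K (Set.range x)).toSubring := by
  let M := AlgebraicIndependent.matroid K A
  have hind : M.Indep (Set.range x) := AlgebraicIndependent.matroid_indep_iff.2 hx.to_subtype_range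
  have hsub : Set.range x ⊆ M.closure (Set.range y) := by
    rintro _ ⟨k, rfl⟩
    rw [AlgebraicIndependent.matroid_closure_eq]
    exact hxy k
  have hrank : M.eRk (M.closure (Set.range y)) ≤ M.eRk (Set.range x) := by
    rw [M.eRk_closure_eq, hind.eRk_eq_encard, ← Set.image_univ, ← Set.image_univ,
      hx.injective.encard_image]
    refine (M.eRk_le_encard _).trans ((Set.encard_image_le _ _).trans ?_)
    rw [Set.encard_univ, Set.encard_univ, ENat.card_eq_coe_fintype_card,
      ENat.card_eq_coe_fintype_card]
    exact_mod_cast hcard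
  have hclosure := (M.isRkFinite_of_finite
    (Set.finite_range x)).closure_eq_closure_of_subset_of_eRk_ge_eRk hsub hrank
  have hj : y j ∈ M.closure (Set.range x) := by
    rw [hclosure, M.closure_closure]
    exact M.subset_closure _ (Set.subset_univ _) ⟨j, rfl⟩
  rw [AlgebraicIndependent.matroid_closure_eq] at hj
  exact hj

theorem range_le_algClosure_range [Fintype κ] [Fintype T] {F : MvPolynomial κ K →+* A}
    {G : MvPolynomial T K →+* A} (hFG : F.comp MvPolynomial.C = G.comp MvPolynomial.C)
    (hF : Function.Injective F) (hrange : F.range ≤ algClosure G.range)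
    (hcard : Fintype.card T ≤ Fintype.card κ) : G.range ≤ algClosure F.range := by
  let _ : Algebra K A := (F.comp MvPolynomial.C).toAlgebra
  let x (k : κ) : A := F (MvPolynomial.X k)
  let y (j : T) : A := G (MvPolynomial.X j)
  have hx : (MvPolynomial.aeval x : MvPolynomial κ K →ₐ[K] A).toRingHom = F :=
    MvPolynomial.ringHom_ext (fun a => MvPolynomial.aeval_C x a) fun k => MvPolynomial.aeval_X x k
  have hy : (MvPolynomial.aeval y : MvPolynomial T K →ₐ[K] A).toRingHom = G :=
    MvPolynomial.ringHom_ext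
      (fun a => (MvPolynomial.aeval_C y a).trans (DFunLike.congr_fun hFG a))
      fun j => MvPolynomial.aeval_X y j
  have hadjoin_x : (Algebra.adjoin K (Set.range x)).toSubring = F.range := by
    rw [Algebra.adjoin_range_eq_range_aeval, ← hx]
    rfl
  have hadjoin_y : (Algebra.adjoin K (Set.range y)).toSubring = G.range := by
    rw [Algebra.adjoin_range_eq_range_aeval, ← hy]
    rfl
  have hind : AlgebraicIndependent K x := by
    rw [← hx] at hF
    exact hF
  have hmem (j : T) : y j ∈ algClosure (Algebra.adjoin K (Set.range x)).toSubring :=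
    mem_algClosure_adjoin_of_card_le hind
      (fun k => by rw [hadjoin_y]; exact hrange ⟨_, rfl⟩) hcard j
  have hle : Algebra.adjoin K (Set.range y) ≤ Subalgebra.restrictScalars K
      (Subalgebra.algebraicClosure (Algebra.adjoin K (Set.range x)) A) :=
    Algebra.adjoin_le (Set.range_subset_iff.2 hmem)
  rw [← hadjoin_x, ← hadjoin_y]
  exact hle

end TranscendenceDegree

section Descent

theorem fderiv_sumElim_apply {E : Type*} [NormedAddCommGroup E] [NormedSpace ℂ E] {ι κ : Type*}
    [Finite ι] [Finite κ] {v : E → ι → ℂ} {w : E → κ → ℂ} {t : E} (hv : DifferentiableAt ℂ v t)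
    (hw : DifferentiableAt ℂ w t) (x : E) :
    fderiv ℂ (fun t => (Sum.elim (v t) (w t) : ι ⊕ κ → ℂ)) t x =
      Sum.elim (fderiv ℂ v t x) (fderiv ℂ w t x) := by
  have := Fintype.ofFinite ι
  have := Fintype.ofFinite κ
  have hvw : DifferentiableAt ℂ (fun t => (Sum.elim (v t) (w t) : ι ⊕ κ → ℂ)) t :=
    differentiableAt_pi.2 (Sum.rec (differentiableAt_pi.1 hv) (differentiableAt_pi.1 hw))
  ext (i | i)
  · exact (DFunLike.congr_fun (fderiv_apply hvw (Sum.inl i)) x).symm.trans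
      (DFunLike.congr_fun (fderiv_apply hv i) x)
  · exact (DFunLike.congr_fun (fderiv_apply hvw (Sum.inr i)) x).symm.trans
      (DFunLike.congr_fun (fderiv_apply hw i) x)

theorem polyHom_injective (ι : Type) [Fintype ι] : Function.Injective (polyHom ι) := by
  rw [injective_iff_map_eq_zero]
  intro p hp
  rw [polyHom_apply, germOf_eq_zero_iff] at hp
  have heval := AnalyticOnNhd.eq_of_eventuallyEq (f := fun x : ι → ℂ => MvPolynomial.eval x p)
    (g := 0) (AnalyticOnNhd.eval_mvPolynomial p) (fun _ _ => analyticAt_const) hp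
  exact MvPolynomial.funext fun x => by simpa using congrFun heval x

variable {ι κ T : Type} [Fintype ι] [Fintype κ] [Fintype T] {v : (T → ℂ) → (ι → ℂ)}
  {w : (T → ℂ) → (κ → ℂ)}

theorem pullback_injective (hv : AnalyticAt ℂ v 0) (hv0 : v 0 = 0)
    (hsurj : ∃ᶠ t in 𝓝 0, Function.Surjective (fderiv ℂ v t)) :
    Function.Injective (pullback hv hv0) := by
  rw [injective_iff_map_eq_zero]
  intro φ hφ
  obtain ⟨g, hg, rfl⟩ := exists_eq_germOf φ
  rw [pullback_germOf, germOf_eq_zero_iff] at hφ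
  rw [germOf_eq_zero_iff]
  have htendsto : Tendsto v (𝓝 0) (𝓝 0) := by simpa only [hv0] using hv.continuousAt.tendsto
  refine eventuallyEq_zero_of_frequently hg (htendsto.frequently ((hsurj.and_eventually
    (hφ.eventually_nhds.and hv.eventually_analyticAt)).mono ?_))
  rintro t ⟨hsurjt, hφt, hvt⟩
  rw [← hvt.hasStrictFDerivAt.map_nhds_eq_of_surj (LinearMap.range_eq_top.2 hsurjt)]
  exact hφt

theorem exists_surjective_sumElim_comp_val {A : (T → ℂ) →ₗ[ℂ] (ι → ℂ)}
    (hA : Function.Surjective A) :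
    ∃ s : Set T, Fintype.card T = Fintype.card ι + Nat.card s ∧
      Function.Surjective fun x => (Sum.elim (A x) (x ∘ Subtype.val) : ι ⊕ s → ℂ) := by
  classical
  obtain ⟨κ, a, ha, hspan, hli⟩ := exists_linearIndependent' ℂ fun j => A (Pi.single j 1)
  have := Finite.of_injective a ha
  have := Fintype.ofFinite κ
  have htop : Submodule.span ℂ (Set.range fun j => A (Pi.single j 1)) = ⊤ := by
    have hmap := congrArg (Submodule.map A) (Pi.basisFun ℂ T).span_eq
    rw [Submodule.map_span, ← Set.range_comp, Submodule.map_top,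
      LinearMap.range_eq_top.2 hA] at hmap
    simpa [Function.comp_def] using hmap
  rw [htop] at hspan
  have hcard : Fintype.card κ = Fintype.card ι := by
    simpa using (Module.finrank_eq_card_basis (Module.Basis.mk hli hspan.ge)).symm
  refine ⟨(Set.range a)ᶜ, ?_, fun y => ?_⟩
  · have hcompl := Set.ncard_add_ncard_compl (Set.range a)
    rw [← Nat.card_coe_set_eq, ← Nat.card_coe_set_eq, Nat.card_range_of_injective ha,
      Nat.card_eq_fintype_card (α := κ), Nat.card_eq_fintype_card (α := T)] at hcompl
    omega
  · let x₀ : T → ℂ := fun j => if h : j ∈ (Set.range a)ᶜ then y (Sum.inr ⟨j, h⟩) else 0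
    have hy : y ∘ Sum.inl - A x₀ ∈
        Submodule.span ℂ (Set.range ((fun j => A (Pi.single j 1)) ∘ a)) := hspan ▸ trivial
    obtain ⟨b, hb⟩ := (Submodule.mem_span_range_iff_exists_fun ℂ).1 hy
    have hA' : A (x₀ + ∑ k, b k • Pi.single (a k) 1) = y ∘ Sum.inl := by
      simp only [map_add, map_sum, map_smul]
      exact add_eq_of_eq_sub' hb
    refine ⟨x₀ + ∑ k, b k • Pi.single (a k) 1, funext (Sum.rec (congrFun hA') fun j => ?_)⟩
    have hsingle (k : κ) : (Pi.single (a k) (1 : ℂ) : T → ℂ) j = 0 :=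
      Pi.single_eq_of_ne (fun h => j.2 ⟨k, h.symm⟩) _
    have hx₀ : x₀ j = y (Sum.inr j) := dif_pos j.2
    simp [hsingle, hx₀]

theorem exists_frequently_surjective_fderiv_sumElim (hv : AnalyticAt ℂ v 0)
    (hsurj : ∃ᶠ t in 𝓝 0, Function.Surjective (fderiv ℂ v t)) :
    ∃ s : Set T, Fintype.card T = Fintype.card ι + Nat.card s ∧ ∃ᶠ t in 𝓝 0,
      Function.Surjective
        (fderiv ℂ (fun t => (Sum.elim (v t) (t ∘ Subtype.val) : ι ⊕ s → ℂ)) t) := by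
  classical
  have hex : ∃ᶠ t in 𝓝 0, ∃ s : Set T, Fintype.card T = Fintype.card ι + Nat.card s ∧
      Function.Surjective
        (fderiv ℂ (fun t => (Sum.elim (v t) (t ∘ Subtype.val) : ι ⊕ s → ℂ)) t) := by
    refine (hsurj.and_eventually hv.eventually_analyticAt).mono fun t ⟨hsurjt, hvt⟩ => ?_
    obtain ⟨s, hcard, hs⟩ := exists_surjective_sumElim_comp_val
      (A := (fderiv ℂ v t : (T → ℂ) →ₗ[ℂ] (ι → ℂ))) hsurjt
    let R : (T → ℂ) →L[ℂ] (s → ℂ) := ContinuousLinearMap.pi fun j => ContinuousLinearMap.proj j.1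
    refine ⟨s, hcard, fun y => (hs y).imp fun x hx => ?_⟩
    exact (fderiv_sumElim_apply hvt.differentiableAt R.differentiableAt x).trans
      ((congrArg _ (DFunLike.congr_fun R.fderiv x)).trans hx)
  by_contra! hnot
  obtain ⟨t, ⟨s, hcard, hs⟩, ht⟩ := (hex.and_eventually (eventually_all.2 fun s =>
    eventually_imp_distrib_left.2 fun hcard => hnot s hcard)).exists
  exact ht s hcard hs

theorem IsNashMap.nashRing_le_algClosure_map (hv : IsNashMap v)
    (hinj : Function.Injective hv.pullback) (hcard : Fintype.card T ≤ Fintype.card ι) :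
    nashRing T ≤ algClosure ((polyHom ι).range.map hv.pullback) := by
  rw [RingHom.map_range]
  refine algClosure_le_algClosure (range_le_algClosure_range (RingHom.ext fun a => ?_)
    (hinj.comp (polyHom_injective ι)) ?_ hcard)
  · simp only [RingHom.comp_apply, polyHom_C, pullback_germOf]
  · rintro _ ⟨p, rfl⟩
    exact hv.pullback_mem_nashRing (polyHom_mem_nashRing p)

theorem partialDeriv_mem_range_sup_map [DecidableEq ι] [DecidableEq T] (e : ι → T)
    {S : Subring (HolGerm ι)} (hS : ∀ i, ∀ φ ∈ S, partialDeriv i φ ∈ S) (j : T) :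
    ∀ ψ ∈ (polyHom T).range ⊔ S.map (isNashMap_reindex e).pullback,
      partialDeriv j ψ ∈ (polyHom T).range ⊔ S.map (isNashMap_reindex e).pullback := by
  refine fun ψ => derivation_mem_sup (partialDeriv j) ?_ ?_
  · rintro _ ⟨p, rfl⟩
    exact SetLike.le_def.1 le_sup_left ⟨_, (partialDeriv_polyHom j p).symm⟩
  · rintro _ ⟨φ, hφ, rfl⟩
    rw [partialDeriv_pullback]
    refine sum_mem fun i _ => mul_mem (SetLike.le_def.1 le_sup_right ⟨_, hS i φ hφ, rfl⟩)
      (SetLike.le_def.1 le_sup_left ⟨MvPolynomial.pderiv j (MvPolynomial.X (e i)), ?_⟩)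
    rw [← partialDeriv_polyHom, polyHom_X]
    rfl

theorem IsNashMap.mem_algClosure_of_sumElim (hv : IsNashMap v) (hw : IsNashMap w)
    (hinj : Function.Injective (hv.sumElim hw).pullback)
    (hcard : Fintype.card T ≤ Fintype.card (ι ⊕ κ)) [DecidableEq ι] {S : Subring (HolGerm ι)}
    (hnash : nashRing ι ≤ S) (hS : ∀ i, ∀ φ ∈ S, partialDeriv i φ ∈ S) {φ : HolGerm ι}
    (hφ : hv.pullback φ ∈ algClosure (nashRing T ⊔ S.map hv.pullback)) : φ ∈ algClosure S := by
  classical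
  let π : HolGerm ι →+* HolGerm (ι ⊕ κ) := (isNashMap_reindex Sum.inl).pullback
  have he : IsNashMap fun Z : ι → ℂ => (Sum.elim Z 0 : ι ⊕ κ → ℂ) :=
    (isNashMap_reindex id).sumElim isNashMap_zero
  have hcomp (ψ) : (hv.sumElim hw).pullback (π ψ) = hv.pullback ψ := by
    obtain ⟨g, hg, rfl⟩ := exists_eq_germOf ψ
    rfl
  have hsection (ψ) : he.pullback (π ψ) = ψ := by
    obtain ⟨g, hg, rfl⟩ := exists_eq_germOf ψ
    rfl
  have hπφ : π φ ∈ algClosure ((polyHom (ι ⊕ κ)).range ⊔ S.map π) := by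
    refine mem_algClosure_of_map_injective hinj ?_
    rw [hcomp, Subring.map_sup]
    refine algClosure_le_algClosure (sup_le ?_ ?_) hφ
    · exact ((hv.sumElim hw).nashRing_le_algClosure_map hinj hcard).trans
        (algClosure_mono le_sup_left)
    · refine le_trans ?_ (le_algClosure _)
      rintro _ ⟨ψ, hψ, rfl⟩
      exact SetLike.le_def.1 le_sup_right ⟨_, ⟨ψ, hψ, rfl⟩, hcomp ψ⟩
  have hrestrict := pullback_mem_algClosure he.analyticAt he.map_zero
    (partialDeriv_mem_range_sup_map Sum.inl hS) hπφ
  rw [hsection] at hrestrict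
  refine algClosure_mono ?_ hrestrict
  rw [Subring.map_sup]
  refine sup_le ?_ ?_
  · rintro _ ⟨_, ⟨p, rfl⟩, rfl⟩
    exact hnash (he.pullback_mem_nashRing (polyHom_mem_nashRing p))
  · rintro _ ⟨_, ⟨ψ, hψ, rfl⟩, rfl⟩
    rwa [hsection]

theorem IsNashMap.mem_algClosure_of_pullback [DecidableEq ι] (hv : IsNashMap v)
    (hsurj : ∃ᶠ t in 𝓝 0, Function.Surjective (fderiv ℂ v t)) {S : Subring (HolGerm ι)}
    (hnash : nashRing ι ≤ S) (hS : ∀ i, ∀ φ ∈ S, partialDeriv i φ ∈ S) {φ : HolGerm ι}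
    (hφ : hv.pullback φ ∈ algClosure (nashRing T ⊔ S.map hv.pullback)) : φ ∈ algClosure S := by
  obtain ⟨s, hcard, hs⟩ := exists_frequently_surjective_fderiv_sumElim hv.analyticAt hsurj
  have := Fintype.ofFinite s
  have hw : IsNashMap fun t : T → ℂ => (t ∘ Subtype.val : s → ℂ) := isNashMap_reindex Subtype.val
  refine hv.mem_algClosure_of_sumElim hw (pullback_injective _ _ hs) ?_ hnash hS hφ
  rw [Fintype.card_sum, hcard, Nat.card_eq_fintype_card]

end Descent

section RingA

variable {n m c N' : ℕ} {Q : Fin m → (Fin n ⊕ Idx n m c → ℂ) → ℂ}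
  {f : Fin N' → (Idx n m c → ℂ) → ℂ} {T : Type} [Fintype T]
  {V : (T → ℂ) → (Idx n m c ⊕ Idx n m c → ℂ)} {j : Fin c → T}

theorem jetRing_uPoint_le_ringA (f : Fin N' → (Idx n m c → ℂ) → ℂ)
    (hf : ∀ s, AnalyticAt ℂ (f s) 0) :
    jetRing f (uPoint fun k => Sum.inr (Sum.inr k)) ≤ ringA f hf := by
  refine jetRing_le (fun φ hφ => ?_) fun L s _ => ?_
  · exact le_iSup (ringALevel f hf) 0 (Subring.subset_closure (Or.inl hφ))
  · exact le_iSup (ringALevel f hf) L.length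
      (Subring.subset_closure (Or.inr ⟨L, s, le_rfl, rfl⟩))

theorem IsChain.germOf_mem_algClosure (hV : IsChain Q f V j) (hf : ∀ s, AnalyticAt ℂ (f s) 0)
    (hsym : symRing f j ≤ algClosure (jetRing f (uPoint j)))
    (hsurj : ∃ᶠ t in 𝓝 0, Function.Surjective (fderiv ℂ (fun t => V t ∘ Sum.inl) t))
    (s : Fin N') :
    germOf (f s) (hf s) ∈ algClosure (jetRing f (uPoint fun k => Sum.inr (Sum.inr k))) := by
  have hv : IsNashMap fun t => V t ∘ Sum.inl := hV.isNashMap.reindex Sum.inl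
  refine hv.mem_algClosure_of_pullback hsurj (nashRing_le_jetRing _ _)
    (fun i _ => partialDeriv_mem_jetRing hf (isNashMap_uPoint _) i)
    (algClosure_mono ?_ ((hV.jets_Z.mono hsym) [] s).2)
  refine jetRing_le le_sup_left fun L s hg => SetLike.le_def.1 le_sup_right ?_
  have hu : IsNashMap (uPoint (n := n) (m := m) fun k => (Sum.inr (Sum.inr k) : Idx n m c)) :=
    isNashMap_uPoint _
  have hL := (analyticAt_iterPartial L (hf s)).fun_comp_of_eq hu.analyticAt hu.map_zero
  refine ⟨germOf _ hL, germOf_mem_jetRing L s hL, ?_⟩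
  rw [pullback_germOf, germOf_eq_iff]
  filter_upwards [hV.uPart_eq] with t ht
  exact congrArg (fun u => iterPartial L (f s) (pt 0 0 u)) ht

end RingA

end KeyAlg

end

/-- `M ⊂ ℂ^N`, `N = n + m + c`, is a germ at `0` of a generic real-algebraic submanifold of CR
dimension `n` and codimension `d = m + c`, of constant orbit dimension at `0`, with CR orbits of
codimension `c` in `M` (i.e. of dimension `2n + m`), written in normal coordinates `(z, w, u)`. For
subrings of a domain, being algebraic over the ring is the same as being algebraic over its
quotient field. -/
theorem proposition3p2 {n m c N' : ℕ}
    (M : Set (KeyAlg.Idx n m c → ℂ))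
    (hM : KeyAlg.IsGenericRealAlgebraic M (m + c))
    (hconst : KeyAlg.HasConstantOrbitDim M 0)
    (hdim : KeyAlg.orbitDim M 0 = 2 * n + m)
    (Q : Fin m → (Fin n ⊕ KeyAlg.Idx n m c → ℂ) → ℂ)
    (hQ : KeyAlg.IsNormalForm M Q)
    (f : Fin N' → (KeyAlg.Idx n m c → ℂ) → ℂ)
    (hf : ∀ s, AnalyticAt ℂ (f s) 0)
    (hf0 : ∀ s, f s 0 = 0)
    (hclub : KeyAlg.Club Q f hf) :
    ∀ s, IsAlgebraic (KeyAlg.ringA f hf) (KeyAlg.germOf (f s) (hf s)) := by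
  obtain ⟨T, _, V, j, hV, hleaf, hleaf'⟩ := KeyAlg.exists_isChain_tangentAlong hQ hclub
  intro s
  exact KeyAlg.algClosure_mono (KeyAlg.jetRing_uPoint_le_ringA f hf)
    (hV.germOf_mem_algClosure hf (hclub.symRing_le hQ j)
      (hV.frequently_surjective_fderiv hQ hM.1 hdim hleaf hleaf') s)
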